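/- **Finite case.** Let $n\ge 0$. In the Lie algebra $\mathfrak{gl}_{2n}$ of complex $2n\times 2n$ matrices with matrix units $E_{ij}$, let $\mathfrak{gl}_n^{(1)}$ (rows and columns $1,\dots,n$) and $\mathfrak{gl}_n^{(2)}$ (rows and columns $n+1,\dots,2n$) be the two diagonal blocks, and let $\mathfrak a_-$ be the lower left block (rows $n+1,\dots,2n$, columns $1,\dots,n$), an abelian subalgebra. Let $\mathfrak{gl}_n^{(1)}\oplus\mathfrak{gl}_n^{(2)}$ act on $\mathfrak a_-$ by the adjoint action, and on the symmetric algebra $S^*(\mathfrak a_-)$ by derivations extending it. For $1\le k\le n$ put $$\mathrm{Det}_k=\det\bigl(E_{n+p,\,n-k+q}\bigr)_{p,q=1}^{k}\in S^*(\mathfrak a_-),$$ and for $l=(l_1,\dots,l_n)\in\mathbb Z_{\ge0}^n$ put $w=w_l=\mathrm{Det}_1^{l_1}\cdots\mathrm{Det}_n^{l_n}$. Let $L_w^{(i)}$ be the $\mathfrak{gl}_n^{(i)}$-submodule of $S^*(\mathfrak a_-)$ generated by $w$ ($i=1,2$), and let $W_w$ be the $\mathfrak{gl}_n^{(1)}\oplus\mathfrak{gl}_n^{(2)}$-submodule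 generated by $w$. Then for every $l$: * $w$ is non-zero, it is annihilated by the strictly upper triangular matrices of $\mathfrak{gl}_n^{(1)}\oplus\mathfrak{gl}_n^{(2)}$, and the diagonal matrices act on it by the weight $\theta_l$ with $\theta_l(E_{n+i,n+i})=l_i+l_{i+1}+\dots+l_n$ and $\theta_l(E_{n+1-i,n+1-i})=-(l_i+l_{i+1}+\dots+l_n)$ for $1\le i\le n$; * $L_w^{(1)}$ and $L_w^{(2)}$ are finite-dimensional irreducible modules over $\mathfrak{gl}_n^{(1)}$ and $\mathfrak{gl}_n^{(2)}$ (so they are the irreducible modules with highest weights given by the two restrictions of $\theta_l$); * $W_w$ is an irreducible $\mathfrak{gl}_n^{(1)}\oplus\mathfrak{gl}_n^{(2)}$-module isomorphic to the external tensor product $L_w^{(1)}\otimes L_w^{(2)}$. Moreover $S^*(\mathfrak a_-)=\bigoplus_{l\in\mathbb Z_{\ge0}^n}W_{w_l}$, so that $S^*(\mathfrak a_-)\cong\bigoplus_w L_w^{(1)}\otimes L_w^{(2)}$. The index set is in bijection with the Young diagrams with at most $n$ rows, $l$ corresponding to the diagram whose $i$-th row has length $l_i+l_{i+1}+\dots+l_n$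 for $1\le i\le n$. **Case $n=\infty$.** Let $\mathfrak K$ be the Lie algebra of complex matrices indexed by $\mathbb Z\times\mathbb Z$ with finitely many non-zero diagonals, or more generally any Lie subalgebra of it that contains all matrix units $E_{ij}$. Let $\mathfrak{gl}^{(1)}$, $\mathfrak{gl}^{(2)}$, $\mathfrak a_-$ be the subalgebras of the matrices in $\mathfrak K$ supported, respectively, on rows and columns $\le0$; on rows and columns $\ge1$; on rows $\ge1$ and columns $\le0$. Let $\mathfrak{gl}^{(1)}\oplus\mathfrak{gl}^{(2)}$ act on $S^*(\mathfrak a_-)$ as before. Put $\mathrm{Det}_k=\det(E_{p,\,-k+q})_{p,q=1}^k$, and for a Young diagram $D$ let $w_D$ be the product over the columns of $D$ of $\mathrm{Det}_k$, where $k$ is the length of the column. Let $L_D^{(i)}$ and $W_D$ be the submodules of $S^*(\mathfrak a_-)$ over $\mathfrak{gl}^{(i)}$ and over $\mathfrak{gl}^{(1)}\oplus\mathfrak{gl}^{(2)}$ generated by $w_D$. Then for every Young diagram $D$, with row lengths $\lambda_1\ge\lambda_2\ge\dots$: * $w_D$ is non-zero, it is annihilated by the strictly upper triangular matrices of $\mathfrak{gl}^{(1)}\oplus\mathfrak{gl}^{(2)}$,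 and a diagonal matrix $h=(h_j)_{j\in\mathbb Z}$ of $\mathfrak{gl}^{(1)}\oplus\mathfrak{gl}^{(2)}$ acts on it by $\theta_D(h)=\sum_{i\ge1}\lambda_i\,(h_i-h_{1-i})$; * $L_D^{(1)}$ and $L_D^{(2)}$ are irreducible modules over $\mathfrak{gl}^{(1)}$ and $\mathfrak{gl}^{(2)}$; * $W_D$ is an irreducible $\mathfrak{gl}^{(1)}\oplus\mathfrak{gl}^{(2)}$-module isomorphic to the external tensor product $L_D^{(1)}\otimes L_D^{(2)}$. Moreover $S^*(\mathfrak a_-)=\bigoplus_D W_D$, the sum being over all Young diagrams, so that $S^*(\mathfrak a_-)\cong\bigoplus_D L_D^{(1)}\otimes L_D^{(2)}$. -/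

import Mathlib

open scoped TensorProduct

-- The bracket of matrices and of endomorphisms is the commutator.
attribute [local instance 100] LieRing.ofAssociativeRing

noncomputable section

/-! ## The action of a Lie algebra on a symmetric algebra by derivations -/

namespace SymAction

variable {R M : Type*} [CommRing R] [AddCommGroup M] [Module R M]

/-- The algebra map from `S(M)` to the dual numbers `S(M)[ε]` with `m ↦ m + ε (φ m)`. -/
def dualLift (φ : M →ₗ[R] SymmetricAlgebra R M) :
    SymmetricAlgebra R M →ₐ[R]
      TrivSqZeroExt (SymmetricAlgebra R M) (SymmetricAlgebra R M) :=
  SymmetricAlgebra.lift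
    (((TrivSqZeroExt.inlAlgHom R (SymmetricAlgebra R M)
        (SymmetricAlgebra R M)).toLinearMap ∘ₗ SymmetricAlgebra.ι R M) +
      ((TrivSqZeroExt.inrHom (SymmetricAlgebra R M)
        (SymmetricAlgebra R M)).restrictScalars R ∘ₗ φ))

theorem fst_dualLift (φ : M →ₗ[R] SymmetricAlgebra R M) (s : SymmetricAlgebra R M) :
    (dualLift φ s).fst = s := by
  have h : (TrivSqZeroExt.fstHom R (SymmetricAlgebra R M) (SymmetricAlgebra R M)).comp
      (dualLift φ) = AlgHom.id R _ := by
    apply SymmetricAlgebra.algHom_ext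
    ext m
    simp [dualLift]
  exact congrArg (fun f => f s) h

/-- The derivation of `S(M)` that extends a linear map `φ : M → S(M)`. -/
def derivationOf (φ : M →ₗ[R] SymmetricAlgebra R M) :
    Derivation R (SymmetricAlgebra R M) (SymmetricAlgebra R M) :=
  Derivation.mk'
    ((TrivSqZeroExt.sndHom (SymmetricAlgebra R M)
      (SymmetricAlgebra R M)).restrictScalars R ∘ₗ (dualLift φ).toLinearMap)
    (fun a b => by
      simp [fst_dualLift, TrivSqZeroExt.snd_mul, mul_comm])

theorem derivationOf_ι (φ : M →ₗ[R] SymmetricAlgebra R M) (m : M) :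
    derivationOf φ (SymmetricAlgebra.ι R M m) = φ m := by
  simp [derivationOf, dualLift]

theorem derivation_ext {D₁ D₂ : Derivation R (SymmetricAlgebra R M) (SymmetricAlgebra R M)}
    (h : ∀ m, D₁ (SymmetricAlgebra.ι R M m) = D₂ (SymmetricAlgebra.ι R M m)) : D₁ = D₂ := by
  ext s
  induction s using SymmetricAlgebra.induction with
  | algebraMap r => simp
  | ι x => exact h x
  | mul a b ha hb => simp [ha, hb]
  | add a b ha hb => simp [ha, hb]

variable {L : Type*} [LieRing L] [LieAlgebra R L] [LieRingModule L M] [LieModule R L M]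

variable (R M) in
/-- The derivation of `S(M)` that extends the action of `x` on `M`. -/
def act (x : L) : Derivation R (SymmetricAlgebra R M) (SymmetricAlgebra R M) :=
  derivationOf (SymmetricAlgebra.ι R M ∘ₗ (LieModule.toEnd R L M x))

@[simp] theorem act_ι (x : L) (m : M) :
    act R M x (SymmetricAlgebra.ι R M m) = SymmetricAlgebra.ι R M ⁅x, m⁆ := by
  simp [act, derivationOf_ι]

theorem act_add (x y : L) : act R M (x + y) = act R M x + act R M y :=
  derivation_ext fun m => by simp

theorem act_smul (r : R) (x : L) : act R M (r • x) = r • act R M x :=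
  derivation_ext fun m => by simp

theorem act_lie (x y : L) : act R M ⁅x, y⁆ = ⁅act R M x, act R M y⁆ :=
  derivation_ext fun m => by simp [Derivation.commutator_apply]

variable (R M L) in
/-- `S(M)` as a module over `L`: the action of `L` on `M`, extended by derivations. -/
@[reducible] def symLieRingModule : LieRingModule L (SymmetricAlgebra R M) where
  bracket x s := act R M x s
  add_lie x y s := by simp [act_add]
  lie_add x s t := by simp
  leibniz_lie x y s := by simp [act_lie, Derivation.commutator_apply]

variable (R M L) in
/-- The action on `S(M)` is linear in both arguments. -/
theorem symLieModule :
    letI := symLieRingModule R M L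
    LieModule R L (SymmetricAlgebra R M) :=
  letI := symLieRingModule R M L
  { smul_lie := fun r x s => by
      change act R M (r • x) s = r • act R M x s
      simp [act_smul]
    lie_smul := fun r x s => by
      change act R M x (r • s) = r • act R M x s
      simp }

end SymAction

/-! ## Highest weight vectors and external tensor products -/

/-- `v` is a highest weight vector of weight `χ` with respect to the set `nPlus` of raising
elements and the set `cartan` of elements of the Cartan subalgebra. -/
structure IsHighestWeightVector {L M : Type*} [LieRing L] [AddCommGroup M] [Module ℂ M]
    [LieRingModule L M] (nPlus cartan : Set L) (χ : L → ℂ) (v : M) : Prop where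
  ne_zero : v ≠ 0
  raising : ∀ x ∈ nPlus, ⁅x, v⁆ = 0
  weight : ∀ x ∈ cartan, ⁅x, v⁆ = χ x • v

/-- The module `N` over `k = g₁ ⊕ g₂` is isomorphic to the external tensor product of the
`g₁`-module `M₁` and the `g₂`-module `M₂`, on which `x + y` (`x ∈ g₁`, `y ∈ g₂`) acts by
`u ⊗ v ↦ x u ⊗ v + u ⊗ y v`. -/
def IsExternalTensor {k : Type*} [LieRing k] [LieAlgebra ℂ k] (g₁ g₂ : LieSubalgebra ℂ k)
    (M₁ M₂ N : Type*) [AddCommGroup M₁] [Module ℂ M₁] [LieRingModule g₁ M₁]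
    [AddCommGroup M₂] [Module ℂ M₂] [LieRingModule g₂ M₂]
    [AddCommGroup N] [Module ℂ N] [LieRingModule k N] : Prop :=
  ∃ e : (M₁ ⊗[ℂ] M₂) ≃ₗ[ℂ] N, ∀ (x : g₁) (y : g₂) (u : M₁) (v : M₂),
    e (⁅x, u⁆ ⊗ₜ[ℂ] v + u ⊗ₜ[ℂ] ⁅y, v⁆) = ⁅(x : k) + (y : k), e (u ⊗ₜ[ℂ] v)⁆

/-! ## The finite case: `2n × 2n` matrices -/

namespace FinGL

/-- The Lie algebra `gl_{2n}`; `Sum.inl i` is the index `i + 1` and `Sum.inr i` is the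
index `n + i + 1`. -/
abbrev gl (n : ℕ) : Type := Matrix (Fin n ⊕ Fin n) (Fin n ⊕ Fin n) ℂ

/-- The block diagonal subalgebra `gl_n⁽¹⁾ ⊕ gl_n⁽²⁾` of `gl_{2n}`. -/
def glDiag (n : ℕ) : LieSubalgebra ℂ (gl n) where
  carrier := {X | (∀ i j, X (.inl i) (.inr j) = 0) ∧ ∀ i j, X (.inr i) (.inl j) = 0}
  add_mem' := by
    rintro X Y ⟨h1, h2⟩ ⟨h3, h4⟩
    exact ⟨fun i j => by simp [h1, h3], fun i j => by simp [h2, h4]⟩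
  zero_mem' := by simp
  smul_mem' := by
    rintro c X ⟨h1, h2⟩
    exact ⟨fun i j => by simp [h1], fun i j => by simp [h2]⟩
  lie_mem' := by
    rintro X Y ⟨h1, h2⟩ ⟨h3, h4⟩
    exact ⟨fun i j => by simp [Ring.lie_def, Matrix.mul_apply, h1, h3],
      fun i j => by simp [Ring.lie_def, Matrix.mul_apply, h2, h4]⟩

/-- `gl_n⁽¹⁾`, the upper left block. -/
def gl₁ (n : ℕ) : LieSubalgebra ℂ (glDiag n) where
  carrier := {X | ∀ i j, (X : gl n) (.inr i) (.inr j) = 0}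
  add_mem' := fun h1 h2 i j => by
    simpa using congrArg₂ (· + ·) (h1 i j) (h2 i j)
  zero_mem' := fun i j => by simp
  smul_mem' := fun c X h i j => by
    simpa using Or.inr (h i j)
  lie_mem' := by
    rintro ⟨X, hX⟩ ⟨Y, hY⟩ h1 h2 i j
    have h1' : ∀ i j, X (.inr i) (.inr j) = 0 := h1
    have h2' : ∀ i j, Y (.inr i) (.inr j) = 0 := h2
    simp [Ring.lie_def, Matrix.mul_apply, h1', h2', hX.2, hY.2]

/-- `gl_n⁽²⁾`, the lower right block. -/
def gl₂ (n : ℕ) : LieSubalgebra ℂ (glDiag n) where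
  carrier := {X | ∀ i j, (X : gl n) (.inl i) (.inl j) = 0}
  add_mem' := fun h1 h2 i j => by
    simpa using congrArg₂ (· + ·) (h1 i j) (h2 i j)
  zero_mem' := fun i j => by simp
  smul_mem' := fun c X h i j => by
    simpa using Or.inr (h i j)
  lie_mem' := by
    rintro ⟨X, hX⟩ ⟨Y, hY⟩ h1 h2 i j
    have h1' : ∀ i j, X (.inl i) (.inl j) = 0 := h1
    have h2' : ∀ i j, Y (.inl i) (.inl j) = 0 := h2
    simp [Ring.lie_def, Matrix.mul_apply, h1', h2', hX.1, hY.1]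

/-- The abelian subalgebra `𝔞₋` of `gl_{2n}` (the lower left block), as a module over the block
diagonal subalgebra under the adjoint action. -/
def aMinus (n : ℕ) : LieSubmodule ℂ (glDiag n) (gl n) where
  carrier := {X | (∀ i j, X (.inl i) j = 0) ∧ ∀ i j, X i (.inr j) = 0}
  add_mem' := by
    rintro X Y ⟨h1, h2⟩ ⟨h3, h4⟩
    exact ⟨fun i j => by simp [h1, h3], fun i j => by simp [h2, h4]⟩
  zero_mem' := by simp
  smul_mem' := by
    rintro c X ⟨h1, h2⟩
    exact ⟨fun i j => by simp [h1], fun i j => by simp [h2]⟩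
  lie_mem := by
    rintro ⟨X, hX1, hX2⟩ Y ⟨h1, h2⟩
    change _ ∧ _
    exact ⟨fun i j => by
        simp [LieSubalgebra.coe_bracket_of_module, Ring.lie_def, Matrix.mul_apply, hX1, h1],
      fun i j => by
        simp [LieSubalgebra.coe_bracket_of_module, Ring.lie_def, Matrix.mul_apply, hX1, h2]⟩

/-- The symmetric algebra `S*(𝔞₋)`. -/
abbrev symA (n : ℕ) : Type := SymmetricAlgebra ℂ (aMinus n)

/-- The adjoint action of `gl_n⁽¹⁾ ⊕ gl_n⁽²⁾` on `S*(𝔞₋)`. -/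
instance (n : ℕ) : LieRingModule (glDiag n) (symA n) :=
  SymAction.symLieRingModule ℂ (aMinus n) (glDiag n)

instance (n : ℕ) : LieModule ℂ (glDiag n) (symA n) :=
  SymAction.symLieModule ℂ (aMinus n) (glDiag n)

/-- The matrix unit of `𝔞₋` in row `i` and column `j` of the lower left block. -/
def unitA (n : ℕ) (i j : Fin n) : aMinus n :=
  ⟨Matrix.single (.inr i) (.inl j) 1, by
    change _ ∧ _
    simp⟩

/-- `det n k` is the determinant `Det_{k+1}` of the upper right `(k+1) × (k+1)` corner of the
lower left block. -/
def det (n : ℕ) (k : Fin n) : symA n :=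
  Matrix.det (Matrix.of fun p q : Fin (k + 1) =>
    SymmetricAlgebra.ι ℂ (aMinus n)
      (unitA n ⟨p, by omega⟩ ⟨n - (k + 1) + q, by omega⟩))

/-- The monomial `Det_1 ^ l_1 ⋯ Det_n ^ l_n`. -/
def monomial (n : ℕ) (l : Fin n → ℕ) : symA n := ∏ k, det n k ^ l k

/-- `𝔫₊⁽¹⁾ ⊕ 𝔫₊⁽²⁾`: strictly upper triangular matrices in both blocks. -/
def nPlus (n : ℕ) : Set (glDiag n) :=
  {X | ∀ i j, j ≤ i →
    (X : gl n) (.inl i) (.inl j) = 0 ∧ (X : gl n) (.inr i) (.inr j) = 0}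

/-- `𝔥⁽¹⁾ ⊕ 𝔥⁽²⁾`: diagonal matrices. -/
def cartan (n : ℕ) : Set (glDiag n) := {X | (X : gl n).IsDiag}

/-- The weight `θ_l`: its value on `E_{n+i+1,n+i+1}` is `∑_{k ≥ i} l_{k+1}`, and its value on
`E_{n-i,n-i}` is the negative of that (`0 ≤ i < n`). -/
def theta (n : ℕ) (l : Fin n → ℕ) (X : glDiag n) : ℂ :=
  ∑ i : Fin n, ((∑ k ∈ Finset.Ici i, l k : ℕ) : ℂ) *
    ((X : gl n) (.inr i) (.inr i) - (X : gl n) (.inl i.rev) (.inl i.rev))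

/-- `L_w` over `gl_n⁽¹⁾`: the `gl_n⁽¹⁾`-submodule generated by the monomial `w`. -/
abbrev L₁ (n : ℕ) (l : Fin n → ℕ) : LieSubmodule ℂ (gl₁ n) (symA n) :=
  LieSubmodule.lieSpan ℂ (gl₁ n) {monomial n l}

/-- `L_w` over `gl_n⁽²⁾`: the `gl_n⁽²⁾`-submodule generated by the monomial `w`. -/
abbrev L₂ (n : ℕ) (l : Fin n → ℕ) : LieSubmodule ℂ (gl₂ n) (symA n) :=
  LieSubmodule.lieSpan ℂ (gl₂ n) {monomial n l}

/-- The `gl_n⁽¹⁾ ⊕ gl_n⁽²⁾`-submodule generated by the monomial `w`. -/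
abbrev W (n : ℕ) (l : Fin n → ℕ) : LieSubmodule ℂ (glDiag n) (symA n) :=
  LieSubmodule.lieSpan ℂ (glDiag n) {monomial n l}

end FinGL

/-! ## The case `n = ∞`: matrices indexed by the integers -/

namespace InfGL

/-- Matrices indexed by `ℤ × ℤ` with finitely many non-zero entries in every column, as linear
endomorphisms of the space with basis `(e_j)`, `j ∈ ℤ`. -/
def Op : Type := Module.End ℂ (ℤ →₀ ℂ)

instance : Ring Op := inferInstanceAs (Ring (Module.End ℂ (ℤ →₀ ℂ)))

instance : Algebra ℂ Op := inferInstanceAs (Algebra ℂ (Module.End ℂ (ℤ →₀ ℂ)))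

instance : FunLike Op (ℤ →₀ ℂ) (ℤ →₀ ℂ) :=
  inferInstanceAs (FunLike (Module.End ℂ (ℤ →₀ ℂ)) (ℤ →₀ ℂ) (ℤ →₀ ℂ))

instance : LinearMapClass Op ℂ (ℤ →₀ ℂ) (ℤ →₀ ℂ) :=
  inferInstanceAs (LinearMapClass (Module.End ℂ (ℤ →₀ ℂ)) ℂ (ℤ →₀ ℂ) (ℤ →₀ ℂ))

/-- The entry of a matrix in row `i` and column `j`. -/
def entry (f : Op) (i j : ℤ) : ℂ := f (Finsupp.single j 1) i

/-- The matrix unit `E_{ij}`. -/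
def unit (i j : ℤ) : Op :=
  (Finsupp.lsingle i ∘ₗ Finsupp.lapply j : Module.End ℂ (ℤ →₀ ℂ))

@[simp] theorem entry_unit (i j a b : ℤ) :
    entry (unit i j) a b = if a = i ∧ b = j then 1 else 0 := by
  change (Finsupp.single i ((Finsupp.single b (1 : ℂ)) j)) a = _
  by_cases h : b = j <;> by_cases h' : a = i <;> simp [h, h']

@[simp] theorem entry_zero (i j : ℤ) : entry 0 i j = 0 := rfl

@[simp] theorem entry_add (f g : Op) (i j : ℤ) :
    entry (f + g) i j = entry f i j + entry g i j := rfl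

@[simp] theorem entry_smul (c : ℂ) (f : Op) (i j : ℤ) :
    entry (c • f) i j = c * entry f i j := rfl

@[simp] theorem entry_sub (f g : Op) (i j : ℤ) :
    entry (f - g) i j = entry f i j - entry g i j := rfl

theorem entry_mul (f g : Op) (i j : ℤ) :
    entry (f * g) i j =
      (g (Finsupp.single j 1)).sum fun m c => c * entry f i m := by
  have h : g (Finsupp.single j 1) =
      (g (Finsupp.single j 1)).sum fun m c => c • Finsupp.single m (1 : ℂ) := by
    simp
  change f (g (Finsupp.single j 1)) i = _
  unfold entry
  conv_lhs => rw [h]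
  rw [map_finsuppSum, Finsupp.sum, Finsupp.finsetSum_apply, Finsupp.sum]
  refine Finset.sum_congr rfl fun m _ => ?_
  rw [map_smul, Finsupp.smul_apply, smul_eq_mul]

theorem entry_mul_eq_zero (f g : Op) (i j : ℤ)
    (h : ∀ m, entry f i m = 0 ∨ entry g m j = 0) : entry (f * g) i j = 0 := by
  rw [entry_mul]
  refine Finset.sum_eq_zero fun m _ => ?_
  rcases h m with h | h
  · simp [h]
  · have h' : g (Finsupp.single j 1) m = 0 := h
    simp [h']

theorem op_ext {f g : Op} (h : ∀ i j, entry f i j = entry g i j) : f = g := by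
  refine Finsupp.lhom_ext' fun j => LinearMap.ext_ring ?_
  ext i
  exact h i j

/-- The Lie algebra `gl_∞` of matrices indexed by `ℤ × ℤ` with finitely many non-zero
diagonals. -/
def glInf : LieSubalgebra ℂ Op where
  carrier := {f | ∃ d : ℤ, ∀ i j, d < |i - j| → entry f i j = 0}
  add_mem' := by
    rintro f g ⟨d, hd⟩ ⟨e, he⟩
    refine ⟨max d e, fun i j h => ?_⟩
    rw [entry_add, hd i j (lt_of_le_of_lt (le_max_left _ _) h),
      he i j (lt_of_le_of_lt (le_max_right _ _) h), add_zero]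
  zero_mem' := ⟨0, fun _ _ _ => rfl⟩
  smul_mem' := by
    rintro c f ⟨d, hd⟩
    exact ⟨d, fun i j h => by rw [entry_smul, hd i j h, mul_zero]⟩
  lie_mem' := by
    have key : ∀ (f g : Op) (d e : ℤ), (∀ i j, d < |i - j| → entry f i j = 0) →
        (∀ i j, e < |i - j| → entry g i j = 0) →
        ∀ i j, d + e < |i - j| → entry (f * g) i j = 0 := by
      intro f g d e hd he i j h
      refine entry_mul_eq_zero f g i j fun m => ?_
      by_cases h1 : d < |i - m|
      · exact Or.inl (hd i m h1)
      · refine Or.inr (he m j ?_)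
        have := abs_sub_le i m j
        omega
    rintro f g ⟨d, hd⟩ ⟨e, he⟩
    refine ⟨d + e, fun i j h => ?_⟩
    rw [Ring.lie_def, entry_sub, key f g d e hd he i j h,
      key g f e d he hd i j (by omega), sub_zero]

/-- The matrix is supported in the upper left block, of rows and columns `≤ 0`. -/
def InBlock₁ (f : Op) : Prop := ∀ i j, ¬ (i ≤ 0 ∧ j ≤ 0) → entry f i j = 0

/-- The matrix is supported in the lower right block, of rows and columns `≥ 1`. -/
def InBlock₂ (f : Op) : Prop := ∀ i j, ¬ (1 ≤ i ∧ 1 ≤ j) → entry f i j = 0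

/-- The matrix is supported in the lower left block, of rows `≥ 1` and columns `≤ 0`. -/
def InBlockA (f : Op) : Prop := ∀ i j, ¬ (1 ≤ i ∧ j ≤ 0) → entry f i j = 0

theorem entry_lie (f g : Op) (i j : ℤ) :
    entry ⁅f, g⁆ i j = entry (f * g) i j - entry (g * f) i j := rfl

theorem InBlock₁.mul {f g : Op} (hf : InBlock₁ f) (hg : InBlock₁ g) : InBlock₁ (f * g) :=
  fun i j h => entry_mul_eq_zero f g i j fun m => by
    by_cases hi : i ≤ 0
    · exact Or.inr (hg m j (by omega))
    · exact Or.inl (hf i m (by omega))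

theorem InBlock₂.mul {f g : Op} (hf : InBlock₂ f) (hg : InBlock₂ g) : InBlock₂ (f * g) :=
  fun i j h => entry_mul_eq_zero f g i j fun m => by
    by_cases hi : 1 ≤ i
    · exact Or.inr (hg m j (by omega))
    · exact Or.inl (hf i m (by omega))

theorem InBlock₁.mul_block₂ {f g : Op} (hf : InBlock₁ f) (hg : InBlock₂ g) : f * g = 0 :=
  op_ext fun i j => entry_mul_eq_zero f g i j fun m => by
    by_cases hm : m ≤ 0
    · exact Or.inr (hg m j (by omega))
    · exact Or.inl (hf i m (by omega))

theorem InBlock₂.mul_block₁ {f g : Op} (hf : InBlock₂ f) (hg : InBlock₁ g) : f * g = 0 :=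
  op_ext fun i j => entry_mul_eq_zero f g i j fun m => by
    by_cases hm : m ≤ 0
    · exact Or.inl (hf i m (by omega))
    · exact Or.inr (hg m j (by omega))

variable (K : LieSubalgebra ℂ Op)

/-- The block diagonal subalgebra `gl⁽¹⁾ ⊕ gl⁽²⁾` of the matrix Lie algebra `K`: sums of a matrix
of `K` in the upper left block and a matrix of `K` in the lower right block. -/
def glDiag : LieSubalgebra ℂ Op where
  carrier := {f | ∃ g ∈ K, ∃ h ∈ K, InBlock₁ g ∧ InBlock₂ h ∧ f = g + h}
  add_mem' := by
    rintro _ _ ⟨g, hg, h, hh, hg1, hh2, rfl⟩ ⟨g', hg', h', hh', hg1', hh2', rfl⟩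
    refine ⟨g + g', K.add_mem hg hg', h + h', K.add_mem hh hh', fun i j hij => ?_,
      fun i j hij => ?_, by abel⟩
    · simp [hg1 i j hij, hg1' i j hij]
    · simp [hh2 i j hij, hh2' i j hij]
  zero_mem' := ⟨0, K.zero_mem, 0, K.zero_mem, fun _ _ _ => rfl, fun _ _ _ => rfl, by simp⟩
  smul_mem' := by
    rintro c _ ⟨g, hg, h, hh, hg1, hh2, rfl⟩
    refine ⟨c • g, K.smul_mem c hg, c • h, K.smul_mem c hh, fun i j hij => ?_,
      fun i j hij => ?_, by simp⟩
    · simp [hg1 i j hij]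
    · simp [hh2 i j hij]
  lie_mem' := by
    rintro _ _ ⟨g, hg, h, hh, hg1, hh2, rfl⟩ ⟨g', hg', h', hh', hg1', hh2', rfl⟩
    refine ⟨⁅g, g'⁆, K.lie_mem hg hg', ⁅h, h'⁆, K.lie_mem hh hh', fun i j hij => ?_,
      fun i j hij => ?_, ?_⟩
    · rw [entry_lie, hg1.mul hg1' i j hij, hg1'.mul hg1 i j hij, sub_zero]
    · rw [entry_lie, hh2.mul hh2' i j hij, hh2'.mul hh2 i j hij, sub_zero]
    · change (g + h) * (g' + h') - (g' + h') * (g + h) =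
        (g * g' - g' * g) + (h * h' - h' * h)
      simp only [add_mul, mul_add, hg1.mul_block₂ hh2', hg1'.mul_block₂ hh2,
        hh2.mul_block₁ hg1', hh2'.mul_block₁ hg1]
      abel

theorem glDiag_le : glDiag K ≤ K := by
  rintro _ ⟨g, hg, h, hh, -, -, rfl⟩
  exact K.add_mem hg hh

theorem entry_glDiag (f : glDiag K) (i j : ℤ) (h : ¬ ((i ≤ 0 ∧ j ≤ 0) ∨ (1 ≤ i ∧ 1 ≤ j))) :
    entry f i j = 0 := by
  obtain ⟨_, g, -, g', -, h1, h2, rfl⟩ := f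
  simp [h1 i j (by omega), h2 i j (by omega)]

/-- `gl⁽¹⁾`, the upper left block. -/
def gl₁ : LieSubalgebra ℂ (glDiag K) where
  carrier := {f | InBlock₁ f}
  add_mem' := fun {f g} hf hg i j h => by simp [hf i j h, hg i j h]
  zero_mem' := fun i j _ => rfl
  smul_mem' := fun c f hf i j h => by simp [hf i j h]
  lie_mem' := fun {f g} hf hg i j h => by
    rw [LieSubalgebra.coe_bracket, Ring.lie_def, entry_sub, InBlock₁.mul hf hg i j h,
      InBlock₁.mul hg hf i j h, sub_zero]

/-- `gl⁽²⁾`, the lower right block. -/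
def gl₂ : LieSubalgebra ℂ (glDiag K) where
  carrier := {f | InBlock₂ f}
  add_mem' := fun {f g} hf hg i j h => by simp [hf i j h, hg i j h]
  zero_mem' := fun i j _ => rfl
  smul_mem' := fun c f hf i j h => by simp [hf i j h]
  lie_mem' := fun {f g} hf hg i j h => by
    rw [LieSubalgebra.coe_bracket, Ring.lie_def, entry_sub, InBlock₂.mul hf hg i j h,
      InBlock₂.mul hg hf i j h, sub_zero]

/-- The abelian subalgebra `𝔞₋` of `K` (the lower left block), as a module over the block
diagonal subalgebra under the adjoint action. -/
def aMinus : LieSubmodule ℂ (glDiag K) Op where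
  carrier := {f | f ∈ K ∧ InBlockA f}
  add_mem' := by
    rintro f g ⟨hf, hf'⟩ ⟨hg, hg'⟩
    exact ⟨K.add_mem hf hg, fun i j h => by simp [hf' i j h, hg' i j h]⟩
  zero_mem' := ⟨K.zero_mem, fun i j _ => rfl⟩
  smul_mem' := by
    rintro c f ⟨hf, hf'⟩
    exact ⟨K.smul_mem c hf, fun i j h => by simp [hf' i j h]⟩
  lie_mem := by
    rintro x f ⟨hf, hf'⟩
    refine ⟨K.lie_mem (glDiag_le K x.2) hf, fun i j h => ?_⟩
    rw [LieSubalgebra.coe_bracket_of_module, entry_lie, entry_mul_eq_zero, entry_mul_eq_zero, sub_zero]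
    · intro m
      by_cases hm : 1 ≤ i ∧ m ≤ 0
      · exact Or.inr (entry_glDiag K x m j (by omega))
      · exact Or.inl (hf' i m hm)
    · intro m
      by_cases hm : 1 ≤ m ∧ j ≤ 0
      · exact Or.inl (entry_glDiag K x i m (by omega))
      · exact Or.inr (hf' m j hm)

/-- The symmetric algebra `S*(𝔞₋)`. -/
abbrev symA : Type := SymmetricAlgebra ℂ (aMinus K)

/-- The adjoint action of `gl⁽¹⁾ ⊕ gl⁽²⁾` on `S*(𝔞₋)`. -/
instance : LieRingModule (glDiag K) (symA K) :=
  SymAction.symLieRingModule ℂ (aMinus K) (glDiag K)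

instance : LieModule ℂ (glDiag K) (symA K) :=
  SymAction.symLieModule ℂ (aMinus K) (glDiag K)

variable (hK : ∀ i j : ℤ, unit i j ∈ K)

/-- The matrix unit `E_{p+1,-q}` of `𝔞₋` (`p, q ≥ 0`). -/
def unitA (p q : ℕ) : aMinus K :=
  ⟨unit (p + 1) (-q), hK _ _, fun i j h => by
    rw [entry_unit, if_neg (by omega)]⟩

/-- The determinant `Det_k` of the upper right `k × k` corner of the lower left block: the rows
are `1, …, k` and the columns are `-k+1, …, 0`. -/
def det (k : ℕ) : symA K :=
  Matrix.det (Matrix.of fun p q : Fin k =>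
    SymmetricAlgebra.ι ℂ (aMinus K) (unitA K hK p q.rev))

/-- The monomial of a Young diagram: the product of `Det_k` over its columns, where `k` is the
length of the column. -/
def monomial (D : YoungDiagram) : symA K :=
  ∏ c ∈ Finset.range (D.rowLen 0), det K hK (D.colLen c)

/-- `𝔫₊⁽¹⁾ ⊕ 𝔫₊⁽²⁾`: strictly upper triangular matrices in both blocks. -/
def nPlus : Set (glDiag K) := {f | ∀ i j, j ≤ i → entry f i j = 0}

/-- `𝔥⁽¹⁾ ⊕ 𝔥⁽²⁾`: diagonal matrices. -/
def cartan : Set (glDiag K) := {f | ∀ i j, i ≠ j → entry f i j = 0}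

/-- The weight `θ_D`: its value on `E_{r+1,r+1}` is the length of the row `r` of `D`, and its
value on `E_{-r,-r}` is the negative of that (`r ≥ 0`). -/
def theta (D : YoungDiagram) (f : glDiag K) : ℂ :=
  ∑ r ∈ Finset.range (D.colLen 0),
    (D.rowLen r : ℂ) * (entry f (r + 1) (r + 1) - entry f (-r) (-r))

/-- `L_D` over `gl⁽¹⁾`: the `gl⁽¹⁾`-submodule generated by the monomial of `D`. -/
abbrev L₁ (D : YoungDiagram) : LieSubmodule ℂ (gl₁ K) (symA K) :=
  LieSubmodule.lieSpan ℂ (gl₁ K) {monomial K hK D}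

/-- `L_D` over `gl⁽²⁾`: the `gl⁽²⁾`-submodule generated by the monomial of `D`. -/
abbrev L₂ (D : YoungDiagram) : LieSubmodule ℂ (gl₂ K) (symA K) :=
  LieSubmodule.lieSpan ℂ (gl₂ K) {monomial K hK D}

/-- The `gl⁽¹⁾ ⊕ gl⁽²⁾`-submodule generated by the monomial of `D`. -/
abbrev W (D : YoungDiagram) : LieSubmodule ℂ (glDiag K) (symA K) :=
  LieSubmodule.lieSpan ℂ (glDiag K) {monomial K hK D}

end InfGL

end

noncomputable section

/-! In coordinates `S*(𝔞₋)` is the algebra of polynomials in the entries of a matrix. There `gl⁽²⁾`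
acts by the row polarizations `rowOp` and `gl⁽¹⁾` by the negatives of the column polarizations
`colOp`. The two cases differ only in the index set of the rows and columns, so both are instances
of one structure, `PolarizationModel`.

The main tool is the Fischer form, for which multiplication by a variable is adjoint to
differentiation. It is positive definite, and transposed matrix units act by adjoint operators. If
`w` is singular, its cyclic module is obtained from `w` by lowering operators, so a raised vector
orthogonal to `w` is orthogonal to the whole module (`IsUnitaryFamily.orthogonal_lieSpan`). Hence
the raised vectors of the module are multiples of `w`. Every non-zero submodule contains a raised
vector, because raising operators decrease the well-founded `size`; this gives irreducibility
without finite dimension. For the external tensor product, the commuting actions define a map `u ⊗ v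
↦ φ u v`, and the Gram identity `gram_tensorMap` makes it injective.

Products of minors are highest weight vectors because the operators are derivations. Their modules
are pairwise orthogonal, since distinct weights are distinct eigenvalues of self-adjoint operators.
They exhaust the space for two reasons. Gaussian elimination shows that a raised polynomial is
determined by its values on diagonal matrices, so there is at most one of each weight up to a scalar
(`IsRaised.eq_smul`). Positivity forces weights to be dominant (`IsRaised.antitone`), and each
dominant weight is that of a product of minors. A non-zero orthogonal complement would contain a
raised weight vector, which is then a multiple of a product of minors and orthogonal to itself.
Orthogonal projections exist because one works in finite-dimensional spaces of polynomials of
bounded degree in finitely many variables. -/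

/-- A positive definite Hermitian form. -/
structure IsPosDefForm {V : Type*} [AddCommGroup V] [Module ℂ V]
    (B : V →ₗ⋆[ℂ] V →ₗ[ℂ] ℂ) : Prop where
  conj_symm : ∀ u v, starRingEnd ℂ (B v u) = B u v
  nonneg : ∀ u, 0 ≤ (B u u).re
  definite : ∀ u, B u u = 0 → u = 0

/-! ### Orthogonality for a positive definite Hermitian form -/

namespace IsPosDefForm

variable {V : Type*} [AddCommGroup V] [Module ℂ V] {B : V →ₗ⋆[ℂ] V →ₗ[ℂ] ℂ}

theorem eq_zero_comm (hB : IsPosDefForm B) {u v : V} : B u v = 0 ↔ B v u = 0 := by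
  rw [← hB.conj_symm u v]
  simp

/-- `V` need not be complete, but a finite-dimensional `F` always has an orthogonal complement. The
form is turned into a local inner product in order to use this. -/
theorem exists_orthogonal_projection (hB : IsPosDefForm B) (F : Submodule ℂ V)
    [FiniteDimensional ℂ F] (v : V) : ∃ f ∈ F, ∀ g ∈ F, B g (v - f) = 0 := by
  let core : InnerProductSpace.Core ℂ V :=
    { inner := fun u v => B u v
      conj_inner_symm := fun u v => hB.conj_symm u v
      re_inner_nonneg := fun u => hB.nonneg u
      add_left := fun u v w => by simp
      smul_left := fun u v r => by simp
      definite := fun u => hB.definite u }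
  let _ : NormedAddCommGroup V := core.toNormedAddCommGroup
  let _ : InnerProductSpace ℂ V := InnerProductSpace.ofCore core.toCore
  obtain ⟨y, hy, z, hz, rfl⟩ := F.exists_add_mem_mem_orthogonal v
  refine ⟨y, hy, fun g hg => ?_⟩
  rw [add_sub_cancel_left]
  exact (Submodule.mem_orthogonal F z).1 hz g hg

/-- The pullback of a positive definite form along an injective map. -/
theorem comp {S : Type*} [AddCommGroup S] [Module ℂ S] (hB : IsPosDefForm B) (Φ : S →ₗ[ℂ] V)
    (hΦ : Function.Injective Φ) : IsPosDefForm ((B.comp Φ).compl₂ Φ) where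
  conj_symm u v := hB.conj_symm _ _
  nonneg u := hB.nonneg _
  definite u h := hΦ (by rw [map_zero]; exact hB.definite _ h)

/-- The vectors that are orthogonal to a given set. -/
def orthogonal (B : V →ₗ⋆[ℂ] V →ₗ[ℂ] ℂ) (s : Set V) : Submodule ℂ V where
  carrier := {u | ∀ v ∈ s, B v u = 0}
  add_mem' := fun hu hu' v hv => by rw [map_add, hu v hv, hu' v hv, add_zero]
  zero_mem' := fun v _ => map_zero _
  smul_mem' := fun c u hu v hv => by rw [map_smul, hu v hv, smul_zero]

end IsPosDefForm

/-! ### Cyclic modules of singular vectors under a contravariant form -/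

/-- A family `e` of elements of a Lie algebra that spans its action on a module `V`, with an
involution `st` such that `e k` and `e (st k)` are adjoint for the form `B`. -/
structure IsUnitaryFamily {𝔤 V κ : Type*} [LieRing 𝔤] [LieAlgebra ℂ 𝔤] [AddCommGroup V] [Module ℂ V]
    [LieRingModule 𝔤 V] (B : V →ₗ⋆[ℂ] V →ₗ[ℂ] ℂ) (e : κ → 𝔤) (st : κ → κ) : Prop where
  mem_span : ∀ (x : 𝔤) (v : V), ⁅x, v⁆ ∈ Submodule.span ℂ (Set.range fun k => ⁅e k, v⁆)
  adjoint : ∀ k u v, B ⁅e k, u⁆ v = B u ⁅e (st k), v⁆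

/-- `w` is killed by the elements `e k`, `k ∈ pos`, and is an eigenvector of the elements `e k`
that are neither raising nor lowering. -/
structure IsSingular {𝔤 V κ : Type*} [LieRing 𝔤] [AddCommGroup V] [Module ℂ V]
    [LieRingModule 𝔤 V] (e : κ → 𝔤) (st : κ → κ) (pos : Set κ) (w : V) : Prop where
  raising : ∀ k ∈ pos, ⁅e k, w⁆ = 0
  cases : ∀ k, k ∈ pos ∨ st k ∈ pos ∨ ∃ c : ℂ, ⁅e k, w⁆ = c • w

namespace IsUnitaryFamily

variable {𝔤 V κ : Type*} [LieRing 𝔤] [LieAlgebra ℂ 𝔤] [AddCommGroup V] [Module ℂ V]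
  [LieRingModule 𝔤 V] [LieModule ℂ 𝔤 V] {B : V →ₗ⋆[ℂ] V →ₗ[ℂ] ℂ} {e : κ → 𝔤} {st : κ → κ}
  {pos : Set κ}

-- The span condition is imposed at each vector separately: a matrix with infinitely many entries
-- need not be a finite combination of matrix units, but its value at a given vector is.
omit [LieModule ℂ 𝔤 V] in
theorem lie_mem (he : IsUnitaryFamily B e st) {p : Submodule ℂ V} {v : V}
    (hp : ∀ k, ⁅e k, v⁆ ∈ p) (x : 𝔤) : ⁅x, v⁆ ∈ p :=
  Submodule.span_le.2 (Set.range_subset_iff.2 hp) (he.mem_span x v)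

omit [LieModule ℂ 𝔤 V] in
/-- A subspace that is stable under the family is a Lie submodule. -/
def toLieSubmodule (he : IsUnitaryFamily B e st) (p : Submodule ℂ V)
    (hp : ∀ k, ∀ v ∈ p, ⁅e k, v⁆ ∈ p) : LieSubmodule ℂ 𝔤 V :=
  { p with lie_mem := fun {x v} hv => he.lie_mem (fun k => hp k v hv) x }

omit [LieModule ℂ 𝔤 V] in
theorem lieSpan_le (he : IsUnitaryFamily B e st) {w : V} {p : Submodule ℂ V} (hw : w ∈ p)
    (hp : ∀ k, ∀ v ∈ p, ⁅e k, v⁆ ∈ p) :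
    (LieSubmodule.lieSpan ℂ 𝔤 {w}).toSubmodule ≤ p := fun v hv => by
  have h : LieSubmodule.lieSpan ℂ 𝔤 {w} ≤ he.toLieSubmodule p hp :=
    LieSubmodule.lieSpan_le.2 (Set.singleton_subset_iff.2 hw)
  exact h hv

/-- The module generated by a singular vector is generated by means of lowering operators. -/
theorem lieSpan_le_of_lowering (he : IsUnitaryFamily B e st) {w : V}
    (hw : IsSingular e st pos w) {p : Submodule ℂ V} (hwp : w ∈ p)
    (hp : ∀ k, st k ∈ pos → ∀ v ∈ p, ⁅e k, v⁆ ∈ p) :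
    (LieSubmodule.lieSpan ℂ 𝔤 {w}).toSubmodule ≤ p := by
  -- The smallest subspace that contains `w` and is stable under lowering. It remains to see that
  -- all of `𝔤` preserves it.
  let S : Submodule ℂ V := sInf {q | w ∈ q ∧ ∀ k, st k ∈ pos → ∀ v ∈ q, ⁅e k, v⁆ ∈ q}
  have hSw : w ∈ S := Submodule.mem_sInf.2 fun q hq => hq.1
  have hSlow : ∀ k, st k ∈ pos → ∀ v ∈ S, ⁅e k, v⁆ ∈ S := fun k hk v hv =>
    Submodule.mem_sInf.2 fun q hq => hq.2 k hk v (Submodule.mem_sInf.1 hv q hq)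
  have hSp : S ≤ p := sInf_le ⟨hwp, hp⟩
  -- Quantifying over every `x` makes `S'` stable under lowering: `x (e k v) = [x, e k] v + e k (x
  -- v)`, and `[x, e k]` is again an element of `𝔤`. No ordering of monomials in the enveloping
  -- algebra is needed.
  let S' : Submodule ℂ V :=
    { carrier := {v | v ∈ S ∧ ∀ x : 𝔤, ⁅x, v⁆ ∈ S}
      add_mem' := fun h h' => ⟨S.add_mem h.1 h'.1, fun x => by
        rw [lie_add]; exact S.add_mem (h.2 x) (h'.2 x)⟩
      zero_mem' := ⟨S.zero_mem, fun x => by rw [lie_zero]; exact S.zero_mem⟩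
      smul_mem' := fun c v h => ⟨S.smul_mem c h.1, fun x => by
        rw [lie_smul]; exact S.smul_mem c (h.2 x)⟩ }
  have hSS' : S ≤ S' := by
    refine sInf_le ⟨⟨hSw, fun x => he.lie_mem (fun k => ?_) x⟩, fun k hk v hv => ⟨hv.2 _, fun x => ?_⟩⟩
    · rcases hw.cases k with hk | hk | ⟨c, hc⟩
      · rw [hw.raising k hk]; exact S.zero_mem
      · exact hSlow k hk w hSw
      · rw [hc]; exact S.smul_mem c hSw
    · rw [leibniz_lie]
      exact S.add_mem (hv.2 _) (hSlow k hk _ (hv.2 x))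
  refine le_trans (he.lieSpan_le hSw fun k v hv => (hSS' hv).2 _) hSp

omit [LieModule ℂ 𝔤 V] in
theorem mem_of_stable (he : IsUnitaryFamily B e st) {w : V}
    {q : Submodule ℂ (LieSubmodule.lieSpan ℂ 𝔤 {w})}
    (hw : ⟨w, LieSubmodule.subset_lieSpan rfl⟩ ∈ q) (hq : ∀ k, ∀ v ∈ q, ⁅e k, v⁆ ∈ q)
    (u : LieSubmodule.lieSpan ℂ 𝔤 {w}) : u ∈ q := by
  have h := he.lieSpan_le (p := q.map (LieSubmodule.lieSpan ℂ 𝔤 {w}).toSubmodule.subtype)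
    ⟨_, hw, rfl⟩ (by rintro k _ ⟨v, hv, rfl⟩; exact ⟨_, hq k v hv, rfl⟩)
  obtain ⟨v, hv, hvu⟩ := h u.2
  rwa [← Subtype.ext (show (v : V) = u from hvu)]

/-- An induction principle inside the cyclic module, for properties that make sense only there. -/
theorem mem_of_lowering_stable (he : IsUnitaryFamily B e st) {w : V} (hs : IsSingular e st pos w)
    {q : Submodule ℂ (LieSubmodule.lieSpan ℂ 𝔤 {w})}
    (hw : ⟨w, LieSubmodule.subset_lieSpan rfl⟩ ∈ q)
    (hq : ∀ k, st k ∈ pos → ∀ v ∈ q, ⁅e k, v⁆ ∈ q)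
    (u : LieSubmodule.lieSpan ℂ 𝔤 {w}) : u ∈ q := by
  have h := he.lieSpan_le_of_lowering hs
    (p := q.map (LieSubmodule.lieSpan ℂ 𝔤 {w}).toSubmodule.subtype)
    ⟨_, hw, rfl⟩ (by rintro k hk _ ⟨v, hv, rfl⟩; exact ⟨_, hq k hk v hv, rfl⟩)
  obtain ⟨v, hv, hvu⟩ := h u.2
  rwa [← Subtype.ext (show (v : V) = u from hvu)]

/-- The adjoint of a lowering operator is a raising operator, which kills `u`; so `u` is orthogonal
to every lowered vector, and to `w` by assumption. -/
theorem orthogonal_lieSpan (he : IsUnitaryFamily B e st) {w u : V}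
    (hst : Function.Involutive st)
    (hw : IsSingular e st pos w) (hu : ∀ k ∈ pos, ⁅e k, u⁆ = 0) (hwu : B u w = 0) {v : V}
    (hv : v ∈ LieSubmodule.lieSpan ℂ 𝔤 {w}) : B u v = 0 := by
  have key : (LieSubmodule.lieSpan ℂ 𝔤 {w}).toSubmodule ≤ LinearMap.ker (B u) := by
    refine he.lieSpan_le_of_lowering hw hwu fun k hk v _ => ?_
    rw [LinearMap.mem_ker]
    have := he.adjoint (st k) u v
    rw [hst k, hu _ hk] at this
    simpa using this.symm
  exact key hv

omit [LieModule ℂ 𝔤 V] in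
/-- The vectors orthogonal to a Lie submodule form a Lie submodule. -/
theorem lie_mem_orthogonal (he : IsUnitaryFamily B e st) (hst : Function.Involutive st)
    {N : Set V} (hN : ∀ k, ∀ v ∈ N, ⁅e k, v⁆ ∈ N) (k : κ) {u : V}
    (hu : u ∈ IsPosDefForm.orthogonal B N) : ⁅e k, u⁆ ∈ IsPosDefForm.orthogonal B N :=
  fun v hv => by
    have := he.adjoint (st k) v u
    rw [hst k] at this
    rw [← this]
    exact hu _ (hN _ v hv)

/-- Subtracting from the raised vector `u` its projection to `w` leaves a raised vector of the
cyclic module orthogonal to `w`, hence to the whole module and to itself. So `u` is a non-zero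
multiple of `w`. -/
theorem mem_of_ne_bot (he : IsUnitaryFamily B e st) (hB : IsPosDefForm B)
    (hst : Function.Involutive st) {w : V} (hw0 : w ≠ 0) (hw : IsSingular e st pos w)
    {N : LieSubmodule ℂ 𝔤 V} (hN : N ≤ LieSubmodule.lieSpan ℂ 𝔤 {w})
    (hraise : ∃ u ∈ N, u ≠ 0 ∧ ∀ k ∈ pos, ⁅e k, u⁆ = 0) : w ∈ N := by
  obtain ⟨u, huN, hu0, hu⟩ := hraise
  have hww : B w w ≠ 0 := fun h => hw0 (hB.definite w h)
  set c : ℂ := B w u / B w w with hc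
  have h1 : B w (u - c • w) = 0 := by
    rw [map_sub, map_smul, hc, smul_eq_mul, div_mul_cancel₀ _ hww, sub_self]
  have hwmem : w ∈ LieSubmodule.lieSpan ℂ 𝔤 {w} := LieSubmodule.subset_lieSpan rfl
  have h2 : B (u - c • w) (u - c • w) = 0 :=
    he.orthogonal_lieSpan hst hw
      (fun k hk => by rw [lie_sub, lie_smul, hu k hk, hw.raising k hk]; simp)
      (hB.eq_zero_comm.1 h1) (sub_mem (hN huN) (SMulMemClass.smul_mem c hwmem))
  have h3 : u = c • w := sub_eq_zero.1 (hB.definite _ h2)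
  have hc0 : c ≠ 0 := fun h => hu0 (by rw [h3, h, zero_smul])
  have : w = c⁻¹ • u := by rw [h3, smul_smul, inv_mul_cancel₀ hc0, one_smul]
  rw [this]
  exact SMulMemClass.smul_mem _ huN

theorem isIrreducible_lieSpan (he : IsUnitaryFamily B e st) (hB : IsPosDefForm B)
    (hst : Function.Involutive st) {w : V} (hw0 : w ≠ 0) (hw : IsSingular e st pos w)
    (hraise : ∀ N : LieSubmodule ℂ 𝔤 V, N ≠ ⊥ → ∃ u ∈ N, u ≠ 0 ∧ ∀ k ∈ pos, ⁅e k, u⁆ = 0) :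
    LieModule.IsIrreducible ℂ 𝔤 (LieSubmodule.lieSpan ℂ 𝔤 {w}) := by
  have hwmem : w ∈ LieSubmodule.lieSpan ℂ 𝔤 {w} := LieSubmodule.subset_lieSpan rfl
  have : Nontrivial (LieSubmodule.lieSpan ℂ 𝔤 {w}) :=
    ⟨⟨⟨w, hwmem⟩, 0, fun h => hw0 (congrArg Subtype.val h)⟩⟩
  refine LieModule.IsIrreducible.mk fun N hN => ?_
  let N' : LieSubmodule ℂ 𝔤 V := N.map (LieSubmodule.lieSpan ℂ 𝔤 {w}).incl
  have hle : N' ≤ LieSubmodule.lieSpan ℂ 𝔤 {w} := by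
    rintro _ ⟨v, -, rfl⟩
    exact v.2
  have hne : N' ≠ ⊥ := by
    intro h
    refine hN ((LieSubmodule.eq_bot_iff _).2 fun v hv => ?_)
    have : (v : V) ∈ N' := ⟨v, hv, rfl⟩
    rw [h] at this
    exact Subtype.ext (by simpa using this)
  have hmem : w ∈ N' := he.mem_of_ne_bot hB hst hw0 hw hle (hraise N' hne)
  have htop : LieSubmodule.lieSpan ℂ 𝔤 {w} ≤ N' :=
    LieSubmodule.lieSpan_le.2 (Set.singleton_subset_iff.2 hmem)
  refine top_le_iff.1 fun v _ => ?_
  obtain ⟨v', hv', h⟩ := htop v.2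
  rwa [← Subtype.ext (show (v' : V) = v from h)]

end IsUnitaryFamily

/-! ### The external tensor product for two commuting subalgebras -/

section ExternalTensor

variable {𝔤 V κ₁ κ₂ : Type*} [LieRing 𝔤] [LieAlgebra ℂ 𝔤] [AddCommGroup V] [Module ℂ V]
  [LieRingModule 𝔤 V] [LieModule ℂ 𝔤 V] {g₁ g₂ : LieSubalgebra ℂ 𝔤}
  {B : V →ₗ⋆[ℂ] V →ₗ[ℂ] ℂ} {e₁ : κ₁ → g₁} {e₂ : κ₂ → g₂} {st₁ : κ₁ → κ₁} {st₂ : κ₂ → κ₂}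
  {pos₁ : Set κ₁} {pos₂ : Set κ₂}

omit [LieAlgebra ℂ 𝔤] [LieModule ℂ 𝔤 V] in
theorem lieModuleHom_ext_lieSpan {g : Type*} [LieRing g] [LieRingModule g V] {w : V}
    {f f' : LieSubmodule.lieSpan ℂ g {w} →ₗ⁅ℂ,g⁆ V}
    (h : f ⟨w, LieSubmodule.subset_lieSpan rfl⟩ = f' ⟨w, LieSubmodule.subset_lieSpan rfl⟩) :
    f = f' := by
  ext ⟨v, hv⟩
  induction hv using LieSubmodule.lieSpan_induction with
  | mem x hx => obtain rfl : x = w := hx; exact h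
  | zero =>
    have : (⟨0, zero_mem _⟩ : LieSubmodule.lieSpan ℂ g {w}) = 0 := rfl
    rw [this, map_zero, map_zero]
  | smul a x hx ih =>
    have : (⟨a • x, SMulMemClass.smul_mem a hx⟩ : LieSubmodule.lieSpan ℂ g {w}) = a • ⟨x, hx⟩ := rfl
    rw [this, map_smul, map_smul, ih]
  | add x y hx hy ihx ihy =>
    have : (⟨x + y, add_mem hx hy⟩ : LieSubmodule.lieSpan ℂ g {w}) = ⟨x, hx⟩ + ⟨y, hy⟩ := rfl
    rw [this, map_add, map_add, ihx, ihy]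
  | lie a x hx ih =>
    have : (⟨⁅a, x⁆, LieSubmodule.lie_mem _ hx⟩ : LieSubmodule.lieSpan ℂ g {w}) = ⁅a, ⟨x, hx⟩⁆ := rfl
    rw [this, LieModuleHom.map_lie, LieModuleHom.map_lie, ih]

/-- For commuting `g₁` and `g₂` and `u` in the `g₁`-module generated by `w` there is a `g₂`-equivariant
map on the `g₂`-module generated by `w` that sends `w` to `u`. -/
theorem exists_lieModuleHom_of_commute
    (hcomm : ∀ (x : g₁) (y : g₂) (v : V), ⁅x, ⁅y, v⁆⁆ = ⁅y, ⁅x, v⁆⁆) {w u : V}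
    (hu : u ∈ LieSubmodule.lieSpan ℂ g₁ {w}) :
    ∃ f : LieSubmodule.lieSpan ℂ g₂ {w} →ₗ⁅ℂ,g₂⁆ V,
      f ⟨w, LieSubmodule.subset_lieSpan rfl⟩ = u := by
  induction hu using LieSubmodule.lieSpan_induction with
  | mem x hx =>
    obtain rfl : x = w := hx
    exact ⟨(LieSubmodule.lieSpan ℂ g₂ {x}).incl, rfl⟩
  | zero => exact ⟨0, rfl⟩
  | smul a x hx ih =>
    obtain ⟨f, hf⟩ := ih
    exact ⟨a • f, by rw [LieModuleHom.smul_apply, hf]⟩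
  | add x y hx hy ihx ihy =>
    obtain ⟨f, hf⟩ := ihx
    obtain ⟨f', hf'⟩ := ihy
    exact ⟨f + f', by rw [LieModuleHom.add_apply, hf, hf']⟩
  | lie a x hx ih =>
    obtain ⟨f, hf⟩ := ih
    exact ⟨{ (LieModule.toEnd ℂ g₁ V a) ∘ₗ (f : LieSubmodule.lieSpan ℂ g₂ {w} →ₗ[ℂ] V) with
      map_lie' := fun {y v} => by
        change ⁅a, f ⁅y, v⁆⁆ = ⁅y, ⁅a, f v⁆⁆
        rw [LieModuleHom.map_lie, hcomm] }, by
      change ⁅a, f _⁆ = _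
      rw [hf]⟩

/-- The map `u ↦ (v ↦ u ⊗ v)`: the equivariant map on the `g₂`-module generated by `w` that
sends `w` to `u`. -/
theorem exists_tensorMap (hcomm : ∀ (x : g₁) (y : g₂) (v : V), ⁅x, ⁅y, v⁆⁆ = ⁅y, ⁅x, v⁆⁆) (w : V) :
    ∃ φ : LieSubmodule.lieSpan ℂ g₁ {w} →ₗ[ℂ] LieSubmodule.lieSpan ℂ g₂ {w} →ₗ[ℂ] V,
      (∀ u, φ u ⟨w, LieSubmodule.subset_lieSpan rfl⟩ = u) ∧
      (∀ v, φ ⟨w, LieSubmodule.subset_lieSpan rfl⟩ v = v) ∧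
      (∀ (x : g₁) u v, φ ⁅x, u⁆ v = ⁅x, φ u v⁆) ∧
      (∀ (y : g₂) u v, φ u ⁅y, v⁆ = ⁅y, φ u v⁆) := by
  -- The maps `f u` are chosen independently. Linearity and equivariance in `u` follow because an
  -- equivariant map on a cyclic module is determined by its value at `w`.
  choose f hf using fun u : LieSubmodule.lieSpan ℂ g₁ {w} =>
    exists_lieModuleHom_of_commute hcomm u.2
  refine ⟨LinearMap.mk₂ ℂ (fun u v => f u v) (fun u u' v => ?_) (fun c u v => ?_)
    (fun u v v' => map_add _ _ _) (fun c u v => map_smul _ _ _), hf, fun v => ?_, fun x u v => ?_,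
    fun y u v => LieModuleHom.map_lie _ _ _⟩
  · rw [← LieModuleHom.add_apply]
    exact DFunLike.congr_fun (lieModuleHom_ext_lieSpan (by
      rw [LieModuleHom.add_apply, hf, hf, hf]; rfl)) v
  · rw [← LieModuleHom.smul_apply]
    exact DFunLike.congr_fun (lieModuleHom_ext_lieSpan (by
      rw [LieModuleHom.smul_apply, hf, hf]; rfl)) v
  · exact DFunLike.congr_fun (lieModuleHom_ext_lieSpan
      (f' := (LieSubmodule.lieSpan ℂ g₂ {w}).incl) (hf _)) v
  · let F : LieSubmodule.lieSpan ℂ g₂ {w} →ₗ⁅ℂ,g₂⁆ V :=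
      { (LieModule.toEnd ℂ g₁ V x) ∘ₗ (f u : LieSubmodule.lieSpan ℂ g₂ {w} →ₗ[ℂ] V) with
        map_lie' := fun {y v} => by
          change ⁅x, f u ⁅y, v⁆⁆ = ⁅y, ⁅x, f u v⁆⁆
          rw [LieModuleHom.map_lie, hcomm] }
    refine DFunLike.congr_fun (lieModuleHom_ext_lieSpan (f' := F) ?_) v
    change _ = ⁅x, f u _⁆
    rw [hf, hf]
    rfl

/-- The Gram identity of the map `u ⊗ v ↦ φ u v`. -/
theorem gram_tensorMap (he₁ : IsUnitaryFamily B e₁ st₁)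
    (he₂ : IsUnitaryFamily B e₂ st₂) (hst₁ : Function.Involutive st₁) {w : V}
    (hw₁ : IsSingular e₁ st₁ pos₁ w)
    {φ : LieSubmodule.lieSpan ℂ g₁ {w} →ₗ[ℂ] LieSubmodule.lieSpan ℂ g₂ {w} →ₗ[ℂ] V}
    (hφ₂ : ∀ v, φ ⟨w, LieSubmodule.subset_lieSpan rfl⟩ v = v)
    (hφx : ∀ (x : g₁) u v, φ ⁅x, u⁆ v = ⁅x, φ u v⁆)
    (hφy : ∀ (y : g₂) u v, φ u ⁅y, v⁆ = ⁅y, φ u v⁆)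
    (u u' : LieSubmodule.lieSpan ℂ g₁ {w}) (v v' : LieSubmodule.lieSpan ℂ g₂ {w}) :
    B (φ u v) (φ u' v') * B w w = B u u' * B v v' := by
  -- The case `u = v = w`. Both sides vanish when `u'` is replaced by a lowered vector, since `w` is
  -- orthogonal to all of these; this leaves `u' = w`.
  have hlow : ∀ v' u', B w (φ u' v') * B w w = B w u' * B w v' := by
    intro v'
    let q : Submodule ℂ (LieSubmodule.lieSpan ℂ g₁ {w}) :=
      { carrier := {u' | B w (φ u' v') * B w w = B w u' * B w v'}
        add_mem' := fun {a b} ha hb => by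
          change B w (φ (a + b) v') * _ = B w ((a : V) + b) * _
          rw [map_add, LinearMap.add_apply, map_add, map_add, add_mul, add_mul, ha, hb]
        zero_mem' := by
          change B w (φ 0 v') * _ = B w 0 * _
          simp
        smul_mem' := fun c a ha => by
          change B w (φ (c • a) v') * _ = B w (c • (a : V)) * _
          rw [map_smul, LinearMap.smul_apply, map_smul, map_smul, smul_eq_mul, smul_eq_mul,
            mul_assoc, mul_assoc, ha] }
    refine he₁.mem_of_lowering_stable hw₁ (q := q) ?_ fun k hk a ha => ?_
    · change B w (φ ⟨w, _⟩ v') * _ = B w w * _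
      rw [hφ₂, mul_comm]
    · change B w (φ ⁅e₁ k, a⁆ v') * _ = B w ⁅e₁ k, (a : V)⁆ * _
      have h0 : ∀ z, B w ⁅e₁ k, z⁆ = 0 := fun z => by
        have := he₁.adjoint (st₁ k) w z
        rw [hst₁ k, hw₁.raising _ hk] at this
        simpa using this.symm
      rw [hφx, h0, h0, zero_mul, zero_mul]
  -- An operator in front of `v` moves to `v'` by adjointness on both sides, so the identity
  -- propagates from `v = w`; below, the same is done for `u`.
  have hv : ∀ (v : LieSubmodule.lieSpan ℂ g₂ {w}) u' v', B v (φ u' v') * B w w = B w u' * B v v' := by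
    let q : Submodule ℂ (LieSubmodule.lieSpan ℂ g₂ {w}) :=
      { carrier := {v | ∀ u' v', B v (φ u' v') * B w w = B w u' * B v v'}
        add_mem' := fun {a b} ha hb u' v' => by
          change B ((a : V) + b) _ * _ = _ * B ((a : V) + b) _
          rw [map_add, LinearMap.add_apply, LinearMap.add_apply, add_mul, mul_add, ha, hb]
        zero_mem' := fun u' v' => by
          change B 0 _ * _ = _ * B 0 _
          simp
        smul_mem' := fun c a ha u' v' => by
          change B (c • (a : V)) _ * _ = _ * B (c • (a : V)) _
          rw [map_smulₛₗ, LinearMap.smul_apply, LinearMap.smul_apply, smul_eq_mul, smul_eq_mul,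
            mul_assoc, ha, mul_left_comm] }
    refine fun v => he₂.mem_of_stable (q := q) (fun u' v' => hlow v' u') (fun k a ha u' v' => ?_) v
    change B ⁅e₂ k, (a : V)⁆ _ * _ = _ * B ⁅e₂ k, (a : V)⁆ _
    rw [he₂.adjoint, he₂.adjoint, ← hφy, ha]
    rfl
  let q : Submodule ℂ (LieSubmodule.lieSpan ℂ g₁ {w}) :=
    { carrier := {u | ∀ u' v v', B (φ u v) (φ u' v') * B w w = B u u' * B v v'}
      add_mem' := fun {a b} ha hb u' v v' => by
        change B (φ (a + b) v) _ * _ = B ((a : V) + b) _ * _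
        rw [map_add, LinearMap.add_apply, map_add, LinearMap.add_apply, map_add,
          LinearMap.add_apply, add_mul, add_mul, ha, hb]
      zero_mem' := fun u' v v' => by
        change B (φ 0 v) _ * _ = B 0 _ * _
        simp
      smul_mem' := fun c a ha u' v v' => by
        change B (φ (c • a) v) _ * _ = B (c • (a : V)) _ * _
        rw [map_smul, LinearMap.smul_apply, map_smulₛₗ, map_smulₛₗ, LinearMap.smul_apply,
          LinearMap.smul_apply, smul_eq_mul, smul_eq_mul, mul_assoc, mul_assoc, ha] }
  refine he₁.mem_of_stable (q := q) (fun u' v v' => ?_) (fun k a ha u' v v' => ?_) u u' v v'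
  · rw [hφ₂]
    exact hv v u' v'
  · change _ = B ⁅e₁ k, (a : V)⁆ _ * _
    rw [hφx, he₁.adjoint, he₁.adjoint, ← hφx, ha]
    rfl

/-- The module generated by a singular vector over a sum of two commuting subalgebras is the
external tensor product of the modules generated over the two subalgebras. -/
theorem isExternalTensor_lieSpan (hB : IsPosDefForm B) (he₁ : IsUnitaryFamily B e₁ st₁)
    (he₂ : IsUnitaryFamily B e₂ st₂) (hst₁ : Function.Involutive st₁) {w : V}
    (hw₁ : IsSingular e₁ st₁ pos₁ w)
    (hcomm : ∀ (x : g₁) (y : g₂) (v : V), ⁅x, ⁅y, v⁆⁆ = ⁅y, ⁅x, v⁆⁆)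
    (hsum : ∀ x : 𝔤, ∃ (x₁ : g₁) (x₂ : g₂), x = x₁ + x₂) :
    IsExternalTensor g₁ g₂ (LieSubmodule.lieSpan ℂ g₁ {w}) (LieSubmodule.lieSpan ℂ g₂ {w})
      (LieSubmodule.lieSpan ℂ 𝔤 {w}) := by
  classical
  obtain ⟨φ, hφ₁, hφ₂, hφx, hφy⟩ := exists_tensorMap hcomm w
  have hgram := gram_tensorMap he₁ he₂ hst₁ hw₁ hφ₂ hφx hφy
  revert φ
  set L₁ := LieSubmodule.lieSpan ℂ g₁ {w}
  set L₂ := LieSubmodule.lieSpan ℂ g₂ {w}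
  set W := LieSubmodule.lieSpan ℂ 𝔤 {w}
  intro φ hφ₁ hφ₂ hφx hφy hgram
  have hw₁W : w ∈ W := LieSubmodule.subset_lieSpan rfl
  have hL₁ : ∀ u : L₁, (u : V) ∈ W := by
    rintro ⟨u, hu⟩
    let W' : LieSubmodule ℂ g₁ V :=
      { W.toSubmodule with lie_mem := fun {x v} hv => W.lie_mem (x := (x : 𝔤)) hv }
    have : L₁ ≤ W' := LieSubmodule.lieSpan_le.2 (Set.singleton_subset_iff.2 hw₁W)
    exact this hu
  have hφW : ∀ u v, φ u v ∈ W := by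
    intro u
    let q : Submodule ℂ L₂ := W.toSubmodule.comap (φ u)
    refine he₂.mem_of_stable (q := q) ?_ fun k v hv => ?_
    · change φ u ⟨w, _⟩ ∈ W
      rw [hφ₁]
      exact hL₁ u
    · change φ u ⁅e₂ k, v⁆ ∈ W
      rw [hφy]
      exact W.lie_mem (x := (e₂ k : 𝔤)) hv
  let t₀ : L₁ ⊗[ℂ] L₂ →ₗ[ℂ] V := TensorProduct.lift φ
  have ht₀W : ∀ z, t₀ z ∈ W.toSubmodule := by
    intro z
    induction z using TensorProduct.induction_on with
    | zero => rw [map_zero]; exact W.zero_mem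
    | tmul u v => exact hφW u v
    | add a b ha hb => rw [map_add]; exact W.add_mem ha hb
  let t : L₁ ⊗[ℂ] L₂ →ₗ[ℂ] W := t₀.codRestrict W.toSubmodule ht₀W
  have ht : ∀ (x : g₁) (y : g₂) u v,
      t₀ (⁅x, u⁆ ⊗ₜ[ℂ] v + u ⊗ₜ[ℂ] ⁅y, v⁆) = ⁅(x : 𝔤) + (y : 𝔤), t₀ (u ⊗ₜ[ℂ] v)⁆ := by
    intro x y u v
    rw [map_add, add_lie]
    change φ ⁅x, u⁆ v + φ u ⁅y, v⁆ = _
    rw [hφx, hφy]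
    rfl
  -- Write a kernel element as `∑ aᵢ ⊗ bᵢ` with `bᵢ` a basis of `L₂`. The Gram identity makes `∑
  -- B(u, aᵢ) bᵢ` orthogonal to `L₂`, hence zero. So every `B(u, aᵢ)` vanishes, and `u = aᵢ` gives
  -- `aᵢ = 0`.
  have hinj : Function.Injective t := by
    rw [← LinearMap.ker_eq_bot, LinearMap.ker_eq_bot']
    intro z hz
    have hz : t₀ z = 0 := congrArg Subtype.val hz
    let b := Module.Basis.ofVectorSpace ℂ L₂
    let E := TensorProduct.equivFinsuppOfBasisRight (R := ℂ) (M := L₁) b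
    have hzE : z = (E z).sum fun i u => u ⊗ₜ[ℂ] b i := by
      conv_lhs => rw [← E.symm_apply_apply z]
      exact TensorProduct.equivFinsuppOfBasisRight_symm_apply b (E z)
    suffices h : E z = 0 by rwa [LinearEquiv.map_eq_zero_iff] at h
    have h1 : ∀ (u : L₁) (v : L₂), B v ((E z).sum fun i a => B u a • (b i : V)) = 0 := by
      intro u v
      have h2 : B (φ u v) (t₀ z) * B w w = 0 := by rw [hz, map_zero, zero_mul]
      rw [hzE, Finsupp.sum, map_sum, map_sum, Finset.sum_mul] at h2
      rw [Finsupp.sum, map_sum, ← h2]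
      refine Finset.sum_congr rfl fun i _ => ?_
      rw [map_smul, smul_eq_mul]
      exact (hgram u _ v _).symm
    have h3 : ∀ u : L₁, ((E z).sum fun i a => B u a • b i) = 0 := by
      intro u
      have h4 := h1 u ((E z).sum fun i a => B u a • b i)
      have h5 : (((E z).sum fun i a => B u a • b i : L₂) : V) =
          (E z).sum fun i a => B u a • (b i : V) :=
        map_sum L₂.toSubmodule.subtype _ _
      rw [h5] at h4
      exact Subtype.ext (h5.trans (hB.definite _ h4))
    ext i
    have h6 : B (E z i) (E z i) = 0 := by
      by_cases hi : i ∈ (E z).support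
      · exact (linearIndependent_iff'.1 b.linearIndependent) _ _ (h3 (E z i)) i hi
      · rw [Finsupp.notMem_support_iff.1 hi]
        exact map_zero _
    rw [hB.definite _ h6]
    rfl
  have hsurj : Function.Surjective t := by
    rintro ⟨v, hv⟩
    let N : LieSubmodule ℂ 𝔤 V :=
      { LinearMap.range t₀ with
        lie_mem := by
          rintro x _ ⟨z, rfl⟩
          obtain ⟨x₁, x₂, rfl⟩ := hsum x
          change _ ∈ LinearMap.range t₀
          induction z using TensorProduct.induction_on with
          | zero => rw [map_zero, lie_zero]; exact Submodule.zero_mem _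
          | tmul u v => rw [← ht]; exact LinearMap.mem_range_self _ _
          | add a b ha hb => rw [map_add, lie_add]; exact Submodule.add_mem _ ha hb }
    have hN : W ≤ N := LieSubmodule.lieSpan_le.2 (Set.singleton_subset_iff.2
      ⟨⟨w, LieSubmodule.subset_lieSpan rfl⟩ ⊗ₜ[ℂ] ⟨w, LieSubmodule.subset_lieSpan rfl⟩, hφ₁ _⟩)
    obtain ⟨z, hz⟩ := hN hv
    exact ⟨z, Subtype.ext hz⟩
  exact ⟨LinearEquiv.ofBijective t ⟨hinj, hsurj⟩, fun x y u v => Subtype.ext (ht x y u v)⟩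

end ExternalTensor

/-! ## Polarization operators on polynomials in the entries of a matrix -/

namespace MatrixPoly

open MvPolynomial

/-- Polynomials in the entries of a matrix with rows and columns indexed by `ℕ`. -/
abbrev Poly : Type := MvPolynomial (ℕ × ℕ) ℂ

/-- The row polarization `∑ j, X (a, j) ∂ / ∂ X (b, j)`. -/
def rowOp (a b : ℕ) : Derivation ℂ Poly Poly :=
  mkDerivation ℂ fun v => if v.1 = b then X (a, v.2) else 0

/-- The column polarization `∑ i, X (i, a) ∂ / ∂ X (i, b)`. -/
def colOp (a b : ℕ) : Derivation ℂ Poly Poly :=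
  mkDerivation ℂ fun v => if v.2 = b then X (v.1, a) else 0

@[simp] theorem rowOp_X (a b : ℕ) (v : ℕ × ℕ) :
    rowOp a b (X v) = if v.1 = b then X (a, v.2) else 0 := mkDerivation_X _ _ _

@[simp] theorem colOp_X (a b : ℕ) (v : ℕ × ℕ) :
    colOp a b (X v) = if v.2 = b then X (v.1, a) else 0 := mkDerivation_X _ _ _

theorem derivation_sum_apply {ι : Type*} (s : Finset ι) (D : ι → Derivation ℂ Poly Poly) (f : Poly) :
    (∑ i ∈ s, D i) f = ∑ i ∈ s, D i f := by
  classical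
  induction s using Finset.induction_on with
  | empty => simp
  | insert i s hi ih => rw [Finset.sum_insert hi, Finset.sum_insert hi, Derivation.add_apply, ih]

/-- The polarization is an infinite sum of derivations, but a derivation is determined on `f` by its
values on the variables of `f`. The freedom in `F` lets two polynomials share one sum. -/
theorem rowOp_eq_sum (a b : ℕ) (f : Poly) {F : Finset ℕ} (hF : ∀ v ∈ f.vars, v.2 ∈ F) :
    rowOp a b f = ∑ j ∈ F, X (a, j) * pderiv (b, j) f := by
  have h : rowOp a b f = (∑ j ∈ F, (X (a, j) : Poly) • pderiv (R := ℂ) (b, j)) f := by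
    refine derivation_eq_of_forall_mem_vars fun v hv => ?_
    obtain ⟨i, j⟩ := v
    have hj : j ∈ F := hF _ hv
    rw [derivation_sum_apply, rowOp_X]
    simp only [Derivation.smul_apply, pderiv_X, smul_eq_mul]
    rw [Finset.sum_eq_single j]
    · by_cases h : i = b <;> simp [h]
    · intro j' _ hj'
      simp [hj'.symm]
    · exact fun h => absurd hj h
  rw [h, derivation_sum_apply]
  rfl

theorem colOp_eq_sum (a b : ℕ) (f : Poly) {F : Finset ℕ} (hF : ∀ v ∈ f.vars, v.1 ∈ F) :
    colOp a b f = ∑ i ∈ F, X (i, a) * pderiv (i, b) f := by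
  have h : colOp a b f = (∑ i ∈ F, (X (i, a) : Poly) • pderiv (R := ℂ) (i, b)) f := by
    refine derivation_eq_of_forall_mem_vars fun v hv => ?_
    obtain ⟨i, j⟩ := v
    have hj : i ∈ F := hF _ hv
    rw [derivation_sum_apply, colOp_X]
    simp only [Derivation.smul_apply, pderiv_X, smul_eq_mul]
    rw [Finset.sum_eq_single i]
    · by_cases h : j = b <;> simp [h]
    · intro j' _ hj'
      simp [hj'.symm]
    · exact fun h => absurd hj h
  rw [h, derivation_sum_apply]
  rfl

/-! ### The Fischer form -/

/-- The product of the factorials of the exponents. -/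
def factorialProd (m : (ℕ × ℕ) →₀ ℕ) : ℕ := m.prod fun _ k => k.factorial

theorem factorialProd_pos (m : (ℕ × ℕ) →₀ ℕ) : 0 < factorialProd m :=
  Finset.prod_pos fun _ _ => Nat.factorial_pos _

theorem factorialProd_add_single (m : (ℕ × ℕ) →₀ ℕ) (v : ℕ × ℕ) :
    factorialProd (m + Finsupp.single v 1) = (m v + 1) * factorialProd m := by
  classical
  unfold factorialProd
  have h : ∀ m : (ℕ × ℕ) →₀ ℕ, m.prod (fun _ k => k.factorial) =
      (m v).factorial * (m.erase v).prod fun _ k => k.factorial := fun m =>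
    (Finsupp.mul_prod_erase' m v _ fun _ => Nat.factorial_zero).symm
  rw [h m, h (m + _)]
  simp [Nat.factorial_succ, mul_assoc, Finsupp.erase_add]

/-- The bilinear form for which the monomials `X ^ m` are orthogonal of norm `m!`. -/
def fischerBilin : Poly →ₗ[ℂ] Poly →ₗ[ℂ] ℂ :=
  (basisMonomials (ℕ × ℕ) ℂ).constr ℂ fun m => (factorialProd m : ℂ) • lcoeff ℂ m

theorem fischerBilin_monomial (m : (ℕ × ℕ) →₀ ℕ) (c : ℂ) (g : Poly) :
    fischerBilin (monomial m c) g = c * (factorialProd m * coeff m g) := by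
  have h : (monomial m c : Poly) = c • basisMonomials (ℕ × ℕ) ℂ m := by
    rw [coe_basisMonomials, smul_monomial, smul_eq_mul, mul_one]
  rw [h, map_smul, fischerBilin, Module.Basis.constr_basis]
  rfl

theorem fischerBilin_eq_sum (f g : Poly) :
    fischerBilin f g = ∑ m ∈ f.support, coeff m f * (factorialProd m * coeff m g) := by
  conv_lhs => rw [f.as_sum]
  rw [map_sum, LinearMap.sum_apply]
  exact Finset.sum_congr rfl fun m _ => fischerBilin_monomial m _ g

/-- On monomials this is `(k + 1)! = (k + 1) * k!`; the factorial norms are chosen for this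
adjointness. -/
theorem fischerBilin_X_mul (v : ℕ × ℕ) (f g : Poly) :
    fischerBilin (X v * f) g = fischerBilin f (pderiv v g) := by
  induction f using MvPolynomial.induction_on' with
  | add p q hp hq => rw [mul_add, map_add, map_add, LinearMap.add_apply, LinearMap.add_apply, hp, hq]
  | monomial m c =>
    rw [X, monomial_mul, one_mul, fischerBilin_monomial, fischerBilin_monomial, coeff_pderiv,
      add_comm (Finsupp.single v 1) m, factorialProd_add_single]
    push_cast
    ring

theorem fischerBilin_comm (f g : Poly) : fischerBilin f g = fischerBilin g f := by
  classical
  have key : ∀ f g : Poly, fischerBilin f g =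
      ∑ m ∈ f.support ∪ g.support, coeff m f * (factorialProd m * coeff m g) := by
    intro f g
    rw [fischerBilin_eq_sum]
    refine Finset.sum_subset Finset.subset_union_left fun m _ hm => ?_
    rw [notMem_support_iff.1 hm, zero_mul]
  rw [key, key, Finset.union_comm]
  exact Finset.sum_congr rfl fun m _ => by ring

/-- Complex conjugation of the coefficients. -/
def conjPoly : Poly →ₗ⋆[ℂ] Poly where
  toFun := map (starRingEnd ℂ)
  map_add' := map_add _
  map_smul' c f := by simp [smul_eq_C_mul]

theorem coeff_conjPoly (m : (ℕ × ℕ) →₀ ℕ) (f : Poly) :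
    coeff m (conjPoly f) = starRingEnd ℂ (coeff m f) := coeff_map _ _ _

theorem conjPoly_X_mul (v : ℕ × ℕ) (f : Poly) : conjPoly (X v * f) = X v * conjPoly f := by
  change map _ _ = _ * map _ _
  rw [map_mul, map_X]

theorem support_conjPoly (f : Poly) : (conjPoly f).support = f.support := by
  ext m
  simp [coeff_conjPoly]

/-- The Fischer form `⟨f, g⟩ = (conj f)(∂) g (0)`. -/
def fischer : Poly →ₗ⋆[ℂ] Poly →ₗ[ℂ] ℂ := fischerBilin.comp conjPoly

theorem fischer_apply (f g : Poly) : fischer f g = fischerBilin (conjPoly f) g := rfl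

theorem fischer_eq_sum (f g : Poly) : fischer f g =
    ∑ m ∈ f.support, starRingEnd ℂ (coeff m f) * (factorialProd m * coeff m g) := by
  rw [fischer_apply, fischerBilin_eq_sum, support_conjPoly]
  simp only [coeff_conjPoly]

theorem fischer_X_mul (v : ℕ × ℕ) (f g : Poly) :
    fischer (X v * f) g = fischer f (pderiv v g) := by
  rw [fischer_apply, conjPoly_X_mul, fischerBilin_X_mul]
  rfl

theorem fischer_conj_symm (f g : Poly) : starRingEnd ℂ (fischer g f) = fischer f g := by
  rw [fischer_eq_sum, map_sum, fischer_apply, fischerBilin_comm, fischerBilin_eq_sum]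
  exact Finset.sum_congr rfl fun m _ => by simp [coeff_conjPoly]

theorem fischer_pderiv (v : ℕ × ℕ) (f g : Poly) :
    fischer (pderiv v f) g = fischer f (X v * g) := by
  rw [← fischer_conj_symm, ← fischer_X_mul, fischer_conj_symm]

theorem fischer_self (f : Poly) :
    fischer f f = ((∑ m ∈ f.support, factorialProd m * ‖coeff m f‖ ^ 2 : ℝ) : ℂ) := by
  rw [fischer_eq_sum]
  push_cast
  refine Finset.sum_congr rfl fun m _ => ?_
  rw [← Complex.conj_mul']
  ring

theorem isPosDefForm_fischer : IsPosDefForm fischer where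
  conj_symm := fischer_conj_symm
  nonneg f := by
    rw [fischer_self, Complex.ofReal_re]
    positivity
  definite f h := by
    rw [fischer_self, Complex.ofReal_eq_zero,
      Finset.sum_eq_zero_iff_of_nonneg fun m _ => by positivity] at h
    by_contra hf
    obtain ⟨m, hm⟩ := Finset.nonempty_iff_ne_empty.2 fun h => hf (support_eq_empty.1 h)
    have h1 := h m hm
    have h2 : (factorialProd m : ℝ) ≠ 0 := by exact_mod_cast (factorialProd_pos m).ne'
    have h3 : coeff m f = 0 := by simpa [h2] using h1
    exact mem_support_iff.1 hm h3

/-- Termwise, the adjoint of `X (a, j) ∂(b, j)` is `X (b, j) ∂(a, j)`. -/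
theorem fischer_rowOp (a b : ℕ) (f g : Poly) :
    fischer (rowOp a b f) g = fischer f (rowOp b a g) := by
  classical
  let F := f.vars.image Prod.snd ∪ g.vars.image Prod.snd
  have hf : ∀ v ∈ f.vars, v.2 ∈ F := fun v hv =>
    Finset.mem_union_left _ (Finset.mem_image_of_mem _ hv)
  have hg : ∀ v ∈ g.vars, v.2 ∈ F := fun v hv =>
    Finset.mem_union_right _ (Finset.mem_image_of_mem _ hv)
  rw [rowOp_eq_sum a b f hf, rowOp_eq_sum b a g hg, map_sum, map_sum, LinearMap.sum_apply]
  exact Finset.sum_congr rfl fun j _ => by rw [fischer_X_mul, fischer_pderiv]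

theorem fischer_colOp (a b : ℕ) (f g : Poly) :
    fischer (colOp a b f) g = fischer f (colOp b a g) := by
  classical
  let F := f.vars.image Prod.fst ∪ g.vars.image Prod.fst
  have hf : ∀ v ∈ f.vars, v.1 ∈ F := fun v hv =>
    Finset.mem_union_left _ (Finset.mem_image_of_mem _ hv)
  have hg : ∀ v ∈ g.vars, v.1 ∈ F := fun v hv =>
    Finset.mem_union_right _ (Finset.mem_image_of_mem _ hv)
  rw [colOp_eq_sum a b f hf, colOp_eq_sum b a g hg, map_sum, map_sum, LinearMap.sum_apply]
  exact Finset.sum_congr rfl fun j _ => by rw [fischer_X_mul, fischer_pderiv]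

end MatrixPoly

namespace MatrixPoly

open MvPolynomial

/-! ### The exponents that occur in the image of a polarization -/

/-- Each term of the polarization trades one factor `X (b, j)` for one factor `X (a, j)`. -/
theorem exists_of_mem_support_rowOp {a b : ℕ} {f : Poly} {m : (ℕ × ℕ) →₀ ℕ}
    (hm : m ∈ (rowOp a b f).support) : ∃ (m' : (ℕ × ℕ) →₀ ℕ) (j : ℕ),
      m = m' + Finsupp.single (a, j) 1 ∧ m' + Finsupp.single (b, j) 1 ∈ f.support := by
  classical
  rw [rowOp_eq_sum a b f (F := f.vars.image Prod.snd)
    (fun v hv => Finset.mem_image_of_mem _ hv)] at hm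
  obtain ⟨j, -, hj⟩ := Finset.mem_biUnion.1 (support_sum hm)
  rw [mul_comm, support_mul_X] at hj
  obtain ⟨m', hm', rfl⟩ := Finset.mem_map.1 hj
  refine ⟨m', j, rfl, mem_support_iff.2 fun h => ?_⟩
  rw [mem_support_iff, coeff_pderiv, h, zero_mul] at hm'
  exact hm' rfl

theorem exists_of_mem_support_colOp {a b : ℕ} {f : Poly} {m : (ℕ × ℕ) →₀ ℕ}
    (hm : m ∈ (colOp a b f).support) : ∃ (m' : (ℕ × ℕ) →₀ ℕ) (i : ℕ),
      m = m' + Finsupp.single (i, a) 1 ∧ m' + Finsupp.single (i, b) 1 ∈ f.support := by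
  classical
  rw [colOp_eq_sum a b f (F := f.vars.image Prod.fst)
    (fun v hv => Finset.mem_image_of_mem _ hv)] at hm
  obtain ⟨j, -, hj⟩ := Finset.mem_biUnion.1 (support_sum hm)
  rw [mul_comm, support_mul_X] at hj
  obtain ⟨m', hm', rfl⟩ := Finset.mem_map.1 hj
  refine ⟨m', j, rfl, mem_support_iff.2 fun h => ?_⟩
  rw [mem_support_iff, coeff_pderiv, h, zero_mul] at hm'
  exact hm' rfl

/-- The degree of a monomial in the variables of row `a`. -/
def rowDeg (a : ℕ) : ((ℕ × ℕ) →₀ ℕ) →+ ℕ := Finsupp.weight fun v => if v.1 = a then 1 else 0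

/-- The diagonal operation is the Euler operator in the variables of row `a`. -/
theorem coeff_rowOp_self (a : ℕ) (f : Poly) (m : (ℕ × ℕ) →₀ ℕ) :
    coeff m (rowOp a a f) = rowDeg a m * coeff m f := by
  classical
  induction f using MvPolynomial.induction_on' with
  | add p q hp hq => rw [map_add, coeff_add, coeff_add, hp, hq, mul_add]
  | monomial s c =>
    have h : rowOp a a (monomial s c) = (rowDeg a s : ℂ) • monomial s c := by
      rw [rowOp, mkDerivation_monomial, rowDeg, Finsupp.weight_apply, Finsupp.sum, Finsupp.sum,
        Nat.cast_sum, Finset.sum_smul, Finset.smul_sum]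
      refine Finset.sum_congr rfl fun v hv => ?_
      by_cases hva : v.1 = a
      · obtain ⟨i, j⟩ := v
        obtain rfl : i = a := hva
        have hle : Finsupp.single (i, j) 1 ≤ s := by
          rw [Finsupp.single_le_iff]
          exact Nat.one_le_iff_ne_zero.2 (Finsupp.mem_support_iff.1 hv)
        simp only [if_true, X, smul_eq_mul, monomial_mul, tsub_add_cancel_of_le hle, smul_monomial]
        simp [mul_comm]
      · simp [hva]
    rw [h, coeff_smul, smul_eq_mul, coeff_monomial]
    split_ifs with hs
    · rw [hs]
    · simp

/-! ### A well-founded size that raising operators decrease -/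

/-- The weight of a monomial for which `X (i, j)` has weight `i + j`. -/
def height : ((ℕ × ℕ) →₀ ℕ) →+ ℕ := Finsupp.weight fun v => v.1 + v.2

theorem height_single (v : ℕ × ℕ) : height (Finsupp.single v 1) = v.1 + v.2 := by
  simp [height, Finsupp.weight_single]

/-- The largest height of a monomial of `f`, followed by the number of monomials of `f`. -/
def size (f : Poly) : ℕ ×ₗ ℕ := toLex (f.support.sup height, f.support.card)

theorem size_lt_of_height_lt {f g : Poly} (hg : g ≠ 0)
    (h : ∀ m ∈ g.support, ∃ m' ∈ f.support, height m < height m') : size g < size f := by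
  refine Prod.Lex.toLex_lt_toLex.2 (Or.inl ?_)
  have hne : g.support.Nonempty := Finset.nonempty_iff_ne_empty.2 fun h => hg (support_eq_empty.1 h)
  obtain ⟨m, hm, hsup⟩ := Finset.exists_mem_eq_sup g.support hne height
  obtain ⟨m', hm', hlt⟩ := h m hm
  change g.support.sup height < f.support.sup height
  rw [hsup]
  exact lt_of_lt_of_le hlt (Finset.le_sup (f := height) hm')

theorem size_lt_of_ssubset {f g : Poly} (h : g.support ⊂ f.support) : size g < size f := by
  refine Prod.Lex.toLex_lt_toLex.2 ?_
  rcases (Finset.sup_mono (f := height) h.subset).lt_or_eq with h' | h'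
  · exact Or.inl h'
  · exact Or.inr ⟨h', Finset.card_lt_card h⟩

/-- Moving a factor from row `b` to the earlier row `a` lowers the height of each monomial. -/
theorem size_rowOp_lt {a b : ℕ} (hab : a < b) {f : Poly} (h : rowOp a b f ≠ 0) :
    size (rowOp a b f) < size f := by
  refine size_lt_of_height_lt h fun m hm => ?_
  obtain ⟨m', j, rfl, hm'⟩ := exists_of_mem_support_rowOp hm
  refine ⟨_, hm', ?_⟩
  rw [map_add, map_add, height_single, height_single]
  simpa using hab

theorem size_colOp_lt {a b : ℕ} (hab : a < b) {f : Poly} (h : colOp a b f ≠ 0) :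
    size (colOp a b f) < size f := by
  refine size_lt_of_height_lt h fun m hm => ?_
  obtain ⟨m', j, rfl, hm'⟩ := exists_of_mem_support_colOp hm
  refine ⟨_, hm', ?_⟩
  rw [map_add, map_add, height_single, height_single]
  simpa using hab

/-- For an operator that is diagonal on monomials, subtracting the eigenvalue at `m` removes `m`
from the support and adds nothing. This is why `size` also counts monomials: minimal elements become
eigenvectors. -/
theorem size_sub_smul_lt {f g : Poly} {c : ((ℕ × ℕ) →₀ ℕ) → ℂ} {m : (ℕ × ℕ) →₀ ℕ}
    (hm : m ∈ f.support) (hg : ∀ m, coeff m g = c m * coeff m f) :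
    size (g - c m • f) < size f := by
  have h : ∀ m', coeff m' (g - c m • f) = (c m' - c m) * coeff m' f := fun m' => by
    rw [coeff_sub, coeff_smul, hg, smul_eq_mul, sub_mul]
  refine size_lt_of_ssubset ⟨fun m' hm' => ?_, fun hsub => ?_⟩
  · rw [mem_support_iff, h] at hm'
    exact mem_support_iff.2 (right_ne_zero_of_mul hm')
  · have := hsub hm
    rw [mem_support_iff, h, sub_self, zero_mul] at this
    exact this rfl

/-- Well-foundedness replaces finite dimension of `Z`. An operator that preserves `Z` and strictly
decreases the size of whatever it does not kill must annihilate `u`. -/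
theorem exists_minimal_size {S : Type*} [AddCommGroup S] [Module ℂ S] (Φ : S → Poly)
    {Z : Submodule ℂ S} (hZ : Z ≠ ⊥) :
    ∃ u ∈ Z, u ≠ 0 ∧ ∀ v ∈ Z, size (Φ v) < size (Φ u) → v = 0 := by
  obtain ⟨z, hz, hz0⟩ := Z.ne_bot_iff.1 hZ
  obtain ⟨u, ⟨huZ, hu0⟩, hu⟩ := WellFounded.has_min
    (InvImage.wf (fun s => size (Φ s)) wellFounded_lt) {s | s ∈ Z ∧ s ≠ 0} ⟨z, hz, hz0⟩
  exact ⟨u, huZ, hu0, fun v hv h => by_contra fun hv0 => hu v ⟨hv, hv0⟩ h⟩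

/-! ### Polynomials that are invariant under raising operators -/

/-- By `hD` the line `x + t y` is an integral curve of `D`, so `f (x + t y)` has derivative `(D f)
(x + t y) = 0` in `t`. Compare `t = 1` with `t = 0`. -/
theorem eval_add_eq {f : Poly} (D : Derivation ℂ Poly Poly) (hf : D f = 0) (x y : ℕ × ℕ → ℂ)
    (hD : ∀ v, aeval (fun v => Polynomial.C (x v) + Polynomial.X * Polynomial.C (y v)) (D (X v)) =
      Polynomial.C (y v)) :
    eval (fun v => x v + y v) f = eval x f := by
  set A : Poly →ₐ[ℂ] Polynomial ℂ :=
    aeval fun v => Polynomial.C (x v) + Polynomial.X * Polynomial.C (y v) with hA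
  have h1 : ∀ g, Polynomial.derivative (A g) = A (D g) := by
    intro g
    induction g using MvPolynomial.induction_on with
    | C c => simp [← algebraMap_eq]
    | add p q hp hq => simp only [map_add, hp, hq]
    | mul_X p v hp =>
      rw [map_mul, Polynomial.derivative_mul, hp, Derivation.leibniz, map_add, smul_eq_mul,
        smul_eq_mul, map_mul, map_mul, hD, hA, aeval_X]
      simp
      ring
  have h2 : ∀ t : ℂ, (A f).eval t = eval (fun v => x v + t * y v) f := by
    intro t
    have : ((Polynomial.aeval t).comp A : Poly →ₐ[ℂ] ℂ) = aeval fun v => x v + t * y v := by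
      ext v
      simp [hA, mul_comm (y v)]
    have := DFunLike.congr_fun this f
    rw [AlgHom.comp_apply, Polynomial.coe_aeval_eq_eval] at this
    rw [this, ← coe_aeval_eq_eval]
    rfl
  have h3 : Polynomial.derivative (A f) = 0 := by rw [h1, hf, map_zero]
  have h4 := Polynomial.eq_C_of_derivative_eq_zero h3
  have h5 : (A f).eval 1 = (A f).eval 0 := by rw [h4, Polynomial.eval_C, Polynomial.eval_C]
  rw [h2, h2] at h5
  simpa using h5

/-- `f` is killed by the strictly upper triangular row and column operations. -/
structure IsRaised (f : Poly) : Prop where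
  row : ∀ a b, a < b → rowOp a b f = 0
  col : ∀ a b, a < b → colOp a b f = 0

/-- Adding multiples of row `k` to the rows below it does not change the value. -/
theorem IsRaised.eval_row {f : Poly} (hf : IsRaised f) (k : ℕ) (c : ℕ → ℂ)
    (hc : ∀ b ≤ k, c b = 0) (x : ℕ × ℕ → ℂ) :
    eval (fun v => x v + c v.1 * x (k, v.2)) f = eval x f := by
  classical
  let D : Derivation ℂ Poly Poly := mkDerivation ℂ fun v => c v.1 • X (k, v.2)
  refine eval_add_eq D ?_ x _ fun v => ?_
  -- On `f` the derivation is a finite combination of the operations `rowOp k b`; those with `b > k`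
  -- are raising, and the others have coefficient zero.
  · have : D f = (∑ b ∈ f.vars.image Prod.fst, c b • rowOp k b) f := by
      refine derivation_eq_of_forall_mem_vars fun v hv => ?_
      rw [derivation_sum_apply, mkDerivation_X, Finset.sum_eq_single v.1]
      · simp
      · intro b _ hb
        simp [hb.symm]
      · exact fun h => absurd (Finset.mem_image_of_mem _ hv) h
    rw [this, derivation_sum_apply]
    refine Finset.sum_eq_zero fun b _ => ?_
    rw [Derivation.smul_apply]
    rcases le_or_gt b k with h | h
    · rw [hc b h, zero_smul]
    · rw [hf.row k b h, smul_zero]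
  -- Since `c k = 0`, row `k` does not move along the line, so the velocity is constant.
  · simp [D, mkDerivation_X, hc k le_rfl, Algebra.smul_def]

/-- Adding multiples of column `k` to the columns to the right of it does not change the value. -/
theorem IsRaised.eval_col {f : Poly} (hf : IsRaised f) (k : ℕ) (c : ℕ → ℂ)
    (hc : ∀ b ≤ k, c b = 0) (x : ℕ × ℕ → ℂ) :
    eval (fun v => x v + c v.2 * x (v.1, k)) f = eval x f := by
  classical
  let D : Derivation ℂ Poly Poly := mkDerivation ℂ fun v => c v.2 • X (v.1, k)
  refine eval_add_eq D ?_ x _ fun v => ?_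
  · have : D f = (∑ b ∈ f.vars.image Prod.snd, c b • colOp k b) f := by
      refine derivation_eq_of_forall_mem_vars fun v hv => ?_
      rw [derivation_sum_apply, mkDerivation_X, Finset.sum_eq_single v.2]
      · simp
      · intro b _ hb
        simp [hb.symm]
      · exact fun h => absurd (Finset.mem_image_of_mem _ hv) h
    rw [this, derivation_sum_apply]
    refine Finset.sum_eq_zero fun b _ => ?_
    rw [Derivation.smul_apply]
    rcases le_or_gt b k with h | h
    · rw [hc b h, zero_smul]
    · rw [hf.col k b h, smul_zero]
  · simp [D, mkDerivation_X, hc k le_rfl, Algebra.smul_def]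

/-- As a function of the single entry at `v` this is a polynomial with infinitely many roots. It
removes the assumption of a non-zero pivot in the elimination below. -/
theorem eval_eq_zero_of_ne_zero {f : Poly} (v : ℕ × ℕ) (x : ℕ × ℕ → ℂ)
    (h : ∀ t : ℂ, t ≠ 0 → eval (Function.update x v t) f = 0) (t : ℂ) :
    eval (Function.update x v t) f = 0 := by
  classical
  set A : Poly →ₐ[ℂ] Polynomial ℂ :=
    aeval (Function.update (fun u => Polynomial.C (x u)) v Polynomial.X) with hA
  have h2 : ∀ t : ℂ, (A f).eval t = eval (Function.update x v t) f := by
    intro t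
    have : ((Polynomial.aeval t).comp A : Poly →ₐ[ℂ] ℂ) = aeval (Function.update x v t) := by
      ext u
      by_cases hu : u = v
      · subst hu; simp [hA]
      · simp [hA, hu]
    have := DFunLike.congr_fun this f
    rw [AlgHom.comp_apply, Polynomial.coe_aeval_eq_eval] at this
    rw [this, ← coe_aeval_eq_eval]
    rfl
  have h3 : A f = 0 := by
    refine Polynomial.eq_zero_of_infinite_isRoot _ (Set.Infinite.mono (s := {0}ᶜ) (fun t ht => ?_)
      (Set.finite_singleton _).infinite_compl)
    rw [Set.mem_ofPred_eq, Polynomial.IsRoot, h2]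
    exact h t ht
  rw [← h2, h3, Polynomial.eval_zero]

/-- A polynomial that is invariant under raising operators is determined by its values on
diagonal matrices. -/
theorem IsRaised.eq_zero_of_eval_diag {f : Poly} (hf : IsRaised f)
    (h : ∀ x : ℕ × ℕ → ℂ, (∀ i j, i ≠ j → x (i, j) = 0) → eval x f = 0) : f = 0 := by
  classical
  -- the values on matrices whose first `k` rows and columns are diagonal
  have step : ∀ k : ℕ,
      (∀ x : ℕ × ℕ → ℂ, (∀ i j, i ≠ j → (i < k + 1 ∨ j < k + 1) → x (i, j) = 0) → eval x f = 0) →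
      ∀ x : ℕ × ℕ → ℂ, (∀ i j, i ≠ j → (i < k ∨ j < k) → x (i, j) = 0) → eval x f = 0 := by
    intro k hk
    -- Elimination with pivot `x (k, k)`: row operations clear column `k` below the pivot, then
    -- column operations clear row `k` to its right. The latter change only row `k`, the rest of
    -- column `k` being zero by then.
    have main : ∀ x : ℕ × ℕ → ℂ, (∀ i j, i ≠ j → (i < k ∨ j < k) → x (i, j) = 0) →
        x (k, k) ≠ 0 → eval x f = 0 := by
      intro x hx hxk
      rw [← hf.eval_row k (fun b => if k < b then -x (b, k) / x (k, k) else 0)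
        (fun b hb => if_neg (not_lt.2 hb)) x]
      set x₁ : ℕ × ℕ → ℂ :=
        fun v => x v + (if k < v.1 then -x (v.1, k) / x (k, k) else 0) * x (k, v.2) with hx₁
      have h1k : ∀ j, x₁ (k, j) = x (k, j) := fun j => by simp [hx₁]
      have h1c : ∀ i, i ≠ k → x₁ (i, k) = 0 := by
        intro i hi
        rcases lt_or_gt_of_ne hi with hik | hik
        · simp [hx₁, not_lt.2 hik.le, hx i k hi (Or.inl hik)]
        · simp only [hx₁, hik, if_true]
          field_simp
          ring
      have h1 : ∀ i j, i ≠ j → (i < k ∨ j < k) → x₁ (i, j) = 0 := by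
        intro i j hij hlt
        by_cases hik : k < i
        · have hjk : j < k := by omega
          simp [hx₁, hx i j hij hlt, hx k j (by omega) (Or.inr hjk)]
        · simp [hx₁, hx i j hij hlt, hik]
      rw [← hf.eval_col k (fun b => if k < b then -x₁ (k, b) / x₁ (k, k) else 0)
        (fun b hb => if_neg (not_lt.2 hb)) x₁]
      refine hk _ fun i j hij hlt => ?_
      by_cases hi : i = k
      · subst hi
        have h0 : x₁ (i, i) ≠ 0 := by rwa [h1k]
        by_cases hjk : i < j
        · simp only [hjk, if_true]
          field_simp
          ring
        · simp [hjk, h1 i j hij (Or.inr (by omega))]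
      · simp only [h1c i hi, mul_zero, add_zero]
        by_cases hj : j = k
        · rw [hj]; exact h1c i hi
        · exact h1 i j hij (by omega)
    intro x hx
    have hup : x = Function.update x (k, k) (x (k, k)) := (Function.update_eq_self _ _).symm
    rw [hup]
    refine eval_eq_zero_of_ne_zero (k, k) x (fun t ht => main _ (fun i j hij hlt => ?_) ?_) _
    · rw [Function.update_of_ne (by rintro ⟨⟩; exact hij rfl)]
      exact hx i j hij hlt
    · rwa [Function.update_self]
  -- No variable of `f` lies in a row from `n` on, so the elimination may stop there; the induction
  -- goes down from `n` to `0`, where the condition on `x` is empty.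
  obtain ⟨n, hn⟩ : ∃ n, ∀ v ∈ f.vars, v.1 < n :=
    ⟨f.vars.sup Prod.fst + 1, fun v hv => Nat.lt_succ_of_le (Finset.le_sup (f := Prod.fst) hv)⟩
  have top : ∀ x : ℕ × ℕ → ℂ, (∀ i j, i ≠ j → (i < n ∨ j < n) → x (i, j) = 0) → eval x f = 0 := by
    intro x hx
    rw [← h (fun v => if v.1 = v.2 then x v else 0) fun i j hij => if_neg hij]
    refine eval₂Hom_congr' rfl (fun v hv _ => ?_) rfl
    by_cases hv' : v.1 = v.2
    · rw [if_pos hv']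
    · rw [if_neg hv']
      exact hx v.1 v.2 hv' (Or.inl (hn v hv))
  have all : ∀ k ≤ n, ∀ x : ℕ × ℕ → ℂ,
      (∀ i j, i ≠ j → (i < n - k ∨ j < n - k) → x (i, j) = 0) → eval x f = 0 := by
    intro k
    induction k with
    | zero => exact fun _ => top
    | succ k ih =>
      intro hk
      refine step (n - (k + 1)) ?_
      rw [show n - (k + 1) + 1 = n - k by omega]
      exact ih (by omega)
  refine MvPolynomial.funext fun x => ?_
  rw [map_zero]
  exact all n le_rfl x fun i j _ hlt => by omega

/-- A monomial with an off-diagonal variable vanishes on diagonal matrices, so only diagonal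
monomials contribute to the values there. -/
theorem IsRaised.eq_zero_of_coeff_diag {f : Poly} (hf : IsRaised f)
    (h : ∀ m : (ℕ × ℕ) →₀ ℕ, (∀ v, m v ≠ 0 → v.1 = v.2) → coeff m f = 0) : f = 0 := by
  refine hf.eq_zero_of_eval_diag fun x hx => ?_
  rw [eval_eq]
  refine Finset.sum_eq_zero fun m _ => ?_
  by_cases hm : ∀ v, m v ≠ 0 → v.1 = v.2
  · rw [h m hm, zero_mul]
  · push Not at hm
    obtain ⟨v, hv, hne⟩ := hm
    rw [Finset.prod_eq_zero (Finsupp.mem_support_iff.2 hv), mul_zero]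
    rw [hx v.1 v.2 hne, zero_pow hv]

theorem IsRaised.smul_sub_smul {f g : Poly} (hf : IsRaised f) (hg : IsRaised g) (a b : ℂ) :
    IsRaised (a • f - b • g) where
  row i j h := by
    rw [map_sub, Derivation.map_smul, Derivation.map_smul, hf.row i j h, hg.row i j h]
    simp
  col i j h := by
    rw [map_sub, Derivation.map_smul, Derivation.map_smul, hf.col i j h, hg.col i j h]
    simp

/-- `f` has the weight `μ` for the diagonal row operations. -/
def HasRowWeight (f : Poly) (μ : ℕ → ℕ) : Prop := ∀ a, rowOp a a f = (μ a : ℂ) • f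

/-- `f` has the weight `μ` for the diagonal column operations. -/
def HasColWeight (f : Poly) (μ : ℕ → ℕ) : Prop := ∀ a, colOp a a f = (μ a : ℂ) • f

theorem HasRowWeight.rowDeg_eq {f : Poly} {μ : ℕ → ℕ} (hf : HasRowWeight f μ)
    {m : (ℕ × ℕ) →₀ ℕ} (hm : coeff m f ≠ 0) (a : ℕ) : rowDeg a m = μ a := by
  have h := congrArg (coeff m) (hf a)
  rw [coeff_rowOp_self, coeff_smul, smul_eq_mul] at h
  exact_mod_cast mul_right_cancel₀ hm h

theorem rowDeg_of_diag {m : (ℕ × ℕ) →₀ ℕ} (hm : ∀ v, m v ≠ 0 → v.1 = v.2) (a : ℕ) :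
    rowDeg a m = m (a, a) := by
  rw [rowDeg, Finsupp.weight_apply, Finsupp.sum, Finset.sum_eq_single (a, a)]
  · simp
  · rintro ⟨i, j⟩ hv hne
    obtain rfl : i = j := hm _ (Finsupp.mem_support_iff.1 hv)
    have : i ≠ a := fun h => hne (by rw [h])
    simp [this]
  · intro h
    rw [Finsupp.notMem_support_iff.1 h, zero_smul]

/-- The space of raised polynomials of a given weight is at most one-dimensional. -/
theorem IsRaised.eq_smul {f g : Poly} {μ : ℕ → ℕ} (hf : IsRaised f) (hg : IsRaised g)
    (hfμ : HasRowWeight f μ) (hgμ : HasRowWeight g μ) (hg0 : g ≠ 0) : ∃ c : ℂ, f = c • g := by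
  obtain ⟨m, hm, hmg⟩ : ∃ m : (ℕ × ℕ) →₀ ℕ, (∀ v, m v ≠ 0 → v.1 = v.2) ∧ coeff m g ≠ 0 := by
    by_contra! h
    exact hg0 (hg.eq_zero_of_coeff_diag h)
  -- A diagonal monomial is determined by its row degrees, so `m` is the only diagonal monomial that
  -- can occur in weight `μ`.
  have huniq : ∀ (h : Poly), HasRowWeight h μ → ∀ m' : (ℕ × ℕ) →₀ ℕ,
      (∀ v, m' v ≠ 0 → v.1 = v.2) → m' ≠ m → coeff m' h = 0 := by
    intro h hμ m' hm' hne
    by_contra h0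
    refine hne (Finsupp.ext fun v => ?_)
    by_cases hv : v.1 = v.2
    · obtain ⟨i, j⟩ := v
      obtain rfl : i = j := hv
      rw [← rowDeg_of_diag hm', ← rowDeg_of_diag hm, hμ.rowDeg_eq h0, hgμ.rowDeg_eq hmg]
    · rw [not_not.1 (mt (hm' v) hv), not_not.1 (mt (hm v) hv)]
  -- This combination cancels the coefficient at `m`, hence has no diagonal monomial left.
  have h0 := (hf.smul_sub_smul hg (coeff m g) (coeff m f)).eq_zero_of_coeff_diag fun m' hm' => by
    rw [coeff_sub, coeff_smul, coeff_smul, smul_eq_mul, smul_eq_mul]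
    by_cases hmm : m' = m
    · rw [hmm]; ring
    · rw [huniq f hfμ m' hm' hmm, huniq g hgμ m' hm' hmm]; ring
  refine ⟨(coeff m g)⁻¹ * coeff m f, ?_⟩
  rw [mul_smul, ← sub_eq_zero.1 h0, smul_smul, inv_mul_cancel₀ hmg, one_smul]

theorem rowOp_commutator (a b : ℕ) (f : Poly) :
    rowOp a b (rowOp b a f) - rowOp b a (rowOp a b f) = rowOp a a f - rowOp b b f := by
  have h : ⁅rowOp a b, rowOp b a⁆ = rowOp a a - rowOp b b := by
    refine MvPolynomial.derivation_ext fun v => ?_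
    rw [Derivation.commutator_apply, Derivation.sub_apply, rowOp_X, rowOp_X, rowOp_X, rowOp_X]
    obtain ⟨i, j⟩ := v
    by_cases ha : i = a <;> by_cases hb : i = b <;> simp [ha, hb]
    · subst ha; subst hb; simp
    · subst ha; simp [hb]
    · subst hb; simp [ha]
  rw [← Derivation.commutator_apply, h, Derivation.sub_apply]

/-- The weight of a raised polynomial is dominant. -/
theorem IsRaised.antitone {f : Poly} {μ : ℕ → ℕ} (hf : IsRaised f) (hμ : HasRowWeight f μ)
    (hf0 : f ≠ 0) : Antitone μ := by
  refine antitone_nat_of_succ_le fun a => ?_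
  -- The `sl₂` computation: move one lowering operator across the form, and replace the resulting
  -- product by the commutator, since the raising operator kills `f`. The squared norm on the left
  -- is non-negative.
  have h1 : fischer (rowOp (a + 1) a f) (rowOp (a + 1) a f) =
      ((μ a : ℂ) - μ (a + 1)) * fischer f f := by
    have h := rowOp_commutator a (a + 1) f
    rw [hf.row a (a + 1) (Nat.lt_succ_self a), map_zero, sub_zero, hμ, hμ] at h
    rw [fischer_rowOp, h, ← sub_smul, map_smul, smul_eq_mul]
  have h2 := isPosDefForm_fischer.nonneg (rowOp (a + 1) a f)
  have h3 : 0 < (fischer f f).re := by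
    refine lt_of_le_of_ne (isPosDefForm_fischer.nonneg f) fun h => hf0 ?_
    refine isPosDefForm_fischer.definite f (Complex.ext h.symm ?_)
    rw [fischer_self, Complex.ofReal_im, Complex.zero_im]
  have h4 : (((μ a : ℂ) - μ (a + 1)) * fischer f f).re =
      ((μ a : ℝ) - μ (a + 1)) * (fischer f f).re := by
    rw [show ((μ a : ℂ) - μ (a + 1)) = (((μ a : ℝ) - μ (a + 1) : ℝ) : ℂ) by push_cast; rfl,
      Complex.re_ofReal_mul]
  rw [h1, h4] at h2
  have h5 := nonneg_of_mul_nonneg_left h2 h3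
  exact_mod_cast sub_nonneg.1 h5

/-- A polynomial such that the diagonal row operations do not decrease its size has a weight. -/
theorem exists_hasRowWeight {f : Poly} (hf : f ≠ 0)
    (h : ∀ (a : ℕ) (c : ℂ), size (rowOp a a f - c • f) < size f → rowOp a a f - c • f = 0) :
    ∃ μ : ℕ → ℕ, HasRowWeight f μ := by
  -- Any monomial of `f` serves: its row degrees are the weight.
  obtain ⟨m, hm⟩ := Finset.nonempty_iff_ne_empty.2 fun h => hf (support_eq_empty.1 h)
  exact ⟨fun a => rowDeg a m, fun a => sub_eq_zero.1
    (h a _ (size_sub_smul_lt (c := fun m => (rowDeg a m : ℂ)) hm (coeff_rowOp_self a f)))⟩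

end MatrixPoly

/-! ### Products of minors as highest weight vectors -/

namespace MatrixPoly

open MvPolynomial

/-- `f` is a highest weight vector of weight `μ` for the row and the column operations. -/
structure IsHighest (f : Poly) (μ : ℕ → ℕ) : Prop where
  raised : IsRaised f
  row : HasRowWeight f μ
  col : HasColWeight f μ

theorem IsHighest.one : IsHighest 1 0 where
  raised := ⟨fun _ _ _ => Derivation.map_one_eq_zero _, fun _ _ _ => Derivation.map_one_eq_zero _⟩
  row a := by simp
  col a := by simp

/-- The Leibniz rule: the operators are derivations, so weights add. This reduces products of
determinants to single minors. -/
theorem IsHighest.mul {f g : Poly} {μ ν : ℕ → ℕ} (hf : IsHighest f μ) (hg : IsHighest g ν) :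
    IsHighest (f * g) (μ + ν) where
  raised :=
    ⟨fun a b h => by simp [Derivation.leibniz, hf.raised.row a b h, hg.raised.row a b h],
      fun a b h => by simp [Derivation.leibniz, hf.raised.col a b h, hg.raised.col a b h]⟩
  row a := by
    rw [Derivation.leibniz, hf.row, hg.row]
    simp [add_smul, mul_comm, add_comm]
  col a := by
    rw [Derivation.leibniz, hf.col, hg.col]
    simp [add_smul, mul_comm, add_comm]

theorem IsHighest.pow {f : Poly} {μ : ℕ → ℕ} (hf : IsHighest f μ) (k : ℕ) :
    IsHighest (f ^ k) (k • μ) := by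
  induction k with
  | zero => simpa using IsHighest.one
  | succ k ih => rw [pow_succ, succ_nsmul]; exact ih.mul hf

theorem IsHighest.prod {ι : Type*} (s : Finset ι) {f : ι → Poly} {μ : ι → ℕ → ℕ}
    (hf : ∀ i ∈ s, IsHighest (f i) (μ i)) : IsHighest (∏ i ∈ s, f i) (∑ i ∈ s, μ i) := by
  classical
  induction s using Finset.induction_on with
  | empty => simpa using IsHighest.one
  | insert i s hi ih =>
    rw [Finset.prod_insert hi, Finset.sum_insert hi]
    exact (hf i (Finset.mem_insert_self i s)).mul
      (ih fun j hj => hf j (Finset.mem_insert_of_mem hj))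

theorem derivation_prod {ι : Type*} [DecidableEq ι] (D : Derivation ℂ Poly Poly) (s : Finset ι)
    (f : ι → Poly) : D (∏ i ∈ s, f i) = ∑ p ∈ s, ∏ i ∈ s, if i = p then D (f i) else f i := by
  induction s using Finset.induction_on with
  | empty => simp
  | insert a s ha ih =>
    have h1 : ∏ i ∈ s, (if i = a then D (f i) else f i) = ∏ i ∈ s, f i :=
      Finset.prod_congr rfl fun i hi => if_neg (ne_of_mem_of_not_mem hi ha)
    have h2 : ∀ p ∈ s, (∏ i ∈ insert a s, if i = p then D (f i) else f i) =
        f a * ∏ i ∈ s, if i = p then D (f i) else f i := fun p hp => by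
      rw [Finset.prod_insert ha, if_neg (ne_of_mem_of_not_mem hp ha).symm]
    rw [Finset.prod_insert ha, Derivation.leibniz, ih, Finset.sum_insert ha, Finset.sum_congr rfl h2,
      Finset.prod_insert ha, if_pos rfl, h1, ← Finset.mul_sum, smul_eq_mul, smul_eq_mul, add_comm,
      mul_comm (D (f a))]

/-- A derivation acts on a determinant row by row. -/
theorem derivation_det {n : ℕ} (D : Derivation ℂ Poly Poly) (M : Matrix (Fin n) (Fin n) Poly) :
    D M.det = ∑ p, (M.updateRow p fun q => D (M p q)).det := by
  -- The transposed Leibniz formula, so that the factors are indexed by rows.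
  have hdet : ∀ N : Matrix (Fin n) (Fin n) Poly,
      N.det = ∑ σ : Equiv.Perm (Fin n), Equiv.Perm.sign σ • ∏ i, N i (σ i) := fun N => by
    rw [← Matrix.det_transpose, Matrix.det_apply]
    rfl
  simp_rw [hdet]
  rw [map_sum, Finset.sum_comm]
  refine Finset.sum_congr rfl fun σ _ => ?_
  rw [← Finset.smul_sum]
  have hs : ∀ g : Poly, D (Equiv.Perm.sign σ • g) = Equiv.Perm.sign σ • D g := fun g => by
    rw [Units.smul_def, Units.smul_def, map_zsmul]
  rw [hs, derivation_prod]
  congr 1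
  refine Finset.sum_congr rfl fun p _ => Finset.prod_congr rfl fun i _ => ?_
  by_cases h : i = p
  · subst h
    rw [if_pos rfl, Matrix.updateRow_self]
  · rw [if_neg h, Matrix.updateRow_ne h]

/-- The leading minor of size `k`, with its columns in reverse order. -/
def minor (k : ℕ) : Poly :=
  Matrix.det (Matrix.of fun p q : Fin k => (X ((p : ℕ), (q.rev : ℕ)) : Poly))

/-- At the identity matrix the reversed columns give a permutation matrix, of determinant `±1`. -/
theorem minor_ne_zero (k : ℕ) : minor k ≠ 0 := by
  intro h
  have h1 := congrArg (eval fun v : ℕ × ℕ => if v.1 = v.2 then (1 : ℂ) else 0) h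
  rw [minor, RingHom.map_det, map_zero] at h1
  have h2 : (eval fun v : ℕ × ℕ => if v.1 = v.2 then (1 : ℂ) else 0).mapMatrix
      (Matrix.of fun p q : Fin k => (X ((p : ℕ), (q.rev : ℕ)) : Poly)) =
      (1 : Matrix (Fin k) (Fin k) ℂ).submatrix id Fin.revPerm := by
    ext p q
    simp [Matrix.one_apply, Fin.ext_iff]
  rw [h2, Matrix.det_permute', Matrix.det_one, mul_one] at h1
  exact (Int.cast_ne_zero.2 (Units.ne_zero _)) h1

/-- The operation replaces row `b` of the minor by row `a`, which also belongs to the minor because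
`a ≤ b`. For `a < b` two rows coincide; for `a = b` nothing changes; for `b ≥ k` there is no such
row. -/
theorem rowOp_minor (a b k : ℕ) (hab : a ≤ b) :
    rowOp a b (minor k) = if a = b ∧ a < k then minor k else 0 := by
  rw [minor, derivation_det]
  set M : Matrix (Fin k) (Fin k) Poly := Matrix.of fun p q => X ((p : ℕ), (q.rev : ℕ)) with hM
  have hzero : ∀ p : Fin k, (p : ℕ) ≠ b → (M.updateRow p fun q => rowOp a b (M p q)).det = 0 := by
    intro p hp
    refine Matrix.det_eq_zero_of_row_eq_zero p fun q => ?_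
    simp [hM, hp]
  by_cases hb : b < k
  · rw [Finset.sum_eq_single ⟨b, hb⟩ (fun p _ hp => hzero p fun h => hp (Fin.ext h))
      (fun h => absurd (Finset.mem_univ _) h)]
    have hrow : (fun q => rowOp a b (M ⟨b, hb⟩ q)) = M ⟨a, hab.trans_lt hb⟩ := by
      ext1 q
      simp [hM]
    rw [hrow]
    by_cases hab' : a = b
    · subst hab'
      rw [Matrix.updateRow_eq_self, if_pos ⟨rfl, hb⟩]
    · rw [if_neg fun h => hab' h.1]
      refine Matrix.det_zero_of_row_eq (i := ⟨a, hab.trans_lt hb⟩) (j := ⟨b, hb⟩)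
        (fun h => hab' (congrArg Fin.val h)) ?_
      rw [Matrix.updateRow_self, Matrix.updateRow_ne fun h => hab' (congrArg Fin.val h)]
  · rw [Finset.sum_eq_zero fun p _ => hzero p fun h => hb (h ▸ p.2),
      if_neg fun h : a = b ∧ a < k => hb (h.1 ▸ h.2)]

theorem colOp_minor (a b k : ℕ) (hab : a ≤ b) :
    colOp a b (minor k) = if a = b ∧ a < k then minor k else 0 := by
  rw [minor, ← Matrix.det_transpose, derivation_det]
  set M : Matrix (Fin k) (Fin k) Poly :=
    (Matrix.of fun p q : Fin k => (X ((p : ℕ), (q.rev : ℕ)) : Poly)).transpose with hM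
  have hzero : ∀ p : Fin k, (p.rev : ℕ) ≠ b →
      (M.updateRow p fun q => colOp a b (M p q)).det = 0 := by
    intro p hp
    refine Matrix.det_eq_zero_of_row_eq_zero p fun q => ?_
    simp only [hM, Matrix.updateRow_self, Matrix.transpose_apply, Matrix.of_apply, colOp_X,
      if_neg hp]
  by_cases hb : b < k
  · rw [Finset.sum_eq_single (⟨b, hb⟩ : Fin k).rev (fun p _ hp => hzero p fun h => hp (by
      rw [← Fin.rev_rev p]; exact congrArg Fin.rev (Fin.ext h)))
      (fun h => absurd (Finset.mem_univ _) h)]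
    have hrow : (fun q => colOp a b (M (⟨b, hb⟩ : Fin k).rev q)) =
        M (⟨a, hab.trans_lt hb⟩ : Fin k).rev := by
      ext1 q
      simp only [hM, Matrix.transpose_apply, Matrix.of_apply, colOp_X, Fin.rev_rev, if_true]
    rw [hrow]
    by_cases hab' : a = b
    · subst hab'
      rw [Matrix.updateRow_eq_self, if_pos ⟨rfl, hb⟩]
    · rw [if_neg fun h => hab' h.1]
      have hne : (⟨a, hab.trans_lt hb⟩ : Fin k).rev ≠ (⟨b, hb⟩ : Fin k).rev :=
        fun h => hab' (congrArg Fin.val (Fin.rev_injective h))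
      refine Matrix.det_zero_of_row_eq hne ?_
      rw [Matrix.updateRow_self, Matrix.updateRow_ne hne]
  · rw [Finset.sum_eq_zero fun p _ => hzero p fun h => hb (h ▸ p.rev.2),
      if_neg fun h : a = b ∧ a < k => hb (h.1 ▸ h.2)]

theorem isHighest_minor (k : ℕ) : IsHighest (minor k) fun a => if a < k then 1 else 0 where
  raised :=
    ⟨fun a b h => by rw [rowOp_minor a b k h.le, if_neg fun h' => h.ne h'.1],
      fun a b h => by rw [colOp_minor a b k h.le, if_neg fun h' => h.ne h'.1]⟩
  row a := by rw [rowOp_minor a a k le_rfl]; split_ifs <;> simp_all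
  col a := by rw [colOp_minor a a k le_rfl]; split_ifs <;> simp_all

/-! ### Polynomials of bounded degree in finitely many variables -/

/-- Polynomials of degree at most `d` in the first `n` rows and columns. -/
def bounded (n d : ℕ) : Submodule ℂ Poly :=
  restrictSupport ℂ {m | (∀ v ∈ m.support, v.1 < n ∧ v.2 < n) ∧ Finsupp.degree m ≤ d}

instance (n d : ℕ) : FiniteDimensional ℂ (bounded n d) := by
  have hfin : {m : (ℕ × ℕ) →₀ ℕ |
      (∀ v ∈ m.support, v.1 < n ∧ v.2 < n) ∧ Finsupp.degree m ≤ d}.Finite := by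
    classical
    refine Set.Finite.subset (Finset.finite_toSet
      ((Finset.range n ×ˢ Finset.range n).finsupp fun _ => Finset.range (d + 1))) fun m hm => ?_
    rw [Finset.mem_coe, Finset.mem_finsupp_iff]
    refine ⟨fun v hv => ?_, fun v _ => ?_⟩
    · simpa using hm.1 v hv
    · rw [Finset.mem_range, Nat.lt_succ_iff]
      exact (Finsupp.le_degree v m).trans hm.2
  have := hfin.to_subtype
  exact Module.Finite.of_basis (basisRestrictSupport ℂ _)

theorem exists_mem_bounded (f : Poly) : ∃ n d, f ∈ bounded n d := by
  classical
  refine ⟨f.vars.sup (fun v => max v.1 v.2) + 1, f.support.sup Finsupp.degree, fun m hm =>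
    ⟨fun v hv => ?_, Finset.le_sup (f := Finsupp.degree) hm⟩⟩
  have h : max v.1 v.2 ≤ f.vars.sup (fun v => max v.1 v.2) :=
    Finset.le_sup (f := fun v : ℕ × ℕ => max v.1 v.2)
      ((mem_vars_iff_mem_support v).2 ⟨m, hm, hv⟩)
  exact ⟨by omega, by omega⟩

theorem mem_support_add_single {m : (ℕ × ℕ) →₀ ℕ} {u v : ℕ × ℕ}
    (h : v ∈ (m + Finsupp.single u 1).support) : v = u ∨ v ∈ m.support := by
  by_cases hv : v = u
  · exact Or.inl hv
  · refine Or.inr ?_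
    simpa [Finsupp.single_apply, Ne.symm hv] using h

theorem subset_support_add_single {m : (ℕ × ℕ) →₀ ℕ} {u v : ℕ × ℕ} (h : v = u ∨ v ∈ m.support) :
    v ∈ (m + Finsupp.single u 1).support := by
  rcases h with rfl | h
  · simp
  · simp only [Finsupp.mem_support_iff, Finsupp.add_apply] at h ⊢
    omega

/-- Polarizations preserve the degree, and the only new variables are in row `a`. -/
theorem rowOp_mem_bounded {n d a b : ℕ} (ha : a < n) {f : Poly} (hf : f ∈ bounded n d) :
    rowOp a b f ∈ bounded n d := fun m hm => by
  obtain ⟨m', j, rfl, hm'⟩ := exists_of_mem_support_rowOp hm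
  obtain ⟨h1, h2⟩ := hf hm'
  refine ⟨fun v hv => ?_, ?_⟩
  · rcases mem_support_add_single hv with rfl | hv
    · exact ⟨ha, (h1 _ (subset_support_add_single (Or.inl rfl))).2⟩
    · exact h1 v (subset_support_add_single (Or.inr hv))
  · simpa [map_add] using h2

theorem colOp_mem_bounded {n d a b : ℕ} (ha : a < n) {f : Poly} (hf : f ∈ bounded n d) :
    colOp a b f ∈ bounded n d := fun m hm => by
  obtain ⟨m', j, rfl, hm'⟩ := exists_of_mem_support_colOp hm
  obtain ⟨h1, h2⟩ := hf hm'
  refine ⟨fun v hv => ?_, ?_⟩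
  · rcases mem_support_add_single hv with rfl | hv
    · exact ⟨(h1 _ (subset_support_add_single (Or.inl rfl))).1, ha⟩
    · exact h1 v (subset_support_add_single (Or.inr hv))
  · simpa [map_add] using h2

theorem lt_of_mem_bounded {n d : ℕ} {f : Poly} (hf : f ∈ bounded n d) {v : ℕ × ℕ}
    (hv : v ∈ f.vars) : v.1 < n ∧ v.2 < n := by
  obtain ⟨m, hm, hvm⟩ := (mem_vars_iff_mem_support v).1 hv
  exact (hf hm).1 v hvm

theorem rowOp_eq_zero {a b : ℕ} {f : Poly} (hf : ∀ v ∈ f.vars, v.1 ≠ b) : rowOp a b f = 0 :=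
  derivation_eq_zero_of_forall_mem_vars fun v hv => by rw [rowOp_X, if_neg (hf v hv)]

theorem colOp_eq_zero {a b : ℕ} {f : Poly} (hf : ∀ v ∈ f.vars, v.2 ≠ b) : colOp a b f = 0 :=
  derivation_eq_zero_of_forall_mem_vars fun v hv => by rw [colOp_X, if_neg (hf v hv)]

end MatrixPoly

/-! ### Modules modelled on polynomials with polarization operators -/

open MatrixPoly

/-- A module `S` over a sum `𝔤 = g₁ ⊕ g₂` of two Lie algebras of matrices that is identified with
polynomials in the entries of a matrix, in such a way that the matrix units of `g₁` act by column
polarizations, up to the sign, and the matrix units of `g₂` act by row polarizations. -/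
structure PolarizationModel (σ : Type*) {𝔤 : Type*} (S : Type*) [LieRing 𝔤] [LieAlgebra ℂ 𝔤]
    [AddCommGroup S] [Module ℂ S] [LieRingModule 𝔤 S] (g₁ g₂ : LieSubalgebra ℂ 𝔤) where
  /-- The position of an index. -/
  idx : σ → ℕ
  -- The positions form an initial segment of `ℕ`, so each raising operation out of an occurring row
  -- or column comes from a matrix unit.
  idx_lower : ∀ a m, m ≤ idx a → ∃ b, idx b = m
  /-- The identification with polynomials. -/
  toPoly : S →ₗ[ℂ] Poly
  injective : Function.Injective toPoly
  vars : ∀ s, ∀ v ∈ (toPoly s).vars, (∃ a, idx a = v.1) ∧ ∃ b, idx b = v.2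
  /-- The matrix units of `g₁`. -/
  e₁ : σ × σ → g₁
  /-- The matrix units of `g₂`. -/
  e₂ : σ × σ → g₂
  toPoly_e₁ : ∀ p s, toPoly ⁅e₁ p, s⁆ = -colOp (idx p.1) (idx p.2) (toPoly s)
  toPoly_e₂ : ∀ p s, toPoly ⁅e₂ p, s⁆ = rowOp (idx p.1) (idx p.2) (toPoly s)
  /-- The matrix entries of the component in `g₁`. -/
  c₁ : 𝔤 → σ × σ → ℂ
  /-- The matrix entries of the component in `g₂`. -/
  c₂ : 𝔤 → σ × σ → ℂ
  c₁_eq_zero : ∀ (x : g₂) p, c₁ x p = 0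
  c₂_eq_zero : ∀ (x : g₁) p, c₂ x p = 0
  -- Only finitely many entries of `x` affect a given `s`. Allowing every larger `F` makes it
  -- possible to add chosen positions to the sum.
  lie_eq_sum : ∀ (x : 𝔤) (s : S), ∃ F₀ : Finset (σ × σ), ∀ F, F₀ ⊆ F →
    ⁅x, s⁆ = ∑ p ∈ F, (c₁ x p • ⁅e₁ p, s⁆ + c₂ x p • ⁅e₂ p, s⁆)
  lie_eq_zero : ∀ (x : g₁) (y : g₂), ⁅(x : 𝔤), (y : 𝔤)⁆ = 0
  exists_add : ∀ x : 𝔤, ∃ (x₁ : g₁) (x₂ : g₂), x = x₁ + x₂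

namespace PolarizationModel

variable {σ 𝔤 S : Type*} [LieRing 𝔤] [LieAlgebra ℂ 𝔤] [AddCommGroup S] [Module ℂ S]
  [LieRingModule 𝔤 S] {g₁ g₂ : LieSubalgebra ℂ 𝔤}
  (P : PolarizationModel σ S g₁ g₂)

/-- The Fischer form. -/
def form : S →ₗ⋆[ℂ] S →ₗ[ℂ] ℂ := (fischer.comp P.toPoly).compl₂ P.toPoly

theorem form_apply (s t : S) : P.form s t = fischer (P.toPoly s) (P.toPoly t) := rfl

theorem isPosDefForm_form : IsPosDefForm P.form := isPosDefForm_fischer.comp _ P.injective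

/-- The matrix units of `g₁` and `g₂`. -/
def e : (σ × σ) ⊕ (σ × σ) → 𝔤 := Sum.elim (fun p => P.e₁ p) fun p => P.e₂ p

/-- Transposition of the matrix units of `g₁` and `g₂`. -/
def st : (σ × σ) ⊕ (σ × σ) → (σ × σ) ⊕ (σ × σ) := Sum.map Prod.swap Prod.swap

theorem st_involutive : Function.Involutive (st (σ := σ)) := by
  rintro (⟨a, b⟩ | ⟨a, b⟩) <;> rfl

theorem swap_involutive : Function.Involutive (Prod.swap : σ × σ → σ × σ) := Prod.swap_swap

/-- The indices of the raising operators. -/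
def pos : Set (σ × σ) := {p | P.idx p.1 < P.idx p.2}

/-- The indices of the raising operators of `g₁` and `g₂`. -/
def pos' : Set ((σ × σ) ⊕ (σ × σ)) := {k | Sum.elim (· ∈ P.pos) (· ∈ P.pos) k}

theorem form_e₁ (p : σ × σ) (s t : S) : P.form ⁅P.e₁ p, s⁆ t = P.form s ⁅P.e₁ p.swap, t⁆ := by
  rw [form_apply, form_apply, toPoly_e₁, toPoly_e₁, map_neg, map_neg, LinearMap.neg_apply,
    fischer_colOp]
  rfl

theorem form_e₂ (p : σ × σ) (s t : S) : P.form ⁅P.e₂ p, s⁆ t = P.form s ⁅P.e₂ p.swap, t⁆ := by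
  rw [form_apply, form_apply, toPoly_e₂, toPoly_e₂, fischer_rowOp]
  rfl

theorem unitary₁ : IsUnitaryFamily P.form P.e₁ Prod.swap where
  mem_span x s := by
    obtain ⟨F, hF⟩ := P.lie_eq_sum x s
    have h : ⁅x, s⁆ = _ := hF F subset_rfl
    rw [h]
    refine Submodule.sum_mem _ fun p _ => ?_
    rw [P.c₂_eq_zero, zero_smul, add_zero]
    exact Submodule.smul_mem _ _ (Submodule.subset_span ⟨p, rfl⟩)
  adjoint := P.form_e₁

theorem unitary₂ : IsUnitaryFamily P.form P.e₂ Prod.swap where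
  mem_span x s := by
    obtain ⟨F, hF⟩ := P.lie_eq_sum x s
    have h : ⁅x, s⁆ = _ := hF F subset_rfl
    rw [h]
    refine Submodule.sum_mem _ fun p _ => ?_
    rw [P.c₁_eq_zero, zero_smul, zero_add]
    exact Submodule.smul_mem _ _ (Submodule.subset_span ⟨p, rfl⟩)
  adjoint := P.form_e₂

theorem unitary : IsUnitaryFamily P.form P.e st where
  mem_span x s := by
    obtain ⟨F, hF⟩ := P.lie_eq_sum x s
    rw [hF F subset_rfl]
    exact Submodule.sum_mem _ fun p _ => Submodule.add_mem _
      (Submodule.smul_mem _ _ (Submodule.subset_span ⟨Sum.inl p, rfl⟩))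
      (Submodule.smul_mem _ _ (Submodule.subset_span ⟨Sum.inr p, rfl⟩))
  adjoint := by
    rintro (p | p)
    · exact P.form_e₁ p
    · exact P.form_e₂ p

theorem size_lie_e₁_lt {p : σ × σ} (hp : p ∈ P.pos) {s : S} (h : ⁅P.e₁ p, s⁆ ≠ 0) :
    size (P.toPoly ⁅P.e₁ p, s⁆) < size (P.toPoly s) := by
  have h1 : P.toPoly ⁅P.e₁ p, s⁆ ≠ 0 := fun h' => h (P.injective (by rw [h', map_zero]))
  rw [toPoly_e₁] at h1 ⊢
  have h2 := size_colOp_lt hp (neg_ne_zero.1 h1)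
  rwa [size, MvPolynomial.support_neg]

theorem size_lie_e₂_lt {p : σ × σ} (hp : p ∈ P.pos) {s : S} (h : ⁅P.e₂ p, s⁆ ≠ 0) :
    size (P.toPoly ⁅P.e₂ p, s⁆) < size (P.toPoly s) := by
  have h1 : P.toPoly ⁅P.e₂ p, s⁆ ≠ 0 := fun h' => h (P.injective (by rw [h', map_zero]))
  rw [toPoly_e₂] at h1 ⊢
  exact size_rowOp_lt hp h1

/-- A non-zero element of `N` of minimal size is killed by raising operators, which would otherwise
produce a smaller one. -/
theorem exists_raised₁ (N : LieSubmodule ℂ g₁ S) (hN : N ≠ ⊥) :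
    ∃ u ∈ N, u ≠ 0 ∧ ∀ p ∈ P.pos, ⁅P.e₁ p, u⁆ = 0 := by
  obtain ⟨u, hu, hu0, hmin⟩ := exists_minimal_size P.toPoly (Z := N.toSubmodule)
    fun h => hN ((LieSubmodule.toSubmodule_eq_bot N).1 h)
  refine ⟨u, hu, hu0, fun p hp => ?_⟩
  by_contra h
  exact h (hmin _ (N.lie_mem hu) (P.size_lie_e₁_lt hp h))

theorem exists_raised₂ (N : LieSubmodule ℂ g₂ S) (hN : N ≠ ⊥) :
    ∃ u ∈ N, u ≠ 0 ∧ ∀ p ∈ P.pos, ⁅P.e₂ p, u⁆ = 0 := by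
  obtain ⟨u, hu, hu0, hmin⟩ := exists_minimal_size P.toPoly (Z := N.toSubmodule)
    fun h => hN ((LieSubmodule.toSubmodule_eq_bot N).1 h)
  refine ⟨u, hu, hu0, fun p hp => ?_⟩
  by_contra h
  exact h (hmin _ (N.lie_mem hu) (P.size_lie_e₂_lt hp h))

theorem exists_raised (N : LieSubmodule ℂ 𝔤 S) (hN : N ≠ ⊥) :
    ∃ u ∈ N, u ≠ 0 ∧ ∀ k ∈ P.pos', ⁅P.e k, u⁆ = 0 := by
  obtain ⟨u, hu, hu0, hmin⟩ := exists_minimal_size P.toPoly (Z := N.toSubmodule)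
    fun h => hN ((LieSubmodule.toSubmodule_eq_bot N).1 h)
  refine ⟨u, hu, hu0, ?_⟩
  rintro (p | p) hp <;> by_contra h
  · exact h (hmin _ (N.lie_mem hu) (P.size_lie_e₁_lt hp h))
  · exact h (hmin _ (N.lie_mem hu) (P.size_lie_e₂_lt hp h))

variable {w : S} {μ : ℕ → ℕ}

theorem lie_e₁_eq_zero (hw : IsHighest (P.toPoly w) μ) {p : σ × σ} (hp : P.idx p.1 < P.idx p.2) :
    ⁅P.e₁ p, w⁆ = 0 :=
  P.injective (by rw [toPoly_e₁, hw.raised.col _ _ hp, neg_zero, map_zero])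

theorem lie_e₂_eq_zero (hw : IsHighest (P.toPoly w) μ) {p : σ × σ} (hp : P.idx p.1 < P.idx p.2) :
    ⁅P.e₂ p, w⁆ = 0 :=
  P.injective (by rw [toPoly_e₂, hw.raised.row _ _ hp, map_zero])

theorem lie_e₁_self (hw : IsHighest (P.toPoly w) μ) {p : σ × σ} (hp : P.idx p.1 = P.idx p.2) :
    ⁅P.e₁ p, w⁆ = (-μ (P.idx p.1) : ℂ) • w :=
  P.injective (by rw [toPoly_e₁, ← hp, hw.col, map_smul, neg_smul])

theorem lie_e₂_self (hw : IsHighest (P.toPoly w) μ) {p : σ × σ} (hp : P.idx p.1 = P.idx p.2) :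
    ⁅P.e₂ p, w⁆ = (μ (P.idx p.1) : ℂ) • w :=
  P.injective (by rw [toPoly_e₂, ← hp, hw.row, map_smul])

theorem isSingular₁ (hw : IsHighest (P.toPoly w) μ) : IsSingular P.e₁ Prod.swap P.pos w where
  raising _ hp := P.lie_e₁_eq_zero hw hp
  cases p := by
    rcases lt_trichotomy (P.idx p.1) (P.idx p.2) with h | h | h
    · exact Or.inl h
    · exact Or.inr (Or.inr ⟨_, P.lie_e₁_self hw h⟩)
    · exact Or.inr (Or.inl h)

theorem isSingular₂ (hw : IsHighest (P.toPoly w) μ) : IsSingular P.e₂ Prod.swap P.pos w where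
  raising _ hp := P.lie_e₂_eq_zero hw hp
  cases p := by
    rcases lt_trichotomy (P.idx p.1) (P.idx p.2) with h | h | h
    · exact Or.inl h
    · exact Or.inr (Or.inr ⟨_, P.lie_e₂_self hw h⟩)
    · exact Or.inr (Or.inl h)

theorem isSingular (hw : IsHighest (P.toPoly w) μ) : IsSingular P.e st P.pos' w where
  raising := by
    rintro (p | p) hp
    · exact P.lie_e₁_eq_zero hw hp
    · exact P.lie_e₂_eq_zero hw hp
  cases := by
    rintro (p | p)
    · exact (P.isSingular₁ hw).cases p
    · exact (P.isSingular₂ hw).cases p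

theorem lie_eq_zero_of_strictUpper (hw : IsHighest (P.toPoly w) μ) {x : 𝔤}
    (hx : ∀ p, P.idx p.2 ≤ P.idx p.1 → P.c₁ x p = 0 ∧ P.c₂ x p = 0) : ⁅x, w⁆ = 0 := by
  obtain ⟨F, hF⟩ := P.lie_eq_sum x w
  rw [hF F subset_rfl]
  refine Finset.sum_eq_zero fun p _ => ?_
  rcases lt_or_ge (P.idx p.1) (P.idx p.2) with h | h
  · rw [P.lie_e₁_eq_zero hw h, P.lie_e₂_eq_zero hw h, smul_zero, smul_zero, add_zero]
  · rw [(hx p h).1, (hx p h).2, zero_smul, zero_smul, add_zero]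

theorem lie_eq_smul_of_diag (hw : IsHighest (P.toPoly w) μ) {x : 𝔤}
    (hx : ∀ p : σ × σ, p.1 ≠ p.2 → P.c₁ x p = 0 ∧ P.c₂ x p = 0) {G : Finset σ}
    (hG : ∀ a, a ∉ G → μ (P.idx a) = 0) :
    ⁅x, w⁆ = (∑ a ∈ G, (μ (P.idx a) : ℂ) * (P.c₂ x (a, a) - P.c₁ x (a, a))) • w := by
  classical
  obtain ⟨F₀, hF⟩ := P.lie_eq_sum x w
  have hinj : Function.Injective fun a : σ => (a, a) := fun a b h => congrArg Prod.fst h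
  -- The sum is enlarged to contain the diagonal positions from `G`; all other terms vanish, off the
  -- diagonal by `hx` and on it by `hG`.
  rw [hF (F₀ ∪ G.map ⟨fun a => (a, a), hinj⟩) Finset.subset_union_left,
    ← Finset.sum_subset Finset.subset_union_right, Finset.sum_map, Finset.sum_smul]
  · refine Finset.sum_congr rfl fun a _ => ?_
    change P.c₁ x (a, a) • ⁅P.e₁ (a, a), w⁆ + P.c₂ x (a, a) • ⁅P.e₂ (a, a), w⁆ = _
    rw [P.lie_e₁_self hw rfl, P.lie_e₂_self hw rfl, smul_smul, smul_smul, ← add_smul]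
    congr 1
    ring
  · rintro ⟨a, b⟩ - hab
    by_cases h : a = b
    · subst h
      have ha : a ∉ G := fun h => hab (Finset.mem_map.2 ⟨a, h, rfl⟩)
      rw [P.lie_e₁_self hw rfl, P.lie_e₂_self hw rfl, hG a ha]
      simp
    · rw [(hx (a, b) h).1, (hx (a, b) h).2, zero_smul, zero_smul, add_zero]

variable [LieModule ℂ 𝔤 S]

theorem isIrreducible₁ (hw : IsHighest (P.toPoly w) μ) (hw0 : w ≠ 0) :
    LieModule.IsIrreducible ℂ g₁ (LieSubmodule.lieSpan ℂ g₁ {w}) :=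
  P.unitary₁.isIrreducible_lieSpan P.isPosDefForm_form swap_involutive hw0 (P.isSingular₁ hw)
    P.exists_raised₁

theorem isIrreducible₂ (hw : IsHighest (P.toPoly w) μ) (hw0 : w ≠ 0) :
    LieModule.IsIrreducible ℂ g₂ (LieSubmodule.lieSpan ℂ g₂ {w}) :=
  P.unitary₂.isIrreducible_lieSpan P.isPosDefForm_form swap_involutive hw0 (P.isSingular₂ hw)
    P.exists_raised₂

theorem isIrreducible (hw : IsHighest (P.toPoly w) μ) (hw0 : w ≠ 0) :
    LieModule.IsIrreducible ℂ 𝔤 (LieSubmodule.lieSpan ℂ 𝔤 {w}) :=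
  P.unitary.isIrreducible_lieSpan P.isPosDefForm_form st_involutive hw0 (P.isSingular hw)
    P.exists_raised

theorem isExternalTensor (hw : IsHighest (P.toPoly w) μ) :
    IsExternalTensor g₁ g₂ (LieSubmodule.lieSpan ℂ g₁ {w}) (LieSubmodule.lieSpan ℂ g₂ {w})
      (LieSubmodule.lieSpan ℂ 𝔤 {w}) := by
  refine isExternalTensor_lieSpan P.isPosDefForm_form P.unitary₁ P.unitary₂ swap_involutive
    (P.isSingular₁ hw) (fun x y v => ?_) P.exists_add
  change ⁅(x : 𝔤), ⁅(y : 𝔤), v⁆⁆ = ⁅(y : 𝔤), ⁅(x : 𝔤), v⁆⁆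
  rw [leibniz_lie, P.lie_eq_zero, zero_lie, zero_add]

omit [LieModule ℂ 𝔤 S] in
theorem lie_e_mem_bounded {n d : ℕ} (k : (σ × σ) ⊕ (σ × σ))
    (hk : Sum.elim (fun p => P.idx p.1 < n) (fun p => P.idx p.1 < n) k) {s : S}
    (hs : P.toPoly s ∈ bounded n d) : P.toPoly ⁅P.e k, s⁆ ∈ bounded n d := by
  rcases k with p | p
  · have h : P.toPoly ⁅P.e (Sum.inl p), s⁆ = _ := P.toPoly_e₁ p s
    rw [h]
    exact neg_mem (colOp_mem_bounded hk hs)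
  · have h : P.toPoly ⁅P.e (Sum.inr p), s⁆ = _ := P.toPoly_e₂ p s
    rw [h]
    exact rowOp_mem_bounded hk hs

/-- The elements of `S` of degree at most `d` in the first `n` rows and columns. -/
def boundedPart (n d : ℕ) : Submodule ℂ S := (bounded n d).comap P.toPoly

instance (n d : ℕ) : FiniteDimensional ℂ (P.boundedPart n d) :=
  Module.Finite.of_injective (P.toPoly.restrict fun _ h => h : P.boundedPart n d →ₗ[ℂ] bounded n d)
    fun _ _ h => Subtype.ext (P.injective (congrArg Subtype.val h))

omit [LieModule ℂ 𝔤 S] in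
theorem exists_mem_boundedPart (s : S) : ∃ n d, s ∈ P.boundedPart n d :=
  exists_mem_bounded (P.toPoly s)

omit [LieModule ℂ 𝔤 S] in
theorem exists_mem_boundedPart_of_forall_lt {n : ℕ} (hn : ∀ a, P.idx a < n) (s : S) :
    ∃ d, s ∈ P.boundedPart n d := by
  obtain ⟨m, d, h⟩ := P.exists_mem_boundedPart s
  refine ⟨d, fun e he => ⟨fun v hv => ?_, (h he).2⟩⟩
  obtain ⟨⟨a, ha⟩, b, hb⟩ :=
    P.vars s v ((MvPolynomial.mem_vars_iff_mem_support v).2 ⟨e, he, hv⟩)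
  rw [← ha, ← hb]
  exact ⟨hn a, hn b⟩

-- If all positions are below `n`, every matrix unit preserves the finite-dimensional bounded part
-- that contains `w`.
omit [LieModule ℂ 𝔤 S] in
theorem finiteDimensional₁ {n : ℕ} (hn : ∀ a, P.idx a < n) (w : S) :
    FiniteDimensional ℂ (LieSubmodule.lieSpan ℂ g₁ {w}) := by
  obtain ⟨d, hd⟩ := P.exists_mem_boundedPart_of_forall_lt hn w
  exact Submodule.finiteDimensional_of_le (P.unitary₁.lieSpan_le hd fun p v hv =>
    P.lie_e_mem_bounded (Sum.inl p) (hn _) hv)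

omit [LieModule ℂ 𝔤 S] in
theorem finiteDimensional₂ {n : ℕ} (hn : ∀ a, P.idx a < n) (w : S) :
    FiniteDimensional ℂ (LieSubmodule.lieSpan ℂ g₂ {w}) := by
  obtain ⟨d, hd⟩ := P.exists_mem_boundedPart_of_forall_lt hn w
  exact Submodule.finiteDimensional_of_le (P.unitary₂.lieSpan_le hd fun p v hv =>
    P.lie_e_mem_bounded (Sum.inr p) (hn _) hv)

variable {Λ : Type*} {v : Λ → S} {wt : Λ → ℕ → ℕ}

-- The vectors are eigenvectors of some self-adjoint `rowOp a a` with different real eigenvalues.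
omit [LieModule ℂ 𝔤 S] in
theorem form_eq_zero_of_ne (hv : ∀ l, IsHighest (P.toPoly (v l)) (wt l)) {l l' : Λ}
    (h : wt l ≠ wt l') : P.form (v l) (v l') = 0 := by
  obtain ⟨a, ha⟩ := Function.ne_iff.1 h
  have h1 := fischer_rowOp a a (P.toPoly (v l)) (P.toPoly (v l'))
  rw [(hv l).row, (hv l').row, map_smulₛₗ, map_smul, LinearMap.smul_apply, map_natCast,
    smul_eq_mul, smul_eq_mul] at h1
  by_contra h0
  exact ha (by exact_mod_cast mul_right_cancel₀ h0 h1)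

/-- The raised vector `v l'` is orthogonal to `v l`, hence to its module. The orthogonal complement
of that module is stable, so it contains the module of `v l'`. -/
theorem form_eq_zero_of_mem (hv : ∀ l, IsHighest (P.toPoly (v l)) (wt l)) {l l' : Λ}
    (h : wt l ≠ wt l') {s t : S} (hs : s ∈ LieSubmodule.lieSpan ℂ 𝔤 {v l})
    (ht : t ∈ LieSubmodule.lieSpan ℂ 𝔤 {v l'}) : P.form s t = 0 := by
  have h1 : ∀ z ∈ LieSubmodule.lieSpan ℂ 𝔤 {v l}, P.form (v l') z = 0 := fun z hz =>
    P.unitary.orthogonal_lieSpan st_involutive (P.isSingular (hv l)) (P.isSingular (hv l')).raising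
      (P.form_eq_zero_of_ne hv h.symm) hz
  have h2 := P.unitary.lieSpan_le (w := v l')
    (p := IsPosDefForm.orthogonal P.form (LieSubmodule.lieSpan ℂ 𝔤 {v l} : Set S))
    (fun z hz => P.isPosDefForm_form.eq_zero_comm.1 (h1 z hz))
    fun k u hu => P.unitary.lie_mem_orthogonal st_involutive
      (fun k z hz => (LieSubmodule.lieSpan ℂ 𝔤 {v l}).lie_mem hz) k hu
  exact h2 ht s hs

theorem iSupIndep_lieSpan (hv : ∀ l, IsHighest (P.toPoly (v l)) (wt l))
    (hwt : Function.Injective wt) :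
    iSupIndep fun l => (LieSubmodule.lieSpan ℂ 𝔤 {v l}).toSubmodule := by
  intro l
  rw [Submodule.disjoint_def]
  intro s hs hs'
  have h : (⨆ l', ⨆ (_ : l' ≠ l), (LieSubmodule.lieSpan ℂ 𝔤 {v l'}).toSubmodule) ≤
      IsPosDefForm.orthogonal P.form (LieSubmodule.lieSpan ℂ 𝔤 {v l} : Set S) :=
    iSup₂_le fun l' hl' t ht z hz => P.form_eq_zero_of_mem hv (hwt.ne hl'.symm) hz ht
  exact P.isPosDefForm_form.definite s (h hs' s hs)

omit [LieModule ℂ 𝔤 S] in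
/-- The modules generated by highest weight vectors of all dominant weights exhaust `S`. -/
theorem iSup_lieSpan_eq_top (hv : ∀ l, IsHighest (P.toPoly (v l)) (wt l)) (hv0 : ∀ l, v l ≠ 0)
    (hwt : ∀ μ : ℕ → ℕ, Antitone μ → (∃ n, ∀ a, n ≤ a → μ a = 0) →
      (∀ a, (∀ i, P.idx i ≠ a) → μ a = 0) → ∃ l, wt l = μ) :
    (⨆ l, (LieSubmodule.lieSpan ℂ 𝔤 {v l}).toSubmodule) = ⊤ := by
  refine top_le_iff.1 fun s _ => ?_
  set T : Submodule ℂ S := ⨆ l, (LieSubmodule.lieSpan ℂ 𝔤 {v l}).toSubmodule with hT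
  have hTlie : ∀ (k : (σ × σ) ⊕ (σ × σ)), ∀ t ∈ T, ⁅P.e k, t⁆ ∈ T := by
    intro k t ht
    have hT' : T = (⨆ l, LieSubmodule.lieSpan ℂ 𝔤 {v l}).toSubmodule := by
      rw [hT, LieSubmodule.iSup_toSubmodule]
    rw [hT'] at ht ⊢
    exact LieSubmodule.lie_mem _ ht
  obtain ⟨n, d, hs⟩ := P.exists_mem_boundedPart s
  set E : Submodule ℂ S := P.boundedPart n d with hE
  have : FiniteDimensional ℂ (T ⊓ E : Submodule ℂ S) :=
    Submodule.finiteDimensional_of_le (inf_le_right : T ⊓ E ≤ E)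
  obtain ⟨t, ht, hst⟩ := P.isPosDefForm_form.exists_orthogonal_projection (T ⊓ E) s
  set Z : Submodule ℂ S := E ⊓ IsPosDefForm.orthogonal P.form (T ⊓ E : Submodule ℂ S) with hZ
  -- Both indices must be below `n`: one for the operator to preserve `E`, the other for its adjoint
  -- to do so.
  have hZlie : ∀ k : (σ × σ) ⊕ (σ × σ),
      Sum.elim (fun p => P.idx p.1 < n) (fun p => P.idx p.1 < n) k →
      Sum.elim (fun p => P.idx p.2 < n) (fun p => P.idx p.2 < n) k →
      ∀ u ∈ Z, ⁅P.e k, u⁆ ∈ Z := by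
    intro k hk hk' u hu
    refine ⟨P.lie_e_mem_bounded k hk hu.1, fun z hz => ?_⟩
    have h := P.unitary.adjoint (st k) z u
    rw [st_involutive k] at h
    rw [← h]
    refine hu.2 _ ⟨hTlie _ _ hz.1, P.lie_e_mem_bounded _ ?_ hz.2⟩
    rcases k with p | p
    · exact hk'
    · exact hk'
  suffices hbot : Z = ⊥ by
    have hmem : s - t ∈ Z := ⟨E.sub_mem hs ht.2, hst⟩
    rw [hbot, Submodule.mem_bot] at hmem
    rw [sub_eq_zero.1 hmem]
    exact ht.1
  by_contra hne
  obtain ⟨u, hu, hu0, hmin⟩ := exists_minimal_size P.toPoly hne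
  have hf0 : P.toPoly u ≠ 0 := fun h => hu0 (P.injective (by rw [h, map_zero]))
  have hbd : ∀ z ∈ (P.toPoly u).vars, z.1 < n ∧ z.2 < n := fun z hz => lt_of_mem_bounded hu.1 hz
  -- If row or column `b` does not occur in `u`, the operation is trivially zero. Otherwise `a < b <
  -- n` are both positions, the matrix unit preserves `Z`, and minimality applies.
  have hraised : IsRaised (P.toPoly u) := by
    constructor
    · intro a b hab
      by_cases hb : ∀ z ∈ (P.toPoly u).vars, z.1 ≠ b
      · exact rowOp_eq_zero hb
      push Not at hb
      obtain ⟨z, hz, rfl⟩ := hb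
      obtain ⟨⟨i, hi⟩, -⟩ := P.vars u z hz
      obtain ⟨j, hj⟩ := P.idx_lower i a (by omega)
      have hlt := (hbd z hz).1
      have hp : (j, i) ∈ P.pos := by
        change P.idx j < P.idx i
        omega
      have h0 : ⁅P.e₂ (j, i), u⁆ = 0 := by
        by_contra h
        exact h (hmin _ (hZlie (Sum.inr (j, i)) (by simp; omega) (by simp; omega) u hu)
          (P.size_lie_e₂_lt hp h))
      have h1 := P.toPoly_e₂ (j, i) u
      rw [h0, map_zero] at h1
      simp only [hi, hj] at h1
      exact h1.symm
    · intro a b hab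
      by_cases hb : ∀ z ∈ (P.toPoly u).vars, z.2 ≠ b
      · exact colOp_eq_zero hb
      push Not at hb
      obtain ⟨z, hz, rfl⟩ := hb
      obtain ⟨-, ⟨i, hi⟩⟩ := P.vars u z hz
      obtain ⟨j, hj⟩ := P.idx_lower i a (by omega)
      have hlt := (hbd z hz).2
      have hp : (j, i) ∈ P.pos := by
        change P.idx j < P.idx i
        omega
      have h0 : ⁅P.e₁ (j, i), u⁆ = 0 := by
        by_contra h
        exact h (hmin _ (hZlie (Sum.inl (j, i)) (by simp; omega) (by simp; omega) u hu)
          (P.size_lie_e₁_lt hp h))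
      have h1 := P.toPoly_e₁ (j, i) u
      rw [h0, map_zero] at h1
      simp only [hi, hj] at h1
      exact neg_eq_zero.1 h1.symm
  -- Minimality again, now for `rowOp a a - c`. When `a` is not a position below `n` the operation
  -- is zero, and a non-zero multiple of `u` is no smaller than `u`.
  obtain ⟨μ, hμ⟩ : ∃ μ, HasRowWeight (P.toPoly u) μ := by
    refine exists_hasRowWeight hf0 fun a c hlt => ?_
    by_cases ha : (∃ i, P.idx i = a) ∧ a < n
    · obtain ⟨⟨i, rfl⟩, ha⟩ := ha
      have h1 : P.toPoly (⁅P.e₂ (i, i), u⁆ - c • u) =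
          rowOp (P.idx i) (P.idx i) (P.toPoly u) - c • P.toPoly u := by
        rw [map_sub, map_smul, P.toPoly_e₂]
      rw [← h1] at hlt ⊢
      exact (congrArg P.toPoly (hmin _ (Z.sub_mem (hZlie (Sum.inr (i, i)) (by simpa using ha)
        (by simpa using ha) u hu) (Z.smul_mem c hu)) hlt)).trans (map_zero _)
    · have h0 : rowOp a a (P.toPoly u) = 0 := rowOp_eq_zero fun z hz h => ha (by
        subst h
        exact ⟨(P.vars u z hz).1, (hbd z hz).1⟩)
      rw [h0, zero_sub] at hlt ⊢
      by_cases hc : c = 0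
      · rw [hc, zero_smul, neg_zero]
      · exfalso
        have : (-(c • P.toPoly u)).support = (P.toPoly u).support := by
          rw [MvPolynomial.support_neg, MvPolynomial.support_smul_eq hc]
        rw [size, this] at hlt
        exact lt_irrefl _ hlt
  have hμ0 : ∀ a, rowOp a a (P.toPoly u) = 0 → μ a = 0 := fun a h => by
    rw [hμ a] at h
    exact_mod_cast (smul_eq_zero.1 h).resolve_right hf0
  obtain ⟨l, rfl⟩ := hwt μ (hraised.antitone hμ hf0)
    ⟨n, fun a ha => hμ0 a (rowOp_eq_zero fun z hz h => absurd (hbd z hz).1 (by omega))⟩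
    fun a ha => hμ0 a (rowOp_eq_zero fun z hz h => by
      obtain ⟨⟨i, hi⟩, -⟩ := P.vars u z hz
      exact ha i (hi.trans h))
  have hvl : P.toPoly (v l) ≠ 0 := fun h => hv0 l (P.injective (by rw [h, map_zero]))
  obtain ⟨c, hc⟩ := hraised.eq_smul (hv l).raised hμ (hv l).row hvl
  have huc : u = c • v l := P.injective (by rw [hc, map_smul])
  have huT : u ∈ T := by
    rw [huc]
    exact T.smul_mem c (le_iSup (fun l => (LieSubmodule.lieSpan ℂ 𝔤 {v l}).toSubmodule) l
      (LieSubmodule.subset_lieSpan rfl))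
  -- Now `u` lies in `T ⊓ E` and is orthogonal to it, hence to itself.
  exact hu0 (P.isPosDefForm_form.definite u (hu.2 u ⟨huT, hu.1⟩))

end PolarizationModel

/-! ### Transfer of the action from generators to the symmetric algebra -/

namespace SymAction

variable {M L : Type*} [AddCommGroup M] [Module ℂ M] [LieRing L] [LieAlgebra ℂ L]
  [LieRingModule L M] [LieModule ℂ L M]

theorem map_act {A : Type*} [CommRing A] [Algebra ℂ A] (φ : SymmetricAlgebra ℂ M →ₐ[ℂ] A)
    (D : Derivation ℂ A A) (x : L)
    (h : ∀ m : M, φ (SymmetricAlgebra.ι ℂ M ⁅x, m⁆) = D (φ (SymmetricAlgebra.ι ℂ M m)))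
    (s : SymmetricAlgebra ℂ M) : φ (act ℂ M x s) = D (φ s) := by
  induction s using SymmetricAlgebra.induction with
  | algebraMap r => simp
  | ι m => rw [act_ι, h]
  | mul a b ha hb => simp [ha, hb]
  | add a b ha hb => simp [ha, hb]

/-- If an element of a Lie algebra acts on the vectors of a basis as a locally finite sum, then it
acts so on the symmetric algebra. -/
theorem act_eq_sum {κ ι : Type*} (b : Module.Basis ι ℂ M) (x : L) (y : κ → L)
    (h : ∀ i, ∃ F₀ : Finset κ, ∀ F, F₀ ⊆ F → ⁅x, b i⁆ = ∑ p ∈ F, ⁅y p, b i⁆)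
    (s : SymmetricAlgebra ℂ M) :
    ∃ F₀ : Finset κ, ∀ F, F₀ ⊆ F → act ℂ M x s = ∑ p ∈ F, act ℂ M (y p) s := by
  classical
  induction s using SymmetricAlgebra.induction with
  | algebraMap r => exact ⟨∅, fun F _ => by simp⟩
  | ι m =>
    suffices hm : ∃ F₀ : Finset κ, ∀ F, F₀ ⊆ F → ⁅x, m⁆ = ∑ p ∈ F, ⁅y p, m⁆ by
      obtain ⟨F₀, hF⟩ := hm
      refine ⟨F₀, fun F hle => ?_⟩
      simp_rw [act_ι]
      rw [hF F hle, map_sum]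
    have hmem : m ∈ Submodule.span ℂ (Set.range b) := b.mem_span m
    induction hmem using Submodule.span_induction with
    | mem m hm =>
      obtain ⟨i, rfl⟩ := hm
      exact h i
    | zero => exact ⟨∅, fun F _ => by simp⟩
    | add m m' _ _ ih ih' =>
      obtain ⟨F₁, h1⟩ := ih
      obtain ⟨F₂, h2⟩ := ih'
      refine ⟨F₁ ∪ F₂, fun F hle => ?_⟩
      simp_rw [lie_add]
      rw [h1 F (Finset.union_subset_left hle), h2 F (Finset.union_subset_right hle),
        Finset.sum_add_distrib]
    | smul c m _ ih =>
      obtain ⟨F₁, h1⟩ := ih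
      refine ⟨F₁, fun F hle => ?_⟩
      simp_rw [lie_smul]
      rw [h1 F hle, Finset.smul_sum]
  | mul a b ha hb =>
    obtain ⟨F₁, h1⟩ := ha
    obtain ⟨F₂, h2⟩ := hb
    refine ⟨F₁ ∪ F₂, fun F hle => ?_⟩
    simp_rw [Derivation.leibniz]
    rw [h1 F (Finset.union_subset_left hle), h2 F (Finset.union_subset_right hle),
      Finset.sum_add_distrib, Finset.smul_sum, Finset.smul_sum]
  | add a b ha hb =>
    obtain ⟨F₁, h1⟩ := ha
    obtain ⟨F₂, h2⟩ := hb
    refine ⟨F₁ ∪ F₂, fun F hle => ?_⟩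
    simp_rw [map_add]
    rw [h1 F (Finset.union_subset_left hle), h2 F (Finset.union_subset_right hle),
      Finset.sum_add_distrib]

end SymAction

/-! ### Young diagrams and dominant weights -/

namespace YoungDiagram

theorem ext_rowLen {D D' : YoungDiagram} (h : ∀ a, D.rowLen a = D'.rowLen a) : D = D' := by
  refine YoungDiagram.ext (Finset.ext fun ⟨i, j⟩ => ?_)
  rw [mem_cells, mem_cells, mem_iff_lt_rowLen, mem_iff_lt_rowLen, h]

theorem exists_rowLen_eq {f : ℕ → ℕ} (hf : Antitone f) {n : ℕ} (hn : ∀ a, n ≤ a → f a = 0) :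
    ∃ D : YoungDiagram, ∀ a, D.rowLen a = f a := by
  let D : YoungDiagram :=
    -- The box only makes the set finite: rows from `n` on are empty, and `f 0` bounds all values of
    -- `f`.
    { cells := (Finset.range n ×ˢ Finset.range (f 0)).filter fun c => c.2 < f c.1
      isLowerSet := by
        rintro ⟨i, j⟩ ⟨i', j'⟩ hle hc
        simp only [Finset.coe_filter, Finset.mem_product, Finset.mem_range] at hc ⊢
        obtain ⟨h1, h2⟩ : i' ≤ i ∧ j' ≤ j := hle
        obtain ⟨⟨h3, h4⟩, h5⟩ := hc
        exact ⟨⟨by omega, by omega⟩, lt_of_le_of_lt h2 (h5.trans_le (hf h1))⟩ }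
  have hD : ∀ i j, (i, j) ∈ D ↔ j < f i := by
    intro i j
    rw [← mem_cells]
    simp only [D, Finset.mem_filter, Finset.mem_product, Finset.mem_range]
    refine ⟨fun h => h.2, fun h => ⟨⟨?_, h.trans_le (hf (Nat.zero_le i))⟩, h⟩⟩
    by_contra hi
    rw [hn i (not_lt.1 hi)] at h
    exact absurd h (Nat.not_lt_zero j)
  refine ⟨D, fun a => ?_⟩
  refine eq_of_forall_lt_iff fun j => ?_
  rw [← mem_iff_lt_rowLen, hD]

theorem colLen_zero_le_iff {D : YoungDiagram} {n : ℕ} :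
    D.colLen 0 ≤ n ↔ ∀ a, n ≤ a → D.rowLen a = 0 := by
  refine ⟨fun h a ha => ?_, fun h => ?_⟩
  · by_contra h0
    have h1 : (a, 0) ∈ D := mem_iff_lt_rowLen.2 (Nat.pos_of_ne_zero h0)
    have h2 := mem_iff_lt_colLen.1 h1
    omega
  · by_contra hlt
    have h1 : (n, 0) ∈ D := mem_iff_lt_colLen.2 (not_le.1 hlt)
    have h2 := mem_iff_lt_rowLen.1 h1
    have h3 := h n le_rfl
    omega

end YoungDiagram

/-! ### The finite case in coordinates -/

namespace FinGL

open MvPolynomial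

/-- The row weight `a ↦ ∑ k ≥ a, l k` of the product of the powers `Det_k ^ l_k`. -/
def weight (n : ℕ) (l : Fin n → ℕ) (a : ℕ) : ℕ := ∑ k : Fin n, if a ≤ k then l k else 0

theorem weight_fin (n : ℕ) (l : Fin n → ℕ) (i : Fin n) :
    weight n l i = ∑ k ∈ Finset.Ici i, l k := by
  rw [weight, ← Finset.sum_filter]
  refine Finset.sum_congr (Finset.ext fun k => ?_) fun _ _ => rfl
  simp

theorem weight_of_le {n : ℕ} (l : Fin n → ℕ) {a : ℕ} (ha : n ≤ a) : weight n l a = 0 :=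
  Finset.sum_eq_zero fun k _ => if_neg (by omega)

/-- The exponents are the successive differences of the weight, which gives both injectivity and
surjectivity of `weight`. -/
theorem weight_eq_add (n : ℕ) (l : Fin n → ℕ) (i : Fin n) :
    weight n l i = l i + weight n l (i + 1) := by
  have h : l i = ∑ k : Fin n, if k = i then l k else 0 := by simp
  rw [weight, weight, h, ← Finset.sum_add_distrib]
  refine Finset.sum_congr rfl fun k _ => ?_
  by_cases h1 : k = i
  · subst h1; simp
  · have : (k : ℕ) ≠ i := fun h => h1 (Fin.ext h)
    by_cases h2 : (i : ℕ) ≤ k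
    · rw [if_pos h2, if_neg h1, if_pos (by omega), zero_add]
    · rw [if_neg h2, if_neg h1, if_neg (by omega)]

theorem weight_antitone (n : ℕ) (l : Fin n → ℕ) : Antitone (weight n l) := fun a b hab =>
  Finset.sum_le_sum fun k _ => by split_ifs <;> omega

theorem weight_injective (n : ℕ) : Function.Injective (weight n) := fun l l' h => by
  ext i
  have h1 := weight_eq_add n l i
  have h2 := weight_eq_add n l' i
  rw [h] at h1
  omega

theorem exists_weight_eq {n : ℕ} {μ : ℕ → ℕ} (hμ : Antitone μ) (hn : ∀ a, n ≤ a → μ a = 0) :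
    ∃ l, weight n l = μ := by
  -- The truncated subtraction loses nothing because `μ` is antitone. The equality is proved
  -- downwards from `n`, where both sides vanish.
  refine ⟨fun k => μ k - μ (k + 1), funext fun a => ?_⟩
  by_cases ha : n ≤ a
  · rw [weight_of_le _ ha, hn a ha]
  · refine Nat.decreasingInduction' (m := a) (n := n)
      (P := fun a => weight n (fun k => μ k - μ (k + 1)) a = μ a) (fun k hk _ ih => ?_)
      (not_le.1 ha).le (by rw [weight_of_le _ le_rfl, hn n le_rfl])
    have h := weight_eq_add n (fun k => μ k - μ (k + 1)) ⟨k, hk⟩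
    simp only at h
    rw [h, ih]
    have := hμ (Nat.le_succ k)
    exact Nat.sub_add_cancel this

/-- The families of exponents correspond to the Young diagrams with at most `n` rows. -/
theorem exists_equiv_youngDiagram (n : ℕ) :
    ∃ e : (Fin n → ℕ) ≃ {D : YoungDiagram // D.colLen 0 ≤ n},
      ∀ (l : Fin n → ℕ) (i : Fin n), (e l).1.rowLen i = ∑ k ∈ Finset.Ici i, l k := by
  choose D hD using fun l : Fin n → ℕ =>
    YoungDiagram.exists_rowLen_eq (weight_antitone n l) (n := n) fun a => weight_of_le l
  have hDn : ∀ l, (D l).colLen 0 ≤ n := fun l =>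
    YoungDiagram.colLen_zero_le_iff.2 fun a ha => by rw [hD, weight_of_le l ha]
  refine ⟨Equiv.ofBijective (fun l => ⟨D l, hDn l⟩) ⟨fun l l' h => ?_, ?_⟩, fun l i => ?_⟩
  · refine weight_injective n (funext fun a => ?_)
    have h' : D l = D l' := congrArg Subtype.val h
    rw [← hD, ← hD, h']
  · rintro ⟨E, hE⟩
    obtain ⟨l, hl⟩ := exists_weight_eq (fun a b h => E.rowLen_anti a b h)
      (YoungDiagram.colLen_zero_le_iff.1 hE)
    refine ⟨l, Subtype.ext (YoungDiagram.ext_rowLen fun a => ?_)⟩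
    change (D l).rowLen a = E.rowLen a
    rw [hD, hl]
  · change (D l).rowLen i = _
    rw [hD, weight_fin]

/-- The coordinates of a matrix of `𝔞₋`, with the columns in reverse order. -/
def coordA (n : ℕ) : aMinus n ≃ₗ[ℂ] (Fin n × Fin n → ℂ) where
  toFun X p := (X : gl n) (.inr p.1) (.inl p.2.rev)
  map_add' X Y := rfl
  map_smul' c X := rfl
  invFun f := ⟨Matrix.of (Sum.elim (fun _ _ => 0) fun i => Sum.elim (fun j => f (i, j.rev)) fun _ => 0),
    ⟨fun i j => rfl, by rintro (i | i) j <;> rfl⟩⟩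
  left_inv X := by
    obtain ⟨X, h1, h2⟩ := X
    refine Subtype.ext (Matrix.ext ?_)
    rintro (i | i) (j | j)
    · exact (h1 _ _).symm
    · exact (h1 _ _).symm
    · simp
    · exact (h2 _ _).symm
  right_inv f := by
    ext ⟨i, j⟩
    simp

/-- The basis of matrix units of `𝔞₋`, with the columns in reverse order. -/
def basisA (n : ℕ) : Module.Basis (Fin n × Fin n) ℂ (aMinus n) := .ofEquivFun (coordA n)

theorem basisA_apply (n : ℕ) (i j : Fin n) : basisA n (i, j) = unitA n i j.rev := by
  rw [basisA, Module.Basis.coe_ofEquivFun, LinearEquiv.symm_apply_eq]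
  ext ⟨a, b⟩
  change _ = (Matrix.single (.inr i) (.inl j.rev) 1 : gl n) (.inr a) (.inl b.rev)
  simp [Matrix.single_apply, Pi.single_apply, Prod.ext_iff, eq_comm]

/-- The identification of `S*(𝔞₋)` with polynomials. -/
def toPoly (n : ℕ) : symA n →ₐ[ℂ] Poly :=
  (rename (Prod.map Fin.val Fin.val)).comp
    (SymmetricAlgebra.equivMvPolynomial (basisA n)).toAlgHom

theorem toPoly_unitA (n : ℕ) (i j : Fin n) :
    toPoly n (SymmetricAlgebra.ι ℂ _ (unitA n i j)) = X ((i : ℕ), (j.rev : ℕ)) := by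
  have h : unitA n i j = basisA n (i, j.rev) := by rw [basisA_apply, Fin.rev_rev]
  rw [h]
  simp [toPoly]

theorem toPoly_injective (n : ℕ) : Function.Injective (toPoly n) := by
  refine Function.Injective.comp (g := rename (Prod.map Fin.val Fin.val)) ?_
    (SymmetricAlgebra.equivMvPolynomial (basisA n)).injective
  exact rename_injective _ (Fin.val_injective.prodMap Fin.val_injective)

/-- The matrix units of `gl_n⁽¹⁾`, with the indices in reverse order, transposed. -/
def unit₁ (n : ℕ) (p : Fin n × Fin n) : gl₁ n :=
  ⟨⟨Matrix.single (.inl p.2.rev) (.inl p.1.rev) 1, by constructor <;> simp⟩, by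
    intro i j
    simp⟩

/-- The matrix units of `gl_n⁽²⁾`. -/
def unit₂ (n : ℕ) (p : Fin n × Fin n) : gl₂ n :=
  ⟨⟨Matrix.single (.inr p.1) (.inr p.2) 1, by constructor <;> simp⟩, by
    intro i j
    simp⟩

/-- On `𝔞₋` the first block acts by right multiplication with a minus sign, which explains the
transposition in `unit₁`. With reversed indices, a strictly upper triangular unit moves a column to
an earlier position. -/
theorem unit₁_lie (n : ℕ) (p : Fin n × Fin n) (i j : Fin n) :
    ⁅(unit₁ n p : glDiag n), unitA n i j⁆ = -if j.rev = p.2 then unitA n i p.1.rev else 0 := by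
  refine Subtype.ext ?_
  change Matrix.single _ _ 1 * Matrix.single _ _ 1 - Matrix.single _ _ 1 * Matrix.single _ _ 1 = _
  rw [Matrix.single_mul_single_of_ne _ _ _ _ (by simp)]
  by_cases h : j.rev = p.2
  · have h' : p.2.rev = j := by rw [← h, Fin.rev_rev]
    rw [if_pos h, h', Matrix.single_mul_single_same]
    simp [unitA]
  · have h' : j ≠ p.2.rev := fun h' => h (by rw [h', Fin.rev_rev])
    rw [if_neg h, Matrix.single_mul_single_of_ne _ _ _ _ (by simpa using h')]
    simp

theorem unit₂_lie (n : ℕ) (p : Fin n × Fin n) (i j : Fin n) :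
    ⁅(unit₂ n p : glDiag n), unitA n i j⁆ = if i = p.2 then unitA n p.1 j else 0 := by
  refine Subtype.ext ?_
  change Matrix.single _ _ 1 * Matrix.single _ _ 1 - Matrix.single _ _ 1 * Matrix.single _ _ 1 = _
  rw [Matrix.single_mul_single_of_ne (h := show (Sum.inl j : Fin n ⊕ Fin n) ≠ Sum.inr p.1 by simp)]
  by_cases h : i = p.2
  · rw [if_pos h, h, Matrix.single_mul_single_same]
    simp [unitA]
  · rw [if_neg h, Matrix.single_mul_single_of_ne _ _ _ _ (by simpa using Ne.symm h)]
    simp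

theorem toPoly_lie {n : ℕ} (x : glDiag n) (D : Derivation ℂ Poly Poly)
    (h : ∀ i j, toPoly n (SymmetricAlgebra.ι ℂ _ ⁅x, unitA n i j⁆) = D (X ((i : ℕ), (j.rev : ℕ))))
    (s : symA n) : toPoly n ⁅x, s⁆ = D (toPoly n s) := by
  refine SymAction.map_act (toPoly n) D x (fun m => ?_) s
  have h' : (toPoly n).toLinearMap ∘ₗ SymmetricAlgebra.ι ℂ _ ∘ₗ LieModule.toEnd ℂ (glDiag n) _ x =
      D.toLinearMap ∘ₗ (toPoly n).toLinearMap ∘ₗ SymmetricAlgebra.ι ℂ _ := by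
    refine (basisA n).ext fun ⟨i, j⟩ => ?_
    rw [basisA_apply]
    refine (h i j.rev).trans ?_
    rw [← toPoly_unitA]
    rfl
  exact DFunLike.congr_fun h' m

theorem sum_units {n : ℕ} (x : glDiag n) :
    x = ∑ p : Fin n × Fin n, ((x : gl n) (.inl p.2.rev) (.inl p.1.rev) • (unit₁ n p : glDiag n) +
      (x : gl n) (.inr p.1) (.inr p.2) • (unit₂ n p : glDiag n)) := by
  refine Subtype.ext ?_
  have hcoe : ∀ f : Fin n × Fin n → glDiag n, ((∑ p, f p : glDiag n) : gl n) = ∑ p, (f p : gl n) :=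
    fun f => map_sum (glDiag n).incl _ _
  rw [hcoe]
  ext i j
  rw [Matrix.sum_apply]
  change _ = ∑ p : Fin n × Fin n, ((x : gl n) (.inl p.2.rev) (.inl p.1.rev) *
      Matrix.single (.inl p.2.rev) (.inl p.1.rev) (1 : ℂ) i j +
      (x : gl n) (.inr p.1) (.inr p.2) * Matrix.single (.inr p.1) (.inr p.2) (1 : ℂ) i j)
  rcases i with i | i <;> rcases j with j | j
  · rw [Finset.sum_eq_single (j.rev, i.rev)]
    · simp
    · rintro ⟨a, b⟩ - hne
      have : ¬(b.rev = i ∧ a.rev = j) := by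
        rintro ⟨rfl, rfl⟩
        simp at hne
      simp [this]
    · simp
  · simp [x.2.1]
  · simp [x.2.2]
  · rw [Finset.sum_eq_single (i, j)]
    · simp
    · rintro ⟨a, b⟩ - hne
      have : ¬(a = i ∧ b = j) := by
        rintro ⟨rfl, rfl⟩
        simp at hne
      simp [this]
    · simp

/-- `S*(𝔞₋)` as the space of polynomials in the entries of a matrix. -/
def model (n : ℕ) : PolarizationModel (Fin n) (symA n) (gl₁ n) (gl₂ n) where
  idx := Fin.val
  idx_lower a m h := ⟨⟨m, by omega⟩, rfl⟩
  toPoly := (toPoly n).toLinearMap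
  injective := toPoly_injective n
  vars s v hv := by
    obtain ⟨u, -, rfl⟩ := mem_vars_rename _ _ hv
    exact ⟨⟨u.1, rfl⟩, u.2, rfl⟩
  e₁ := unit₁ n
  e₂ := unit₂ n
  toPoly_e₁ p s := by
    refine toPoly_lie (unit₁ n p : glDiag n) (-colOp p.1 p.2) (fun i j => ?_) s
    rw [unit₁_lie, Derivation.neg_apply, colOp_X, map_neg, map_neg]
    by_cases h : j.rev = p.2
    · rw [if_pos h, if_pos (congrArg Fin.val h), toPoly_unitA, Fin.rev_rev]
    · rw [if_neg h, if_neg fun h' => h (Fin.ext h'), map_zero, map_zero]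
  toPoly_e₂ p s := by
    refine toPoly_lie (unit₂ n p : glDiag n) (rowOp p.1 p.2) (fun i j => ?_) s
    rw [unit₂_lie, rowOp_X]
    by_cases h : i = p.2
    · rw [if_pos h, if_pos (congrArg Fin.val h), toPoly_unitA]
    · rw [if_neg h, if_neg fun h' => h (Fin.ext h'), map_zero, map_zero]
  c₁ x p := (x : gl n) (.inl p.2.rev) (.inl p.1.rev)
  c₂ x p := (x : gl n) (.inr p.1) (.inr p.2)
  c₁_eq_zero x p := x.2 _ _
  c₂_eq_zero x p := x.2 _ _
  lie_eq_sum x s := ⟨Finset.univ, fun F hF => by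
    rw [Finset.univ_subset_iff.1 hF]
    conv_lhs => rw [sum_units x]
    rw [sum_lie]
    refine Finset.sum_congr rfl fun p _ => ?_
    rw [add_lie, smul_lie, smul_lie]
    rfl⟩
  lie_eq_zero x y := by
    have hx : ∀ i j, ((x : glDiag n) : gl n) (.inr i) (.inr j) = 0 := x.2
    have hy : ∀ i j, ((y : glDiag n) : gl n) (.inl i) (.inl j) = 0 := y.2
    have hx' := (x : glDiag n).2
    have hy' := (y : glDiag n).2
    refine Subtype.ext (Matrix.ext fun i j => ?_)
    change (((x : glDiag n) : gl n) * ((y : glDiag n) : gl n) -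
      ((y : glDiag n) : gl n) * ((x : glDiag n) : gl n)) i j = 0
    rcases i with i | i <;> rcases j with j | j <;>
      simp [Matrix.mul_apply, hx, hy, hx'.1, hx'.2, hy'.1, hy'.2]
  exists_add x := by
    refine ⟨∑ p : Fin n × Fin n, (x : gl n) (.inl p.2.rev) (.inl p.1.rev) • unit₁ n p,
      ∑ p : Fin n × Fin n, (x : gl n) (.inr p.1) (.inr p.2) • unit₂ n p, ?_⟩
    conv_lhs => rw [sum_units x, Finset.sum_add_distrib]
    exact congrArg₂ (· + ·)
      (map_sum (gl₁ n).incl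
        (fun p : Fin n × Fin n => (x : gl n) (.inl p.2.rev) (.inl p.1.rev) • unit₁ n p) _).symm
      (map_sum (gl₂ n).incl
        (fun p : Fin n × Fin n => (x : gl n) (.inr p.1) (.inr p.2) • unit₂ n p) _).symm

/-- Counted from the right, column `n - (k + 1) + q` has position `k - q`, so the upper right corner
becomes the leading minor with reversed columns. -/
theorem toPoly_det (n : ℕ) (k : Fin n) : toPoly n (det n k) = minor (k + 1) := by
  rw [det, AlgHom.map_det, minor]
  congr 1
  ext1 p q
  change toPoly n (SymmetricAlgebra.ι ℂ _ _) = X _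
  rw [toPoly_unitA]
  congr 2
  simp [Fin.val_rev]
  omega

theorem isHighest_monomial (n : ℕ) (l : Fin n → ℕ) :
    IsHighest ((model n).toPoly (monomial n l)) (weight n l) := by
  have h : (model n).toPoly (monomial n l) = ∏ k : Fin n, minor (k + 1) ^ l k := by
    change toPoly n (∏ k, det n k ^ l k) = _
    simp [map_prod, toPoly_det]
  rw [h]
  convert IsHighest.prod Finset.univ fun (k : Fin n) _ => (isHighest_minor (k + 1)).pow (l k) using 1
  ext a
  simp [weight]

theorem monomial_ne_zero (n : ℕ) (l : Fin n → ℕ) : monomial n l ≠ 0 := by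
  intro h
  have h' := congrArg (toPoly n) h
  rw [monomial, map_prod, map_zero, Finset.prod_eq_zero_iff] at h'
  obtain ⟨k, -, hk⟩ := h'
  rw [map_pow, toPoly_det] at hk
  exact pow_ne_zero _ (minor_ne_zero _) hk

theorem isHighestWeightVector_monomial (n : ℕ) (l : Fin n → ℕ) :
    IsHighestWeightVector (nPlus n) (cartan n) (theta n l) (monomial n l) where
  ne_zero := monomial_ne_zero n l
  raising x hx := (model n).lie_eq_zero_of_strictUpper (isHighest_monomial n l) fun p hp =>
    ⟨(hx _ _ (Fin.rev_le_rev.2 hp)).1, (hx _ _ hp).2⟩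
  weight x hx := by
    rw [(model n).lie_eq_smul_of_diag (isHighest_monomial n l) (x := x) (G := Finset.univ)
      (fun p hp => ⟨hx (by simpa using Ne.symm hp), hx (by simpa using hp)⟩)
      fun a ha => absurd (Finset.mem_univ a) ha]
    congr 1
    refine Finset.sum_congr rfl fun i _ => ?_
    rw [← weight_fin]
    rfl

end FinGL

/-! ### The infinite case in coordinates -/

namespace InfGL

open MvPolynomial

theorem entry_mul_unit (f : Op) (k l i j : ℤ) :
    entry (f * unit k l) i j = if j = l then entry f i k else 0 := by
  change f (Finsupp.single k ((Finsupp.single j (1 : ℂ)) l)) i = _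
  by_cases h : j = l
  · subst h
    rw [if_pos rfl, Finsupp.single_eq_same]
    rfl
  · rw [if_neg h, Finsupp.single_eq_of_ne (Ne.symm h), Finsupp.single_zero, map_zero]
    rfl

theorem entry_unit_mul (f : Op) (k l i j : ℤ) :
    entry (unit k l * f) i j = if i = k then entry f l j else 0 := by
  change (Finsupp.single k (f (Finsupp.single j 1) l)) i = _
  by_cases h : i = k
  · subst h
    rw [if_pos rfl, Finsupp.single_eq_same]
    rfl
  · rw [if_neg h, Finsupp.single_eq_of_ne h]

/-- The matrix entry as a linear map. -/
def entryHom (i j : ℤ) : Op →ₗ[ℂ] ℂ where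
  toFun f := entry f i j
  map_add' f g := entry_add f g i j
  map_smul' c f := entry_smul c f i j

theorem entry_sum {ι : Type*} (s : Finset ι) (f : ι → Op) (i j : ℤ) :
    entry (∑ k ∈ s, f k) i j = ∑ k ∈ s, entry (f k) i j := map_sum (entryHom i j) f s

theorem entry_neg (f : Op) (i j : ℤ) : entry (-f) i j = -entry f i j := map_neg (entryHom i j) f

variable (K : LieSubalgebra ℂ Op) (hK : ∀ i j : ℤ, unit i j ∈ K)

theorem coe_sum_aMinus {ι : Type*} (s : Finset ι) (f : ι → aMinus K) :
    ((∑ k ∈ s, f k : aMinus K) : Op) = ∑ k ∈ s, (f k : Op) := map_sum (aMinus K).incl f s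

/-- Matrices of `𝔞₋` are determined by their entries in the lower left block. -/
theorem aMinus_ext {X Y : aMinus K}
    (h : ∀ p q : ℕ, entry X (p + 1) (-q) = entry Y (p + 1) (-q)) : X = Y := by
  refine Subtype.ext (op_ext fun i j => ?_)
  by_cases hij : 1 ≤ i ∧ j ≤ 0
  · obtain ⟨p, hp⟩ := Int.eq_ofNat_of_zero_le (show 0 ≤ i - 1 by omega)
    obtain ⟨q, hq⟩ := Int.eq_ofNat_of_zero_le (show 0 ≤ -j by omega)
    have hi : i = p + 1 := by omega
    have hj : j = -q := by omega
    rw [hi, hj]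
    exact h p q
  · rw [X.2.2 i j hij, Y.2.2 i j hij]

theorem entry_unitA (p q r s : ℕ) :
    entry (unitA K hK p q) (r + 1) (-s) = if r = p ∧ s = q then 1 else 0 := by
  rw [unitA, entry_unit]
  congr 1
  simp

theorem entry_sum_unitA (F : Finset (ℕ × ℕ)) (g : ℕ × ℕ → ℂ) (r s : ℕ) :
    entry (∑ p ∈ F, g p • unitA K hK p.1 p.2 : aMinus K) (r + 1) (-s) =
      if (r, s) ∈ F then g (r, s) else 0 := by
  rw [coe_sum_aMinus, entry_sum, ← Finset.sum_ite_eq' F (r, s) g]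
  refine Finset.sum_congr rfl fun p _ => ?_
  change entry (g p • (unitA K hK p.1 p.2 : Op)) _ _ = _
  rw [entry_smul, entry_unitA]
  by_cases h : p = (r, s)
  · subst h; simp
  · have : ¬(r = p.1 ∧ s = p.2) := fun h' => h (Prod.ext h'.1.symm h'.2.symm)
    rw [if_neg h, if_neg this, mul_zero]

/-- The basis of matrix units of `𝔞₋`. -/
def basisA (hle : K ≤ glInf) : Module.Basis (ℕ × ℕ) ℂ (aMinus K) :=
  .mk (v := fun p => unitA K hK p.1 p.2)
    (by
      rw [linearIndependent_iff']
      intro F g h p hp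
      have h1 := entry_sum_unitA K hK F g p.1 p.2
      rw [h, if_pos hp] at h1
      exact h1.symm)
    (by
      rintro X -
      -- The entry at `(p + 1, -q)` lies at distance `p + q + 1` from the diagonal. A matrix with
      -- finitely many non-zero diagonals thus has finitely many entries in the lower left block, so
      -- the matrix units span `𝔞₋`.
      obtain ⟨d, hd⟩ := hle X.2.1
      have h : X = ∑ p ∈ Finset.range d.toNat ×ˢ Finset.range d.toNat,
          entry X (p.1 + 1) (-p.2) • unitA K hK p.1 p.2 := by
        refine aMinus_ext K fun r s => ?_
        rw [entry_sum_unitA K hK _ fun p : ℕ × ℕ => entry X (p.1 + 1) (-p.2)]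
        by_cases h : (r, s) ∈ Finset.range d.toNat ×ˢ Finset.range d.toNat
        · rw [if_pos h]
        · rw [if_neg h]
          refine hd _ _ ?_
          rw [Finset.mem_product, Finset.mem_range, Finset.mem_range] at h
          rw [abs_of_nonneg (by omega)]
          omega
      rw [h]
      exact Submodule.sum_mem _ fun p _ => Submodule.smul_mem _ _ (Submodule.subset_span ⟨p, rfl⟩))

theorem basisA_apply (hle : K ≤ glInf) (p : ℕ × ℕ) :
    basisA K hK hle p = unitA K hK p.1 p.2 := Module.Basis.mk_apply _ _ p

/-- The identification of `S*(𝔞₋)` with polynomials. -/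
def toPoly (hle : K ≤ glInf) : symA K ≃ₐ[ℂ] Poly :=
  SymmetricAlgebra.equivMvPolynomial (basisA K hK hle)

theorem toPoly_unitA (hle : K ≤ glInf) (p q : ℕ) :
    toPoly K hK hle (SymmetricAlgebra.ι ℂ _ (unitA K hK p q)) = X (p, q) := by
  have h : unitA K hK p q = basisA K hK hle (p, q) := (basisA_apply K hK hle (p, q)).symm
  rw [h]
  exact SymmetricAlgebra.equivMvPolynomial_ι_apply _ _

/-- The matrix units of `gl⁽¹⁾`, with the indices in reverse order, transposed. -/
def unit₁ (p : ℕ × ℕ) : gl₁ K :=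
  ⟨⟨unit (-p.2) (-p.1), unit (-p.2) (-p.1), hK _ _, 0, K.zero_mem,
    fun i j h => by rw [entry_unit, if_neg (by omega)], fun i j _ => rfl, (add_zero _).symm⟩,
    fun i j h => by
      change entry (unit _ _) i j = 0
      rw [entry_unit, if_neg (by omega)]⟩

/-- The matrix units of `gl⁽²⁾`. -/
def unit₂ (p : ℕ × ℕ) : gl₂ K :=
  ⟨⟨unit (p.1 + 1) (p.2 + 1), 0, K.zero_mem, unit (p.1 + 1) (p.2 + 1), hK _ _,
    fun i j _ => rfl, fun i j h => by rw [entry_unit, if_neg (by omega)], (zero_add _).symm⟩,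
    fun i j h => by
      change entry (unit _ _) i j = 0
      rw [entry_unit, if_neg (by omega)]⟩

theorem entry_lie_aMinus (x : glDiag K) (p q r s : ℕ) :
    entry ((⁅x, unitA K hK p q⁆ : aMinus K) : Op) (r + 1) (-s) =
      (if s = q then entry x (r + 1) (p + 1) else 0) -
        if r = p then entry x (-q) (-s) else 0 := by
  change entry ((x : Op) * unit (p + 1) (-q) - unit (p + 1) (-q) * (x : Op)) _ _ = _
  rw [entry_sub, entry_mul_unit, entry_unit_mul]
  congr 2 <;> simp

theorem unit₁_lie (p : ℕ × ℕ) (i j : ℕ) :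
    ⁅(unit₁ K hK p : glDiag K), unitA K hK i j⁆ =
      -if j = p.2 then unitA K hK i p.1 else 0 := by
  refine aMinus_ext K fun r s => ?_
  rw [entry_lie_aMinus]
  change (if s = j then entry (unit _ _) _ _ else 0) - (if r = i then entry (unit _ _) _ _ else 0) =
    entry (-((if j = p.2 then unitA K hK i p.1 else 0 : aMinus K) : Op)) _ _
  have hf : ¬((r : ℤ) + 1 = -(p.2 : ℤ) ∧ (i : ℤ) + 1 = -(p.1 : ℤ)) := by omega
  rw [entry_neg, entry_unit, entry_unit, if_neg hf]
  by_cases h : j = p.2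
  · rw [if_pos h, entry_unitA]
    by_cases h1 : r = i <;> by_cases h2 : s = p.1 <;> simp [h, h1, h2]
  · rw [if_neg h]
    simp [h]

theorem unit₂_lie (p : ℕ × ℕ) (i j : ℕ) :
    ⁅(unit₂ K hK p : glDiag K), unitA K hK i j⁆ =
      if i = p.2 then unitA K hK p.1 j else 0 := by
  refine aMinus_ext K fun r s => ?_
  rw [entry_lie_aMinus]
  change (if s = j then entry (unit _ _) _ _ else 0) - (if r = i then entry (unit _ _) _ _ else 0) =
    entry ((if i = p.2 then unitA K hK p.1 j else 0 : aMinus K) : Op) _ _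
  have hf : ¬(-(j : ℤ) = (p.1 : ℤ) + 1 ∧ -(s : ℤ) = (p.2 : ℤ) + 1) := by omega
  rw [entry_unit, entry_unit, if_neg hf]
  by_cases h : i = p.2
  · rw [if_pos h, entry_unitA]
    by_cases h1 : r = p.1 <;> by_cases h2 : s = j <;> simp [h, h1, h2]
  · rw [if_neg h]
    simp [h]

theorem toPoly_lie (hle : K ≤ glInf) (x : glDiag K) (D : Derivation ℂ Poly Poly)
    (h : ∀ i j, toPoly K hK hle (SymmetricAlgebra.ι ℂ _ ⁅x, unitA K hK i j⁆) = D (X (i, j)))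
    (s : symA K) : toPoly K hK hle ⁅x, s⁆ = D (toPoly K hK hle s) := by
  refine SymAction.map_act (toPoly K hK hle).toAlgHom D x (fun m => ?_) s
  have h' : (toPoly K hK hle).toLinearMap ∘ₗ SymmetricAlgebra.ι ℂ _ ∘ₗ
      LieModule.toEnd ℂ (glDiag K) _ x =
      D.toLinearMap ∘ₗ (toPoly K hK hle).toLinearMap ∘ₗ SymmetricAlgebra.ι ℂ _ := by
    refine (basisA K hK hle).ext fun p => ?_
    rw [basisA_apply]
    refine (h p.1 p.2).trans ?_
    rw [← toPoly_unitA]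
    rfl
  exact DFunLike.congr_fun h' m

/-- On one matrix unit `x` acts through a single column of its lower block and a single row of its
upper block, and both are finite because `x` has finitely many non-zero diagonals. -/
theorem lie_unitA_eq_sum (hle : K ≤ glInf) (x : glDiag K) (p q : ℕ) :
    ∃ F₀ : Finset (ℕ × ℕ), ∀ F, F₀ ⊆ F → ⁅x, unitA K hK p q⁆ =
      ∑ t ∈ F, ⁅entry x (-t.2) (-t.1) • (unit₁ K hK t : glDiag K) +
        entry x (t.1 + 1) (t.2 + 1) • (unit₂ K hK t : glDiag K), unitA K hK p q⁆ := by
  obtain ⟨d, hd⟩ := hle (glDiag_le K x.2)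
  set N := d.toNat + p + q + 1 with hN
  -- At the entry given by `(r, s)` only the indices `(r, p)` and `(s, q)` can contribute, and `N`
  -- is so large that the relevant entry of `x` vanishes when `r` or `s` is at least `N`.
  refine ⟨Finset.range N ×ˢ {p, q}, fun F hF => aMinus_ext K fun r s => ?_⟩
  have hterm : ∀ t : ℕ × ℕ, entry ((⁅entry x (-t.2) (-t.1) • (unit₁ K hK t : glDiag K) +
        entry x (t.1 + 1) (t.2 + 1) • (unit₂ K hK t : glDiag K), unitA K hK p q⁆ : aMinus K) : Op)
        (r + 1) (-s) =
      (if t = (r, p) then if s = q then entry x (r + 1) (p + 1) else 0 else 0) -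
        if t = (s, q) then if r = p then entry x (-q) (-s) else 0 else 0 := by
    rintro ⟨a, b⟩
    rw [add_lie, smul_lie, smul_lie, unit₁_lie, unit₂_lie]
    change entry (entry x (-b) (-a) • (-((if q = b then unitA K hK p a else 0 : aMinus K) : Op)) +
      entry x (a + 1) (b + 1) • ((if p = b then unitA K hK a q else 0 : aMinus K) : Op)) _ _ = _
    rw [entry_add, entry_smul, entry_smul, entry_neg]
    have h1 : entry ((if q = b then unitA K hK p a else 0 : aMinus K) : Op) (r + 1) (-s) =
        if q = b ∧ r = p ∧ s = a then 1 else 0 := by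
      by_cases h : q = b
      · rw [if_pos h, entry_unitA]; simp [h]
      · rw [if_neg h]; simp [h]
    have h2 : entry ((if p = b then unitA K hK a q else 0 : aMinus K) : Op) (r + 1) (-s) =
        if p = b ∧ r = a ∧ s = q then 1 else 0 := by
      by_cases h : p = b
      · rw [if_pos h, entry_unitA]; simp [h]
      · rw [if_neg h]; simp [h]
    rw [h1, h2, add_comm, sub_eq_add_neg]
    congr 1
    · by_cases h : p = b ∧ r = a ∧ s = q
      · obtain ⟨rfl, rfl, rfl⟩ := h
        simp
      · rw [if_neg h, mul_zero]
        split_ifs with h3 h4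
        · simp only [Prod.mk.injEq] at h3
          exact absurd ⟨h3.2.symm, h3.1.symm, h4⟩ h
        · rfl
        · rfl
    · by_cases h : q = b ∧ r = p ∧ s = a
      · obtain ⟨rfl, rfl, rfl⟩ := h
        simp
      · rw [if_neg h, neg_zero, mul_zero]
        split_ifs with h3 h4
        · simp only [Prod.mk.injEq] at h3
          exact absurd ⟨h3.2.symm, h4, h3.1.symm⟩ h
        · rw [neg_zero]
        · rw [neg_zero]
  rw [entry_lie_aMinus, coe_sum_aMinus, entry_sum, Finset.sum_congr rfl fun t _ => hterm t,
    Finset.sum_sub_distrib, Finset.sum_ite_eq', Finset.sum_ite_eq']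
  congr 1
  · by_cases hr : (r, p) ∈ F
    · rw [if_pos hr]
    · have hrN : ¬r < N := fun h => hr (hF (by simp [h]))
      rw [if_neg hr, hd (r + 1) (p + 1) (by rw [abs_of_nonneg (by omega)]; omega), ite_self]
  · by_cases hr : (s, q) ∈ F
    · rw [if_pos hr]
    · have hrN : ¬s < N := fun h => hr (hF (by simp [h]))
      rw [if_neg hr, hd (-q) (-s) (by rw [abs_of_nonneg (by omega)]; omega), ite_self]

/-- `S*(𝔞₋)` as the space of polynomials in the entries of a matrix. -/
def model (hle : K ≤ glInf) : PolarizationModel ℕ (symA K) (gl₁ K) (gl₂ K) where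
  idx := id
  idx_lower a m h := ⟨m, rfl⟩
  toPoly := (toPoly K hK hle).toLinearMap
  injective := (toPoly K hK hle).injective
  vars s v hv := ⟨⟨v.1, rfl⟩, v.2, rfl⟩
  e₁ := unit₁ K hK
  e₂ := unit₂ K hK
  toPoly_e₁ p s := by
    refine toPoly_lie K hK hle (unit₁ K hK p : glDiag K) (-colOp p.1 p.2) (fun i j => ?_) s
    rw [unit₁_lie, Derivation.neg_apply, colOp_X, map_neg, map_neg]
    by_cases h : j = p.2
    · rw [if_pos h, if_pos h, toPoly_unitA]
    · rw [if_neg h, if_neg h, map_zero, map_zero]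
  toPoly_e₂ p s := by
    refine toPoly_lie K hK hle (unit₂ K hK p : glDiag K) (rowOp p.1 p.2) (fun i j => ?_) s
    rw [unit₂_lie, rowOp_X]
    by_cases h : i = p.2
    · rw [if_pos h, if_pos h, toPoly_unitA]
    · rw [if_neg h, if_neg h, map_zero, map_zero]
  c₁ x p := entry x (-p.2) (-p.1)
  c₂ x p := entry x (p.1 + 1) (p.2 + 1)
  c₁_eq_zero x p := x.2 _ _ (by omega)
  c₂_eq_zero x p := x.2 _ _ (by omega)
  lie_eq_sum x s := by
    obtain ⟨F₀, hF⟩ := SymAction.act_eq_sum (basisA K hK hle) x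
      (fun t : ℕ × ℕ => entry x (-t.2) (-t.1) • (unit₁ K hK t : glDiag K) +
        entry x (t.1 + 1) (t.2 + 1) • (unit₂ K hK t : glDiag K))
      (fun i => by rw [basisA_apply]; exact lie_unitA_eq_sum K hK hle x i.1 i.2) s
    refine ⟨F₀, fun F hle => (hF F hle).trans (Finset.sum_congr rfl fun p _ => ?_)⟩
    rw [SymAction.act_add, SymAction.act_smul, SymAction.act_smul]
    rfl
  lie_eq_zero x y := by
    refine Subtype.ext ?_
    change ((x : glDiag K) : Op) * ((y : glDiag K) : Op) -
      ((y : glDiag K) : Op) * ((x : glDiag K) : Op) = 0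
    rw [InBlock₁.mul_block₂ x.2 y.2, InBlock₂.mul_block₁ y.2 x.2, sub_zero]
  exists_add x := by
    obtain ⟨f, g, hg, h, hh, hg1, hh2, rfl⟩ := x
    exact ⟨⟨⟨g, g, hg, 0, K.zero_mem, hg1, fun _ _ _ => rfl, (add_zero _).symm⟩, hg1⟩,
      ⟨⟨h, 0, K.zero_mem, h, hh, fun _ _ _ => rfl, hh2, (zero_add _).symm⟩, hh2⟩, rfl⟩

theorem toPoly_det (hle : K ≤ glInf) (k : ℕ) : toPoly K hK hle (det K hK k) = minor k := by
  rw [det, AlgEquiv.map_det, minor]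
  congr 1
  ext1 p q
  change toPoly K hK hle (SymmetricAlgebra.ι ℂ _ _) = X _
  rw [toPoly_unitA]

/-- Conjugation of partitions: the columns longer than `a` are those that meet row `a`. -/
theorem sum_colLen (D : YoungDiagram) (a : ℕ) :
    ∑ c ∈ Finset.range (D.rowLen 0), (if a < D.colLen c then 1 else 0) = D.rowLen a := by
  rw [← Finset.card_filter]
  have h : (Finset.range (D.rowLen 0)).filter (fun c => a < D.colLen c) =
      Finset.range (D.rowLen a) := by
    ext c
    rw [Finset.mem_filter, Finset.mem_range, Finset.mem_range, ← YoungDiagram.mem_iff_lt_colLen,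
      YoungDiagram.mem_iff_lt_rowLen]
    exact ⟨fun h => h.2, fun h => ⟨h.trans_le (D.rowLen_anti 0 a (Nat.zero_le a)), h⟩⟩
  rw [h, Finset.card_range]

theorem isHighest_monomial (hle : K ≤ glInf) (D : YoungDiagram) :
    IsHighest ((model K hK hle).toPoly (monomial K hK D)) D.rowLen := by
  have h : (model K hK hle).toPoly (monomial K hK D) =
      ∏ c ∈ Finset.range (D.rowLen 0), minor (D.colLen c) := by
    change toPoly K hK hle (∏ c ∈ Finset.range (D.rowLen 0), det K hK (D.colLen c)) = _
    simp [map_prod, toPoly_det]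
  rw [h]
  convert IsHighest.prod (Finset.range (D.rowLen 0)) fun c _ => isHighest_minor (D.colLen c) using 1
  ext a
  rw [Finset.sum_apply, sum_colLen]

theorem monomial_ne_zero (hle : K ≤ glInf) (D : YoungDiagram) : monomial K hK D ≠ 0 := by
  intro h
  have h' := congrArg (toPoly K hK hle) h
  rw [monomial, map_prod, map_zero, Finset.prod_eq_zero_iff] at h'
  obtain ⟨k, -, hk⟩ := h'
  rw [toPoly_det] at hk
  exact minor_ne_zero _ hk

theorem isHighestWeightVector_monomial (hle : K ≤ glInf) (D : YoungDiagram) :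
    IsHighestWeightVector (nPlus K) (cartan K) (theta K D) (monomial K hK D) where
  ne_zero := monomial_ne_zero K hK hle D
  raising x hx := (model K hK hle).lie_eq_zero_of_strictUpper (isHighest_monomial K hK hle D)
    fun p hp => by
      have hp' : p.2 ≤ p.1 := hp
      exact ⟨hx _ _ (by omega), hx _ _ (by omega)⟩
  weight x hx := by
    rw [(model K hK hle).lie_eq_smul_of_diag (isHighest_monomial K hK hle D) (x := x)
      (G := Finset.range (D.colLen 0))
      (fun p hp => ⟨hx _ _ (by omega), hx _ _ (by omega)⟩)
      fun a ha => YoungDiagram.colLen_zero_le_iff.1 le_rfl a (by simpa using ha)]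
    rfl

end InfGL

theorem lemma1p1p2 :
    -- finite `n`
    (∀ n : ℕ,
      (∀ l : Fin n → ℕ,
        IsHighestWeightVector (FinGL.nPlus n) (FinGL.cartan n) (FinGL.theta n l)
          (FinGL.monomial n l) ∧
        FiniteDimensional ℂ (FinGL.L₁ n l) ∧
        LieModule.IsIrreducible ℂ (FinGL.gl₁ n) (FinGL.L₁ n l) ∧
        FiniteDimensional ℂ (FinGL.L₂ n l) ∧
        LieModule.IsIrreducible ℂ (FinGL.gl₂ n) (FinGL.L₂ n l) ∧
        LieModule.IsIrreducible ℂ (FinGL.glDiag n) (FinGL.W n l) ∧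
        IsExternalTensor (FinGL.gl₁ n) (FinGL.gl₂ n)
          (FinGL.L₁ n l) (FinGL.L₂ n l) (FinGL.W n l)) ∧
      iSupIndep (fun l : Fin n → ℕ => (FinGL.W n l).toSubmodule) ∧
      (⨆ l : Fin n → ℕ, (FinGL.W n l).toSubmodule) = ⊤ ∧
      -- the summands are indexed by the Young diagrams with at most `n` rows
      ∃ e : (Fin n → ℕ) ≃ {D : YoungDiagram // D.colLen 0 ≤ n},
        ∀ (l : Fin n → ℕ) (i : Fin n),
          (e l).1.rowLen i = ∑ k ∈ Finset.Ici i, l k) ∧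
    -- `n = ∞`
    (∀ (K : LieSubalgebra ℂ InfGL.Op) (hK : ∀ i j : ℤ, InfGL.unit i j ∈ K),
      K ≤ InfGL.glInf →
      (∀ D : YoungDiagram,
        IsHighestWeightVector (InfGL.nPlus K) (InfGL.cartan K) (InfGL.theta K D)
          (InfGL.monomial K hK D) ∧
        LieModule.IsIrreducible ℂ (InfGL.gl₁ K) (InfGL.L₁ K hK D) ∧
        LieModule.IsIrreducible ℂ (InfGL.gl₂ K) (InfGL.L₂ K hK D) ∧
        LieModule.IsIrreducible ℂ (InfGL.glDiag K) (InfGL.W K hK D) ∧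
        IsExternalTensor (InfGL.gl₁ K) (InfGL.gl₂ K)
          (InfGL.L₁ K hK D) (InfGL.L₂ K hK D) (InfGL.W K hK D)) ∧
      iSupIndep (fun D : YoungDiagram => (InfGL.W K hK D).toSubmodule) ∧
      (⨆ D : YoungDiagram, (InfGL.W K hK D).toSubmodule) = ⊤) := by
  refine ⟨fun n => ⟨fun l => ?_, ?_, ?_, FinGL.exists_equiv_youngDiagram n⟩,
    fun K hK hle => ⟨fun D => ?_, ?_, ?_⟩⟩
  · have hw := FinGL.isHighest_monomial n l
    have h0 := FinGL.monomial_ne_zero n l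
    have hn : ∀ a : Fin n, (FinGL.model n).idx a < n := fun a => a.2
    exact ⟨FinGL.isHighestWeightVector_monomial n l, (FinGL.model n).finiteDimensional₁ hn _,
      (FinGL.model n).isIrreducible₁ hw h0, (FinGL.model n).finiteDimensional₂ hn _,
      (FinGL.model n).isIrreducible₂ hw h0, (FinGL.model n).isIrreducible hw h0,
      (FinGL.model n).isExternalTensor hw⟩
  · exact (FinGL.model n).iSupIndep_lieSpan (FinGL.isHighest_monomial n) (FinGL.weight_injective n)
  · exact (FinGL.model n).iSup_lieSpan_eq_top (FinGL.isHighest_monomial n)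
      (FinGL.monomial_ne_zero n) fun μ hμ _ h0 => FinGL.exists_weight_eq hμ fun a ha =>
        h0 a fun i hi => by
          have : (i : ℕ) = a := hi
          omega
  · have hw := InfGL.isHighest_monomial K hK hle D
    have h0 := InfGL.monomial_ne_zero K hK hle D
    exact ⟨InfGL.isHighestWeightVector_monomial K hK hle D,
      (InfGL.model K hK hle).isIrreducible₁ hw h0, (InfGL.model K hK hle).isIrreducible₂ hw h0,
      (InfGL.model K hK hle).isIrreducible hw h0, (InfGL.model K hK hle).isExternalTensor hw⟩
  · exact (InfGL.model K hK hle).iSupIndep_lieSpan (InfGL.isHighest_monomial K hK hle)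
      fun D D' h => YoungDiagram.ext_rowLen fun a => congrFun h a
  -- Every natural number is a position here, so it is the eventual vanishing of the weight that
  -- makes it a Young diagram; for finite `n` it was the vanishing off the positions.
  · refine (InfGL.model K hK hle).iSup_lieSpan_eq_top (InfGL.isHighest_monomial K hK hle)
      (InfGL.monomial_ne_zero K hK hle) fun μ hμ hn _ => ?_
    obtain ⟨n, hn⟩ := hn
    obtain ⟨D, hD⟩ := YoungDiagram.exists_rowLen_eq hμ hn
    exact ⟨D, funext hD⟩

end
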